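/- Let $m\ge 2$ and $g\ge 2$. Let $X$ be the closed oriented surface of genus $g$, obtained from a $4g$-gon with boundary word $e_1f_1e_1^{-1}f_1^{-1}\cdots e_gf_ge_g^{-1}f_g^{-1}$, and let $X^\circ$ be $X$ without the centre of the polygon, so that $\pi_1(X^\circ)$ is free on $e_1,f_1,\dots,e_g,f_g$ and $\prod_i[e_i,f_i]$ is the loop around the puncture. Let $H=\langle\sigma,\tau,\zeta \mid [\sigma,\tau]=\zeta,\ \zeta \text{ central},\ \sigma^m=\tau^m=\zeta^m=1\rangle$ be the Heisenberg group over $\mathbb Z/m$ and let $Q=\langle\zeta\rangle\cong\mathbb Z/m$. Let $W\to X$ be the branched covering with deck group $H$ that is obtained from the regular covering of $X^\circ$ given by $e_1\mapsto\sigma$, $f_1\mapsto\tau$, all other generators $\mapsto 1$, by filling in the punctures, and let $Z=W/\langle\tau\rangle$. Equivalently, $Z\to X$ has fibre $(\mathbb Z/m)^2$ over the base point and monodromy $e_1:(i,j)\mapsto(i+1,j)$, $f_1:(i,j)\mapsto(i,j+i)$, with all other generators acting trivially. The group $Q$ acts on $Z$ by $\zeta:(i,j)\mapsto(i,j+1)$.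 For a finite group $G$ acting on a surface with intersection form $(\cdot,\cdot)$, the Reidemeister pairing is $\langle x,y\rangle_G=\sum_{h\in G}(x,hy)\,h$. Let $M_m\subset H_1(W;\mathbb Q)$ and $N_m\subset H_1(Z;\mathbb Q)$ be the isotypic factors on which $\zeta$ acts with order $m$, i.e. the kernels of $\Phi_m(\zeta)$, where $\Phi_m$ is the $m$-th cyclotomic polynomial. Let $\mathbf G_m=\mathrm{Aut}_H(M_m,\langle\cdot,\cdot\rangle_H)$ and $\mathbf G_m^{nn}=\mathrm{Aut}_Q(N_m,\langle\cdot,\cdot\rangle_Q)$, regarded as algebraic groups over $\mathbb Q$, i.e. as functors on commutative $\mathbb Q$-algebras. 1. The transfer $t:H_1(Z;k)\to H_1(W;k)$ of the covering $W\to Z$ restricts to a bijection $N_m\to M_m^{\langle\tau\rangle}$, for every commutative $\mathbb Q$-algebra $k$ as coefficients. Under this identification, restriction of automorphisms to the $\tau$-invariants is an isomorphism $\alpha_m:\mathbf G_m\to\mathbf G_m^{nn}$: for every commutative $\mathbb Q$-algebra $k$ there is a group isomorphism $\alpha_m:\mathbf G_m(k)\to\mathbf G_m^{nn}(k)$ with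 $t(\alpha_m(f)(n))=f(t(n))$ for all $f$ and $n$, and it is natural in $k$. 2. Let $A_m\subset\mathbb Q[H]$ be the ideal on which $\zeta$ acts with order $m$ (the annihilator of $\Phi_m(\zeta)$), let $\zeta_m$ be a primitive $m$-th root of unity and let $\rho:\mathbb Q[H]\to M_m(\mathbb Q(\zeta_m))$ be given by $\rho(\sigma)e_j=e_{j+1}$, $\rho(\tau)e_j=\zeta_m^je_j$, $\rho(\zeta)=\zeta_m^{-1}$, with indices $j\in\mathbb Z/m$. Then $\rho$ maps $A_m$ isomorphically onto $M_m(\mathbb Q(\zeta_m))$, and $\zeta\mapsto\zeta_m^{-1}$ maps the corresponding ideal of $\mathbb Q[Q]$ isomorphically onto $\mathbb Q(\zeta_m)$; in this way $M_m$ is an $A_m$-module and $N_m$ a $\mathbb Q(\zeta_m)$-vector space. The $A_m$-module $M_m$ is free of rank $d=2g-1$. For every $A_m$-basis $x_1,\dots,x_d$ of $M_m$, the vectors $E_{0i}x_a$ (where $E_{ij}\in A_m$ are the matrix units under $\rho$, $1\le a\le d$, $i\in\mathbb Z/m$) correspond under $t$ to a $\mathbb Q(\zeta_m)$-basis $y_{(a,i)}$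 of $N_m$. Let $C=(\rho(\langle x_a,x_b\rangle_H)_{ij})_{(a,i),(b,j)}$ and $B=(\langle y_p,y_q\rangle_Q)_{p,q}$ be the Gram matrices in $M_{md}(\mathbb Q(\zeta_m))$ of the two Reidemeister forms. Then $C$ is a nonzero rational multiple of $B$, so that $B$ and $C$ define the same unitary group $\{A\in \mathrm{GL}_{md}(\mathbb Q(\zeta_m)): A^tB\bar A=B\}=\{A: A^tC\bar A=C\}$, where the bar is $\zeta_m\mapsto\zeta_m^{-1}$. Moreover, expressing automorphisms by matrices in these bases (an automorphism $f$ with $f(x_b)=\sum_a\gamma_{ab}x_a$, $\gamma_{ab}\in A_m$, has the matrix with entry $\rho(\gamma_{ab})_{ji}$ at $((a,i),(b,j))$) gives isomorphisms of $\mathbf G_m(\mathbb Q)$ and $\mathbf G_m^{nn}(\mathbb Q)$ with this unitary group, and $f$ and $\alpha_m(f)$ have the same matrix. -/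

import Mathlib

open Polynomial

/-! ### Closed oriented surfaces glued from polygons, and their homology -/

/-- A closed oriented surface (not necessarily connected) glued from finitely many oriented polygons.
A *dart* is a side of a polygon, directed along the boundary orientation of its polygon, i.e. a
directed edge of the cell structure with the polygon on its left. `face d` is the side that follows
`d` on the boundary of its polygon, and `rev d` is the side that is glued to `d` (with the opposite
direction). So polygons are the orbits of `face` and edges are the orbits of `rev`. -/
structure PolySurface where
  Dart : Type
  [fintypeDart : Fintype Dart]
  rev : Equiv.Perm Dart
  face : Equiv.Perm Dart
  rev_rev : ∀ d, rev (rev d) = d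
  rev_ne : ∀ d, rev d ≠ d

attribute [instance] PolySurface.fintypeDart

namespace PolySurface

/-- The next dart, counterclockwise, with the same initial vertex. Vertices are the orbits. -/
def rot (M : PolySurface) : Equiv.Perm M.Dart := M.face.symm.trans M.rev

/-- The number of darts that issue from the initial vertex of `d`. -/
noncomputable def deg (M : PolySurface) (d : M.Dart) : ℕ := Function.minimalPeriod M.rot d

section Homology

variable (k : Type) [CommRing k]

/-- Cellular 1-cycles. A 1-chain is a function `c` on darts with `c (rev d) = - c d` (the coefficient
of the directed edge `d`); its boundary at a vertex vanishes iff the sum of `c` over the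
darts that issue from this vertex does. -/
def cycles (M : PolySurface) : Submodule k (M.Dart → k) where
  carrier := {c | (∀ d, c (M.rev d) = - c d) ∧
    ∀ d, ∑ j ∈ Finset.range (M.deg d), c ((M.rot ^ j) d) = 0}
  zero_mem' := by simp
  add_mem' := by
    rintro x y ⟨hx, hx'⟩ ⟨hy, hy'⟩
    refine ⟨fun d => ?_, fun d => ?_⟩
    · simp only [Pi.add_apply, hx, hy]; ring
    · simp only [Pi.add_apply, Finset.sum_add_distrib, hx', hy', add_zero]
  smul_mem' := by
    rintro r x ⟨hx, hx'⟩
    refine ⟨fun d => ?_, fun d => ?_⟩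
    · simp only [Pi.smul_apply, hx, smul_neg]
    · simp only [Pi.smul_apply, ← Finset.smul_sum, hx', smul_zero]

/-- Cellular 1-boundaries. A 2-chain is a function `u` on darts that is constant on each polygon; the
coefficient of the directed edge `d` in its boundary is the value of `u` on the polygon on the
left of `d` minus the value on the polygon on the right. -/
def boundaries (M : PolySurface) : Submodule k (M.Dart → k) where
  carrier := {c | ∃ u : M.Dart → k, (∀ d, u (M.face d) = u d) ∧ ∀ d, c d = u d - u (M.rev d)}
  zero_mem' := ⟨0, by simp⟩
  add_mem' := by
    rintro x y ⟨u, hu, hu'⟩ ⟨v, hv, hv'⟩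
    refine ⟨u + v, fun d => ?_, fun d => ?_⟩
    · simp [hu, hv]
    · simp only [Pi.add_apply, hu', hv']; ring
  smul_mem' := by
    rintro r x ⟨u, hu, hu'⟩
    refine ⟨r • u, fun d => ?_, fun d => ?_⟩
    · simp [hu]
    · simp only [Pi.smul_apply, hu', smul_sub]

/-- The first homology `H₁(M; k)`. -/
abbrev H1 (M : PolySurface) : Type := M.cycles k ⧸ (M.boundaries k).submoduleOf (M.cycles k)

end Homology

/-- Boundaries are cycles. -/
theorem boundaries_le_cycles (k : Type) [CommRing k] (M : PolySurface) :
    M.boundaries k ≤ M.cycles k := by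
  rintro c ⟨u, hu, hc⟩
  have key : ∀ d, u (M.rev (M.rot d)) = u d := by
    intro d
    have h := hu (M.face.symm d)
    simp only [Equiv.apply_symm_apply] at h
    simp [rot, M.rev_rev, h]
  refine ⟨fun d => by rw [hc, hc, M.rev_rev]; ring, fun d => ?_⟩
  have h1 : ∀ n, ∑ j ∈ Finset.range n, c ((M.rot ^ j) d) =
      u ((M.rot ^ n) (M.rot.symm d)) - u (M.rot.symm d) := by
    intro n
    induction n with
    | zero => simp
    | succ n ih =>
      rw [Finset.sum_range_succ, ih, hc]
      have e1 : (M.rot ^ (n + 1)) (M.rot.symm d) = (M.rot ^ n) d := by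
        rw [pow_succ, Equiv.Perm.mul_apply, Equiv.apply_symm_apply]
      have e2 : (M.rot ^ n) d = M.rot ((M.rot ^ n) (M.rot.symm d)) := by
        rw [← e1, pow_succ', Equiv.Perm.mul_apply]
      rw [e1]
      have e3 := key ((M.rot ^ n) (M.rot.symm d))
      rw [← e2] at e3
      rw [e3]; ring
  rw [h1]
  have e : (M.rot ^ M.deg d) d = d := by
    have := Function.iterate_minimalPeriod (f := M.rot) (x := d)
    rwa [← Equiv.Perm.coe_pow] at this
  have : (M.rot ^ M.deg d) (M.rot.symm d) = M.rot.symm d := by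
    apply M.rot.injective
    rw [← Equiv.Perm.mul_apply, ← pow_succ', pow_succ, Equiv.Perm.mul_apply,
      Equiv.apply_symm_apply, e]
  rw [this, sub_self]

section Intersection

variable (k : Type) [CommRing k] [Algebra ℚ k]

/-- The crossing form of 1-chains. At a vertex with darts `d₀, …, dₙ₋₁` in counterclockwise order,
cycles `x`, `y` cross `½ ∑_{i < j} (x(dᵢ) y(dⱼ) - x(dⱼ) y(dᵢ))` times; this does not depend on the
dart from which one starts to count. Averaged over the `n` possible starts, the weight of
`x(d) y(rotʲ d)`, `0 < j < n`, is `½ (1 - 2 j / n)`. -/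
noncomputable def crossing (M : PolySurface) : LinearMap.BilinForm k (M.Dart → k) :=
  LinearMap.mk₂ k
    (fun x y => ∑ d, ∑ j ∈ Finset.Ico 1 (M.deg d),
      ((1 / 2 : ℚ) * (1 - 2 * (j : ℚ) / (M.deg d : ℚ))) • (x d * y ((M.rot ^ j) d)))
    (fun x x' y => by simp only [Pi.add_apply, add_mul, smul_add, Finset.sum_add_distrib])
    (fun r x y => by
      simp only [Pi.smul_apply, smul_mul_assoc, Finset.smul_sum]
      exact Finset.sum_congr rfl fun _ _ => Finset.sum_congr rfl fun _ _ => smul_comm _ _ _)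
    (fun x y y' => by simp only [Pi.add_apply, mul_add, smul_add, Finset.sum_add_distrib])
    (fun r x y => by
      simp only [Pi.smul_apply, mul_smul_comm, Finset.smul_sum]
      exact Finset.sum_congr rfl fun _ _ => Finset.sum_congr rfl fun _ _ => smul_comm _ _ _)

/-- The functional `L` with `crossing x y = ∑ d, x d * L d`. -/
noncomputable def crossFun (M : PolySurface) (y : M.Dart → k) (d : M.Dart) : k :=
  ∑ j ∈ Finset.Ico 1 (M.deg d),
    ((1 / 2 : ℚ) * (1 - 2 * (j : ℚ) / (M.deg d : ℚ))) • y ((M.rot ^ j) d)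

theorem deg_pos (M : PolySurface) (d : M.Dart) : 0 < M.deg d := by
  classical
  exact Function.minimalPeriod_pos_of_mem_periodicPts
    (M.rot.injective.mem_periodicPts d)

theorem deg_rot (M : PolySurface) (d : M.Dart) : M.deg (M.rot d) = M.deg d :=
  Function.minimalPeriod_apply (M.rot.injective.mem_periodicPts d)

theorem deg_rot_pow (M : PolySurface) (d : M.Dart) (j : ℕ) :
    M.deg ((M.rot ^ j) d) = M.deg d := by
  induction j with
  | zero => simp
  | succ j ih => rw [pow_succ', Equiv.Perm.mul_apply, deg_rot, ih]

theorem rot_pow_deg (M : PolySurface) (d : M.Dart) : (M.rot ^ M.deg d) d = d := by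
  have := Function.iterate_minimalPeriod (f := M.rot) (x := d)
  rwa [← Equiv.Perm.coe_pow] at this

theorem crossing_eq (M : PolySurface) (x y : M.Dart → k) :
    M.crossing k x y = ∑ d, x d * M.crossFun k y d := by
  simp only [crossing, crossFun, LinearMap.mk₂_apply, Finset.mul_sum, mul_smul_comm]

theorem crossFun_rot (M : PolySurface) (y : M.Dart → k) (hy : y ∈ M.cycles k)
    (d : M.Dart) : M.crossFun k y (M.rot d) =
      M.crossFun k y d - (1 / 2 : ℚ) • y d - (1 / 2 : ℚ) • y (M.rot d) := by
  obtain ⟨N, hN⟩ : ∃ N, M.deg d = N + 1 := ⟨M.deg d - 1, by have := M.deg_pos d; omega⟩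
  have hs := hy.2 d
  have hper := M.rot_pow_deg d
  simp only [crossFun, deg_rot]
  rw [hN] at hs hper ⊢
  rw [Finset.sum_Ico_eq_sum_range, Finset.sum_Ico_eq_sum_range]
  simp only [Nat.add_sub_cancel]
  have hN0 : ((N : ℚ) + 1) ≠ 0 := by positivity
  have hshift : ∀ j : ℕ, (M.rot ^ j) (M.rot d) = (M.rot ^ (j + 1)) d := fun j => by
    rw [pow_succ, Equiv.Perm.mul_apply]
  simp only [hshift]
  set f : ℕ → k := fun j => y ((M.rot ^ j) d) with hf
  have hf0 : y d = f 0 := by simp [hf]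
  have hf1 : y (M.rot d) = f 1 := by simp [hf]
  have hfN : f (N + 1) = f 0 := by simp only [hf]; rw [hper]; simp
  have e1 : ∀ j, y ((M.rot ^ j) d) = f j := fun _ => rfl
  simp only [e1] at hs ⊢
  rw [hf0, hf1]
  rw [Finset.sum_range_succ'] at hs
  set w : ℕ → ℚ := fun j => 1 / 2 * (1 - 2 * (j : ℚ) / ((N + 1 : ℕ) : ℚ)) with hw
  have hA : ∑ x ∈ Finset.range N, w (1 + x) • f (1 + x + 1) =
      ∑ x ∈ Finset.range N, w x • f (x + 1) + w N • f (N + 1) - w 0 • f 1 := by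
    rw [← Finset.sum_range_succ (fun x => w x • f (x + 1)), Finset.sum_range_succ']
    simp [add_comm 1]
  have hB : ∑ x ∈ Finset.range N, w x • f (x + 1) =
      ∑ x ∈ Finset.range N, w (1 + x) • f (1 + x) +
        (1 / ((N : ℚ) + 1)) • ∑ x ∈ Finset.range N, f (x + 1) := by
    rw [Finset.smul_sum, ← Finset.sum_add_distrib]
    refine Finset.sum_congr rfl fun x _ => ?_
    rw [add_comm 1 x, ← add_smul]
    congr 1
    simp only [hw]; push_cast; field_simp; ring
  have hs' : ∑ x ∈ Finset.range N, f (x + 1) = - f 0 := eq_neg_of_add_eq_zero_left hs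
  have hwN : w N = 1 / ((N : ℚ) + 1) - 1 / 2 := by
    simp only [hw]; push_cast; field_simp; ring
  have hw0 : w 0 = 1 / 2 := by simp [hw]
  change ∑ x ∈ Finset.range N, w (1 + x) • f (1 + x + 1) =
    ∑ x ∈ Finset.range N, w (1 + x) • f (1 + x) - _ - _
  rw [hA, hB, hs', hfN, hwN, hw0, sub_smul, smul_neg]
  abel

theorem crossing_boundary_left (M : PolySurface) {x y : M.Dart → k}
    (hx : x ∈ M.boundaries k) (hy : y ∈ M.cycles k) : M.crossing k x y = 0 := by
  obtain ⟨u, hu, hx⟩ := hx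
  rw [crossing_eq]
  have hrot : ∀ d, M.rot (M.face d) = M.rev d := fun d => by simp [rot]
  have key : ∀ d, M.crossFun k y (M.rev d) =
      M.crossFun k y (M.face d) - (1 / 2 : ℚ) • y (M.face d) + (1 / 2 : ℚ) • y d := fun d => by
    rw [← hrot, crossFun_rot k M y hy, hrot, hy.1, smul_neg]; abel
  have h1 : ∑ d, u (M.rev d) * M.crossFun k y d = ∑ d, u d * M.crossFun k y (M.rev d) := by
    rw [← Equiv.sum_comp M.rev]
    simp [M.rev_rev]
  have h2 : ∀ F : M.Dart → k, ∑ d, u d * F (M.face d) = ∑ d, u d * F d := fun F => by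
    rw [← Equiv.sum_comp M.face (fun d => u d * F d)]
    simp [hu]
  simp only [hx, sub_mul, Finset.sum_sub_distrib, h1, key, mul_add, mul_sub,
    Finset.sum_add_distrib]
  rw [h2, h2 (fun d => (1 / 2 : ℚ) • y d)]
  abel

/-- The crossing form is alternating. -/
theorem crossing_neg (M : PolySurface) (x y : M.Dart → k) :
    M.crossing k y x = - M.crossing k x y := by
  simp only [crossing, LinearMap.mk₂_apply]
  rw [← Finset.sum_neg_distrib]
  simp only [← Finset.sum_neg_distrib]
  rw [Finset.sum_sigma', Finset.sum_sigma']
  refine Finset.sum_bij' (fun p _ => ⟨(M.rot ^ p.2) p.1, M.deg p.1 - p.2⟩)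
    (fun p _ => ⟨(M.rot ^ p.2) p.1, M.deg p.1 - p.2⟩) ?_ ?_ ?_ ?_ ?_
  · rintro ⟨d, j⟩ h
    simp only [Finset.mem_sigma, Finset.mem_univ, Finset.mem_Ico, true_and, deg_rot_pow] at h ⊢
    omega
  · rintro ⟨d, j⟩ h
    simp only [Finset.mem_sigma, Finset.mem_univ, Finset.mem_Ico, true_and, deg_rot_pow] at h ⊢
    omega
  · rintro ⟨d, j⟩ h
    simp only [Finset.mem_sigma, Finset.mem_univ, Finset.mem_Ico, true_and] at h
    simp only [deg_rot_pow, Sigma.mk.injEq, heq_eq_eq]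
    refine ⟨?_, by omega⟩
    rw [← Equiv.Perm.mul_apply, ← pow_add, Nat.sub_add_cancel h.2.le, rot_pow_deg]
  · rintro ⟨d, j⟩ h
    simp only [Finset.mem_sigma, Finset.mem_univ, Finset.mem_Ico, true_and] at h
    simp only [deg_rot_pow, Sigma.mk.injEq, heq_eq_eq]
    refine ⟨?_, by omega⟩
    rw [← Equiv.Perm.mul_apply, ← pow_add, Nat.sub_add_cancel h.2.le, rot_pow_deg]
  · rintro ⟨d, j⟩ h
    simp only [Finset.mem_sigma, Finset.mem_univ, Finset.mem_Ico, true_and] at h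
    simp only [deg_rot_pow]
    rw [← Equiv.Perm.mul_apply, ← pow_add, Nat.sub_add_cancel h.2.le, rot_pow_deg, ← neg_smul,
      mul_comm (y d)]
    congr 1
    have : (M.deg d : ℚ) ≠ 0 := by
      have := M.deg_pos d
      positivity
    rw [Nat.cast_sub h.2.le]
    field_simp
    ring

/-- The algebraic intersection form on `H₁(M; k)`. -/
noncomputable def intersection (M : PolySurface) : LinearMap.BilinForm k (M.H1 k) :=
  ((M.boundaries k).submoduleOf (M.cycles k)).liftQ
    { toFun := fun x => ((M.boundaries k).submoduleOf (M.cycles k)).liftQ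
        ((M.crossing k x.1).comp (M.cycles k).subtype) (fun y hy => by
          rw [LinearMap.mem_ker, LinearMap.comp_apply, crossing_neg,
            crossing_boundary_left k M hy (by exact x.2), neg_zero])
      map_add' := fun x x' => by
        refine LinearMap.ext fun q => Submodule.Quotient.induction_on _ q fun y => ?_
        simp
      map_smul' := fun r x => by
        refine LinearMap.ext fun q => Submodule.Quotient.induction_on _ q fun y => ?_
        simp }
    (fun x hx => by
      refine LinearMap.ext fun q => Submodule.Quotient.induction_on _ q fun y => ?_
      exact crossing_boundary_left k M hx y.2)

end Intersection

/-! ### Branched coverings -/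

/-- An orientation-preserving cellular branched covering `M' → M` (branched at most over
centres of polygons and over vertices). -/
structure Cover (M' M : PolySurface) where
  toFun : M'.Dart → M.Dart
  map_rev : ∀ d, toFun (M'.rev d) = M.rev (toFun d)
  map_face : ∀ d, toFun (M'.face d) = M.face (toFun d)

namespace Cover

variable {M' M : PolySurface}

theorem map_rot (p : Cover M' M) (d : M'.Dart) : p.toFun (M'.rot d) = M.rot (p.toFun d) := by
  have h := p.map_face (M'.face.symm d)
  rw [Equiv.apply_symm_apply] at h
  simp [rot, p.map_rev, h]

theorem map_rot_pow (p : Cover M' M) (j : ℕ) (d : M'.Dart) :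
    p.toFun ((M'.rot ^ j) d) = (M.rot ^ j) (p.toFun d) := by
  induction j with
  | zero => simp
  | succ j ih => rw [pow_succ', pow_succ', Equiv.Perm.mul_apply, Equiv.Perm.mul_apply, map_rot, ih]

variable (k : Type) [CommRing k]

theorem comp_mem_cycles (p : Cover M' M) {c : M.Dart → k} (hc : c ∈ M.cycles k) :
    c ∘ p.toFun ∈ M'.cycles k := by
  refine ⟨fun d => by simp [p.map_rev, hc.1], fun d => ?_⟩
  simp only [Function.comp_apply, map_rot_pow]
  have hdvd : M.deg (p.toFun d) ∣ M'.deg d := by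
    refine Function.IsPeriodicPt.minimalPeriod_dvd ?_
    have := p.map_rot_pow (M'.deg d) d
    rw [rot_pow_deg] at this
    rw [Function.IsPeriodicPt, Function.IsFixedPt, ← Equiv.Perm.coe_pow, ← this]
  obtain ⟨q, hq⟩ := hdvd
  rw [hq]
  clear hq
  induction q with
  | zero => simp
  | succ q ih =>
    rw [Nat.mul_succ, Finset.sum_range_add, ih, zero_add]
    refine Eq.trans (Finset.sum_congr rfl fun j _ => ?_) (hc.2 (p.toFun d))
    congr 1
    have hfix : ∀ q : ℕ, (M.rot ^ (M.deg (p.toFun d) * q)) (p.toFun d) = p.toFun d := by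
      intro q
      induction q with
      | zero => simp
      | succ q ih => rw [Nat.mul_succ, pow_add, Equiv.Perm.mul_apply, rot_pow_deg, ih]
    rw [add_comm, pow_add, Equiv.Perm.mul_apply, hfix]

/-- The transfer `H₁(M; k) → H₁(M'; k)`: it sends an edge to the sum of the edges above it, so on the
level of coefficient functions it is the composition with the covering map. -/
def transfer (p : Cover M' M) : M.H1 k →ₗ[k] M'.H1 k :=
  Submodule.mapQ _ _
    ((LinearMap.funLeft k k p.toFun).restrict fun _ hc => p.comp_mem_cycles k hc)
    (by
      rintro c ⟨u, hu, hc⟩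
      refine ⟨u ∘ p.toFun, fun d => by simp [p.map_face, hu], fun d => ?_⟩
      have := hc (p.toFun d)
      rw [Function.comp_apply, Function.comp_apply, p.map_rev]
      exact this)

end Cover

/-- The homomorphism `H₁(M; k) → H₁(M; k')` that is induced by a homomorphism `k → k'`. -/
def mapCoeff (M : PolySurface) {k k' : Type} [CommRing k] [CommRing k'] (φ : k →+* k') :
    M.H1 k →+ M.H1 k' :=
  QuotientAddGroup.map _ _
    { toFun := fun c => (⟨fun d => φ (c.1 d), by
        refine ⟨fun d => ?_, fun d => ?_⟩
        · have := c.2.1 d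
          simp [this]
        · have := c.2.2 d
          rw [← map_sum, this, map_zero]⟩ : M.cycles k')
      map_zero' := by ext; simp
      map_add' := fun x y => by ext; simp }
    (by
      rintro c ⟨u, hu, hc⟩
      refine ⟨fun d => φ (u d), fun d => by simp [hu], fun d => ?_⟩
      have := hc d
      exact (congrArg φ this).trans (map_sub φ _ _))

/-- The closed oriented surface of genus `g`: one polygon with `4 g` sides and boundary word
`e₁ f₁ e₁⁻¹ f₁⁻¹ ⋯ e_g f_g e_g⁻¹ f_g⁻¹`. The sides `(i, 0), (i, 1), (i, 2), (i, 3)` are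
`e, f, e⁻¹, f⁻¹` of the `i`-th handle. It has one vertex, and the punctured surface `X°` (the
centre of the polygon removed) has the fundamental group that is freely generated by the loops
`e_i, f_i`, with `∏ [e_i, f_i]` the loop `c` around the puncture. -/
def standard (g : ℕ) : PolySurface where
  Dart := Fin g × Fin 4
  rev := Equiv.prodCongr (Equiv.refl _) (Equiv.addRight 2)
  face :=
    { toFun := fun d => if d.2 = 3 then (finRotate g d.1, 0) else (d.1, d.2 + 1)
      invFun := fun d => if d.2 = 0 then ((finRotate g).symm d.1, 3) else (d.1, d.2 - 1)
      left_inv := by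
        rintro ⟨i, j⟩
        fin_cases j
        · simp
        · simp
        · simp
        · exact Prod.ext ((finRotate g).symm_apply_apply i) rfl
      right_inv := by
        rintro ⟨i, j⟩
        fin_cases j
        · exact Prod.ext ((finRotate g).apply_symm_apply i) rfl
        · exact Prod.ext rfl rfl
        · exact Prod.ext rfl rfl
        · exact Prod.ext rfl rfl }
  rev_rev := by
    rintro ⟨i, j⟩
    fin_cases j <;> simp
  rev_ne := by
    rintro ⟨i, j⟩
    fin_cases j <;> simp

section Monodromy

variable {S S' : Type}

/-- The covering of `M`, branched over the centres of the polygons, with fibre `S` over the vertices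
and monodromy `v`: the lift of the directed edge `d` that starts at the point `s` of the fibre
ends at the point `v d s`. All punctures of the covering of the punctured surface are filled in,
so each orbit of lifted polygon sides bounds one disc. -/
def branchedCover [Fintype S] (M : PolySurface) (v : M.Dart → Equiv.Perm S)
    (hv : ∀ d, v (M.rev d) = (v d)⁻¹) : PolySurface where
  Dart := M.Dart × S
  rev := Equiv.prodShear M.rev v
  face := Equiv.prodShear M.face v
  rev_rev := by
    rintro ⟨d, s⟩
    simp [Equiv.prodShear, hv, M.rev_rev]
  rev_ne := by
    rintro ⟨d, s⟩ h
    exact M.rev_ne d (congrArg Prod.fst h)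

/-- A map of fibres that commutes with the monodromies induces a covering. -/
def coverOfFibre [Fintype S] [Fintype S'] {M : PolySurface}
    {v : M.Dart → Equiv.Perm S} {v' : M.Dart → Equiv.Perm S'}
    {hv : ∀ d, v (M.rev d) = (v d)⁻¹} {hv' : ∀ d, v' (M.rev d) = (v' d)⁻¹}
    (T : S → S') (hT : ∀ d s, T (v d s) = v' d (T s)) :
    Cover (M.branchedCover v hv) (M.branchedCover v' hv') where
  toFun := fun x => (x.1, T x.2)
  map_rev := fun x => Prod.ext rfl (hT x.1 x.2)
  map_face := fun x => Prod.ext rfl (hT x.1 x.2)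

/-- A group `G` that acts on the fibre and commutes with the monodromy acts on the covering surface
by deck transformations, and hence on its homology. The map induced by the homeomorphism
`h` is the transfer of `h⁻¹`. -/
def deckRep [Fintype S] (k : Type) [CommRing k] {G : Type} [Group G] (M : PolySurface)
    (v : M.Dart → Equiv.Perm S) (hv : ∀ d, v (M.rev d) = (v d)⁻¹)
    (act : G →* Equiv.Perm S) (hact : ∀ h d s, act h (v d s) = v d (act h s)) :
    Representation k G ((M.branchedCover v hv).H1 k) where
  toFun := fun h => (coverOfFibre (hv := hv) (hv' := hv) (act h⁻¹) (hact h⁻¹)).transfer k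
  map_one' := by
    refine LinearMap.ext fun q => Submodule.Quotient.induction_on _ q fun c => ?_
    refine congrArg (Submodule.Quotient.mk) (Subtype.ext (funext fun d => ?_))
    change c.1 (d.1, act 1⁻¹ d.2) = c.1 d
    rw [inv_one, map_one]
    rfl
  map_mul' := fun h h' => by
    refine LinearMap.ext fun q => Submodule.Quotient.induction_on _ q fun c => ?_
    refine congrArg (Submodule.Quotient.mk) (Subtype.ext (funext fun d => ?_))
    change c.1 (d.1, act (h * h')⁻¹ d.2) = c.1 (d.1, act h'⁻¹ (act h⁻¹ d.2))
    rw [mul_inv_rev, map_mul, Equiv.Perm.mul_apply]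

/-- The monodromy with `e₁ ↦ a`, `f₁ ↦ b`, all other generators of `π₁(X°)` acting trivially. -/
def handle (g : ℕ) (a b : Equiv.Perm S) : (standard g).Dart → Equiv.Perm S :=
  fun d : Fin g × Fin 4 => if d.1.val = 0 then ![a, b, a⁻¹, b⁻¹] d.2 else 1

theorem handle_rev (g : ℕ) (a b : Equiv.Perm S) (d : (standard g).Dart) :
    handle g a b ((standard g).rev d) = (handle g a b d)⁻¹ := by
  obtain ⟨i, j⟩ := d
  change (if i.val = 0 then ![a, b, a⁻¹, b⁻¹] (j + 2) else 1) =
    (if i.val = 0 then ![a, b, a⁻¹, b⁻¹] j else 1)⁻¹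
  by_cases h : i.val = 0
  · rw [if_pos h, if_pos h]
    fin_cases j <;> simp
  · rw [if_neg h, if_neg h, inv_one]

theorem handle_comm {g : ℕ} {a b : Equiv.Perm S} {a' b' : Equiv.Perm S'} {T : S → S'}
    (ha : ∀ s, T (a s) = a' (T s)) (hb : ∀ s, T (b s) = b' (T s)) (d : (standard g).Dart) (s : S) :
    T (handle g a b d s) = handle g a' b' d (T s) := by
  have ha' : ∀ s, T (a⁻¹ s) = a'⁻¹ (T s) := fun s => by
    rw [Equiv.Perm.eq_inv_iff_eq, ← ha]; simp
  have hb' : ∀ s, T (b⁻¹ s) = b'⁻¹ (T s) := fun s => by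
    rw [Equiv.Perm.eq_inv_iff_eq, ← hb]; simp
  obtain ⟨i, j⟩ := d
  change T ((if i.val = 0 then ![a, b, a⁻¹, b⁻¹] j else 1) s) =
    (if i.val = 0 then ![a', b', a'⁻¹, b'⁻¹] j else 1) (T s)
  by_cases h : i.val = 0
  · rw [if_pos h, if_pos h]
    fin_cases j
    · exact ha s
    · exact hb s
    · exact ha' s
    · exact hb' s
  · rw [if_neg h, if_neg h]
    rfl

end Monodromy

end PolySurface

/-! ### The Heisenberg group and the surfaces `W` and `Z` -/

/-- The Heisenberg group over `ℤ/m`. The triple `(a, b, c)` stands for `τ^a σ^b ζ^c`,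
where `σ τ σ⁻¹ τ⁻¹ = ζ` is central. -/
@[ext]
structure Heis (m : ℕ) where
  a : ZMod m
  b : ZMod m
  c : ZMod m

namespace Heis

variable {m : ℕ}

instance : Group (Heis m) where
  mul x y := ⟨x.a + y.a, x.b + y.b, x.c + y.c + x.b * y.a⟩
  one := ⟨0, 0, 0⟩
  inv x := ⟨-x.a, -x.b, -x.c + x.b * x.a⟩
  mul_assoc x y z := by
    apply Heis.ext
    · exact add_assoc _ _ _
    · exact add_assoc _ _ _
    · change x.c + y.c + x.b * y.a + z.c + (x.b + y.b) * z.a =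
        x.c + (y.c + z.c + y.b * z.a) + x.b * (y.a + z.a)
      ring
  one_mul x := by
    apply Heis.ext
    · exact zero_add _
    · exact zero_add _
    · change 0 + x.c + 0 * x.a = x.c
      ring
  mul_one x := by
    apply Heis.ext
    · exact add_zero _
    · exact add_zero _
    · change x.c + 0 + x.b * 0 = x.c
      ring
  inv_mul_cancel x := by
    apply Heis.ext
    · exact neg_add_cancel _
    · exact neg_add_cancel _
    · change -x.c + x.b * x.a + x.c + -x.b * x.a = 0
      ring

/-- The triples `(a, b, c)`. -/
def equivProd (m : ℕ) : Heis m ≃ ZMod m × ZMod m × ZMod m where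
  toFun x := (x.a, x.b, x.c)
  invFun x := ⟨x.1, x.2.1, x.2.2⟩
  left_inv _ := rfl
  right_inv _ := rfl

instance [NeZero m] : Fintype (Heis m) := Fintype.ofEquiv _ (equivProd m).symm

theorem mul_def (x y : Heis m) :
    x * y = ⟨x.a + y.a, x.b + y.b, x.c + y.c + x.b * y.a⟩ := rfl

/-- The generator `τ`. -/
def tau (m : ℕ) : Heis m := ⟨1, 0, 0⟩
/-- The generator `σ`. -/
def sigma (m : ℕ) : Heis m := ⟨0, 1, 0⟩
/-- The central generator `ζ`. -/
def zeta (m : ℕ) : Heis m := ⟨0, 0, 1⟩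

theorem sigma_mul_tau : sigma m * tau m = zeta m * (tau m * sigma m) := by
  ext <;> simp [mul_def, sigma, tau, zeta]

theorem mul_zeta (h : Heis m) : h * zeta m = zeta m * h := by
  ext <;> simp [mul_def, zeta, add_comm]

end Heis

/-- The cyclic group `Q = ⟨ζ⟩` of order `m`. -/
abbrev CycQ (m : ℕ) : Type := Multiplicative (ZMod m)

/-- The generator `ζ` of `Q`. -/
def CycQ.zeta (m : ℕ) : CycQ m := Multiplicative.ofAdd 1

section Surfaces

open PolySurface

variable (g m : ℕ) [NeZero m]

/-- The normal branched covering `W → X` with deck group `H = Heis m`: the regular `H`-covering of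
`X°` given by `π₁(X°) → H`, `e₁ ↦ σ`, `f₁ ↦ τ` and all other generators to `1`, with the
punctures filled in. The loop around the puncture of `X°` goes to `ζ`. -/
abbrev surfaceW : PolySurface :=
  (standard g).branchedCover
    (handle g (Equiv.mulRight (Heis.sigma m)) (Equiv.mulRight (Heis.tau m)))
    (handle_rev g _ _)

/-- The monodromy of `Z → X` along `e₁`. -/
def monodromyE : Equiv.Perm (ZMod m × ZMod m) :=
  Equiv.prodCongr (Equiv.addRight 1) (Equiv.refl _)

/-- The monodromy of `Z → X` along `f₁`. -/
def monodromyF : Equiv.Perm (ZMod m × ZMod m) :=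
  Equiv.prodShear (Equiv.refl _) (fun i => Equiv.addRight i)

/-- The fibre `Z` of the Atiyah-Kodaira bundle. The point `(i, j)` of the fibre of `Z → X` lies over
the `i`-th point of the cyclic unbranched covering `Y → X` (where `e₁` acts by `i ↦ i + 1`) and on
the `j`-th sheet of the cyclic branched covering `Z → Y`; along the lift of `f₁` at `i`
the sheet changes from `j` to `j + i`. -/
abbrev surfaceZ : PolySurface :=
  (standard g).branchedCover (handle g (monodromyE m) (monodromyF m)) (handle_rev g _ _)

/-- The unbranched covering `r : W → Z` with deck group `⟨τ⟩`: the point `τ^a σ^i ζ^j` of the fibre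
of `W` lies over the point `(i, j)` of the fibre of `Z`. -/
def coverWZ : Cover (surfaceW g m) (surfaceZ g m) :=
  coverOfFibre (fun h : Heis m => (h.b, h.c))
    (handle_comm (T := fun h : Heis m => (h.b, h.c))
      (fun s => by simp [monodromyE, Heis.mul_def, Heis.sigma])
      (fun s => by simp [monodromyF, Heis.mul_def, Heis.tau, Equiv.prodShear]))

variable (k : Type) [CommRing k]

/-- The action of the deck group `H` of `W → X` on `H₁(W; k)`; `h ∈ H` moves the point `s` of
the fibre to `h s`. -/
def repW : Representation k (Heis m) ((surfaceW g m).H1 k) :=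
  deckRep k _ _ _ (MulAction.toPermHom (Heis m) (Heis m)) (fun h => handle_comm
    (fun s => by simp [mul_assoc]) (fun s => by simp [mul_assoc]))

/-- The action of the deck group `Q` of `Z → Y` on `H₁(Z; k)`; `ζ` moves the point `(i, j)` of
the fibre to `(i, j + 1)`. -/
def repZ : Representation k (CycQ m) ((surfaceZ g m).H1 k) :=
  deckRep k _ _ _
    { toFun := fun q => Equiv.prodCongr (Equiv.refl _) (Equiv.addLeft q.toAdd)
      map_one' := by ext s <;> simp
      map_mul' := fun q q' => by ext s <;> simp [add_assoc] }
    (fun q => handle_comm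
      (fun s => rfl)
      (fun s => by simp [monodromyF, Equiv.prodShear, add_assoc]))

end Surfaces

/-! ### Isotypic factors, Reidemeister pairings and unitary groups -/

section Reidemeister

variable {k G V : Type} [CommRing k] [Group G] [AddCommGroup V] [Module k V]

/-- The part of `V` where the central element `z` acts with (exact) order `m`: the
isotypic factor, for the group `⟨z⟩`, of the simple `ℚ[⟨z⟩]`-module `ℚ[t]/Φ_m(t) = ℚ(ζ_m)`
(and the base change of this factor to `k` in general). -/
noncomputable def orderPart (ρ : Representation k G V) (z : G) (m : ℕ) : Submodule k V :=
  LinearMap.ker (aeval (ρ z) (cyclotomic m k))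

theorem orderPart_invariant (ρ : Representation k G V) (z : G) (m : ℕ) (hz : ∀ g, g * z = z * g)
    (g : G) {x : V} (hx : x ∈ orderPart ρ z m) : ρ g x ∈ orderPart ρ z m := by
  have hc : Commute (ρ g) (ρ z) := by
    rw [Commute, SemiconjBy, ← map_mul, hz, map_mul]
  have hc' : Commute (ρ g) (aeval (ρ z) (cyclotomic m k)) := by
    rw [aeval_eq_sum_range]
    exact Commute.sum_right _ _ _ fun i _ => (hc.pow_right i).smul_right _
  have hx' : aeval (ρ z) (cyclotomic m k) x = 0 := hx
  change aeval (ρ z) (cyclotomic m k) (ρ g x) = 0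
  have := LinearMap.congr_fun hc'.eq x
  rw [Module.End.mul_apply, Module.End.mul_apply, hx', map_zero] at this
  exact this.symm

/-- The representation of `G` on `orderPart ρ z m`, for a central element `z`. -/
noncomputable def orderRep (ρ : Representation k G V) (z : G) (m : ℕ)
    (hz : ∀ g, g * z = z * g) : Representation k G (orderPart ρ z m) where
  toFun := fun g => (ρ g).restrict fun _ hx => orderPart_invariant ρ z m hz g hx
  map_one' := by ext x; simp
  map_mul' := fun g h => by ext x; simp

/-- The Reidemeister pairing `⟨x, y⟩_G = ∑_g (x, g y) g`. -/
noncomputable def reidemeister [Fintype G] (ρ : Representation k G V) (B : LinearMap.BilinForm k V)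
    (x y : V) : MonoidAlgebra k G :=
  ∑ g, MonoidAlgebra.single g (B x (ρ g y))

/-- The group `Aut_G(V, ⟨·,·⟩_G)` of `G`-equivariant automorphisms that preserve the
Reidemeister pairing. -/
def reidAut [Fintype G] (ρ : Representation k G V) (B : LinearMap.BilinForm k V) :
    Subgroup (V ≃ₗ[k] V) where
  carrier := {f | (∀ g x, f (ρ g x) = ρ g (f x)) ∧
    ∀ x y, reidemeister ρ B (f x) (f y) = reidemeister ρ B x y}
  one_mem' := ⟨fun _ _ => rfl, fun _ _ => rfl⟩
  mul_mem' := by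
    rintro f f' ⟨h1, h2⟩ ⟨h1', h2'⟩
    refine ⟨fun g x => ?_, fun x y => ?_⟩
    · simp only [LinearEquiv.mul_apply, h1, h1']
    · simp only [LinearEquiv.mul_apply, h2, h2']
  inv_mem' := by
    rintro f ⟨h1, h2⟩
    refine ⟨fun g x => ?_, fun x y => ?_⟩
    · apply f.injective
      rw [h1]
      simp only [← LinearEquiv.mul_apply, mul_inv_cancel]
      rfl
    · rw [← h2]
      simp only [← LinearEquiv.mul_apply, mul_inv_cancel]
      rfl

/-- The two-sided ideal of the group algebra on which the central element `z` acts with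
order `m`. For `ℚ[Q]` and `ℚ[H]` and `z = ζ` of order `m` it is a simple factor of the Wedderburn
decomposition. -/
noncomputable def topFactor (k : Type) [CommRing k] (z : G) (m : ℕ) :
    Submodule k (MonoidAlgebra k G) :=
  LinearMap.ker (LinearMap.mulLeft k (aeval (MonoidAlgebra.of k G z) (cyclotomic m k)))

/-- `x` is a basis of `V` over the factor `topFactor k z m` of the group algebra: each vector is
`∑ aᵢ xᵢ` for unique coefficients `aᵢ` in the factor. -/
def IsFactorBasis {ι : Type} [Fintype ι] (ρ : Representation k G V) (z : G) (m : ℕ)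
    (x : ι → V) : Prop :=
  Function.Bijective fun a : ι → topFactor k z m => ∑ i, ρ.asAlgebraHom (a i).1 (x i)

end Reidemeister

section TopComponent

variable (g m : ℕ) [NeZero m] (k : Type) [CommRing k]

/-- `M_m ⊆ H₁(W; k)`. -/
noncomputable abbrev topM : Submodule k ((surfaceW g m).H1 k) :=
  orderPart (repW g m k) (Heis.zeta m) m

/-- The `H`-action on `M_m`. -/
noncomputable abbrev topMRep : Representation k (Heis m) (topM g m k) :=
  orderRep (repW g m k) (Heis.zeta m) m Heis.mul_zeta

/-- `N_m ⊆ H₁(Z; k)`. -/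
noncomputable abbrev topN : Submodule k ((surfaceZ g m).H1 k) :=
  orderPart (repZ g m k) (CycQ.zeta m) m

/-- The `Q`-action on `N_m`. -/
noncomputable abbrev topNRep : Representation k (CycQ m) (topN g m k) :=
  orderRep (repZ g m k) (CycQ.zeta m) m (fun _ => mul_comm _ _)

variable [Algebra ℚ k]

/-- The intersection form of `W` on `M_m`. -/
noncomputable abbrev topMForm : LinearMap.BilinForm k (topM g m k) :=
  ((surfaceW g m).intersection k).restrict (topM g m k)

/-- The intersection form of `Z` on `N_m`. -/
noncomputable abbrev topNForm : LinearMap.BilinForm k (topN g m k) :=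
  ((surfaceZ g m).intersection k).restrict (topN g m k)

/-- The `k`-points of the algebraic `ℚ`-group `G_m = Aut_H(M_m, ⟨·,·⟩_H)`. -/
noncomputable abbrev GroupG : Subgroup (topM g m k ≃ₗ[k] topM g m k) :=
  reidAut (topMRep g m k) (topMForm g m k)

/-- The `k`-points of the algebraic `ℚ`-group `G_m^{nn} = Aut_Q(N_m, ⟨·,·⟩_Q)`. -/
noncomputable abbrev GroupGnn : Subgroup (topN g m k ≃ₗ[k] topN g m k) :=
  reidAut (topNRep g m k) (topNForm g m k)

end TopComponent

/-! ### Matrices over the cyclotomic field -/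

section Cyclotomic

variable (m : ℕ) [NeZero m]

instance instCyclotomicRat : IsCyclotomicExtension {m} ℚ (CyclotomicField m ℚ) :=
  CyclotomicField.isCyclotomicExtension m ℚ

/-- The character `a ↦ ζ_m ^ a` of `ℤ/m` with values in `ℚ(ζ_m)`. -/
noncomputable def rootChar : AddChar (ZMod m) (CyclotomicField m ℚ) :=
  AddChar.zmodChar m (IsCyclotomicExtension.zeta_spec m ℚ (CyclotomicField m ℚ)).pow_eq_one

/-- The automorphism `ζ_m ↦ ζ_m⁻¹` of `ℚ(ζ_m)`. -/
noncomputable def cycConj : CyclotomicField m ℚ ≃ₐ[ℚ] CyclotomicField m ℚ :=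
  (IsCyclotomicExtension.autEquivPow (CyclotomicField m ℚ)
    (cyclotomic.irreducible_rat (NeZero.pos m))).symm (-1)

/-- The `m`-dimensional representation of `H` over `ℚ(ζ_m)` in which `σ` maps `e_j` to `e_{j+1}`,
`τ` maps `e_j` to `ζ_m ^ j e_j` and `ζ` is the scalar `ζ_m⁻¹`. -/
noncomputable def heisMatrix : Heis m →* Matrix (ZMod m) (ZMod m) (CyclotomicField m ℚ) where
  toFun h := Matrix.of fun i j => if i = j + h.b then rootChar m (h.a * i - h.c) else 0
  map_one' := by
    ext i j
    change (if i = j + 0 then rootChar m (0 * i - 0) else 0) = _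
    simp [Matrix.one_apply]
  map_mul' h h' := by
    ext i l
    rw [Matrix.mul_apply]
    simp only [Matrix.of_apply, Heis.mul_def]
    rw [Finset.sum_eq_single (i - h.b)]
    · by_cases hi : i = l + (h.b + h'.b)
      · have h1 : i - h.b = l + h'.b := by rw [hi]; ring
        rw [if_pos hi, if_pos (by ring), if_pos h1, ← AddChar.map_add_eq_mul]
        congr 1
        ring
      · have h1 : ¬ (i - h.b = l + h'.b) := fun h2 => hi (by rw [← sub_add_cancel i h.b, h2]; ring)
        rw [if_neg hi, if_neg h1, mul_zero]
    · intro j _ hj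
      rw [if_neg (fun h2 => hj (by rw [h2]; ring)), zero_mul]
    · simp

/-- The induced homomorphism `ℚ[H] → M_m(ℚ(ζ_m))`. -/
noncomputable def heisAlg :
    MonoidAlgebra ℚ (Heis m) →ₐ[ℚ] Matrix (ZMod m) (ZMod m) (CyclotomicField m ℚ) :=
  MonoidAlgebra.lift ℚ _ _ (heisMatrix m)

/-- The homomorphism `ℚ[Q] → ℚ(ζ_m)`, `ζ ↦ ζ_m⁻¹`, the restriction of `heisAlg` to
the central subgroup `Q` (with scalar matrices identified with scalars). -/
noncomputable def cycAlg : MonoidAlgebra ℚ (CycQ m) →ₐ[ℚ] CyclotomicField m ℚ :=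
  MonoidAlgebra.lift ℚ _ _
    { toFun := fun q => rootChar m (-q.toAdd)
      map_one' := by simp
      map_mul' := fun q q' => by
        rw [← AddChar.map_add_eq_mul, toAdd_mul, neg_add] }

/-- The unitary group `{A | Aᵗ S Ā = S}` of a matrix `S` over `ℚ(ζ_m)`. -/
noncomputable def matrixUnitary {ι : Type} [Fintype ι] [DecidableEq ι]
    (S : Matrix ι ι (CyclotomicField m ℚ)) : Subgroup (GL ι (CyclotomicField m ℚ)) where
  carrier := {A | A.1.transpose * S * A.1.map (cycConj m) = S}
  one_mem' := by simp
  mul_mem' := by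
    intro A A' hA hA'
    simp only [Set.mem_ofPred_eq] at hA hA' ⊢
    rw [Units.val_mul, Matrix.transpose_mul, Matrix.map_mul]
    calc _ = A'.1.transpose * (A.1.transpose * S * A.1.map (cycConj m)) * A'.1.map (cycConj m) := by
            simp only [Matrix.mul_assoc]
      _ = S := by rw [hA, hA']
  inv_mem' := by
    intro A hA
    simp only [Set.mem_ofPred_eq] at hA ⊢
    have h1 : (A⁻¹).1.transpose * A.1.transpose = 1 := by
      rw [← Matrix.transpose_mul, ← Units.val_mul, mul_inv_cancel]; simp
    have h2 : A.1.map (cycConj m) * (A⁻¹).1.map (cycConj m) = 1 := by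
      rw [← Matrix.map_mul, ← Units.val_mul, mul_inv_cancel]; simp
    calc _ = (A⁻¹).1.transpose * (A.1.transpose * S * A.1.map (cycConj m)) *
              (A⁻¹).1.map (cycConj m) := by rw [hA]
      _ = ((A⁻¹).1.transpose * A.1.transpose) * S *
            (A.1.map (cycConj m) * (A⁻¹).1.map (cycConj m)) := by simp only [Matrix.mul_assoc]
      _ = S := by rw [h1, h2]; simp

variable (g : ℕ) {ι : Type}

/-- The Gram matrix of `⟨·,·⟩_H` for the vectors `x_a` of `M_m`, an `ι × ι` matrix over
`A_m`, as a matrix over `ℚ(ζ_m)` through `A_m ≅ M_m(ℚ(ζ_m))`. -/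
noncomputable def gramH (x : ι → topM g m ℚ) :
    Matrix (ι × ZMod m) (ι × ZMod m) (CyclotomicField m ℚ) :=
  Matrix.of fun p q =>
    heisAlg m (reidemeister (topMRep g m ℚ) (topMForm g m ℚ) (x p.1) (x q.1)) p.2 q.2

/-- The Gram matrix over `ℚ(ζ_m)` of `⟨·,·⟩_Q` for the vectors `y_p` of `N_m`. -/
noncomputable def gramQ (y : ι → topN g m ℚ) : Matrix ι ι (CyclotomicField m ℚ) :=
  Matrix.of fun p q =>
    cycAlg m (reidemeister (topNRep g m ℚ) (topNForm g m ℚ) (y p) (y q))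

end Cyclotomic

/-! ### The character `rootChar` and the trace of the cyclotomic field -/

section RootChar

variable (m : ℕ) [NeZero m]

/-! The engine is character orthogonality for `ζ` itself. On a vector killed by Φ_m(ζ), the powers
of `ζ` satisfy every rational relation between the powers of ζ_m
(`sum_smul_pow_eq_zero_of_rootChar`). In particular ∑_a ζ^(al) vanishes there for l ≠ 0 in ℤ/m, over
every ℚ-algebra k, with no root of unity needed in k.

Let V = M_m, and let N = N_m be identified by the transfer t with the τ-invariants; this
identification only needs m to be invertible. From τσ^j = σ^jζ^(-j)τ, τ acts on σ^j t(N) as ζ^(-j).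
Averaging over the powers of τ therefore separates these subspaces, and V is the direct sum of the
σ^j t(N) (`IsTauDescent.decomp`). The same averaging makes the summands orthogonal (`form_sigma`).
So an equivariant isometry of V is determined by its restriction to N, and an equivariant isometry
of N extends by σ^j t(n) ↦ σ^j t(f' n). This gives α_m (`exists_mulEquiv`).

In the decomposition V ≅ N^m the group algebra acts through the matrices of `heisAlg`
(`asAlgebraHom_sigma_apply`). Explicit Fourier inversion shows that `heisAlg` and `cycAlg` are
bijective on the simple factors. Modules over the matrix algebra then correspond to vector spaces
over ℚ(ζ_m): the matrix units E_{0i} carry a basis of V to a basis of N. The two Gram matrices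
differ by the factor m² (`gram_eq`): one m is the degree of W → Z, the other counts the powers of τ.
The matrix of f is computed from f(E_{0j}x_b) = ∑_a E_{0j}γ_{ab}x_a (`matrix_restrict`).

Freeness reduces to dim N_m = (2g-1)m over ℚ(ζ_m). The Fourier transform along the `ζ`-orbits turns
rational cellular chains into 2gm coordinates in ℚ(ζ_m). The boundary around the polygon lifts to
`ζ`, so `ζ` fixes every 2-cell of Z and boundaries have no component of order m. The m vertex
conditions are independent (`vertexMap_surjective`), so the dimension is 2gm - m. -/

instance instIsGaloisCyclotomicRat : IsGalois ℚ (CyclotomicField m ℚ) :=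
  IsCyclotomicExtension.isGalois {m} ℚ (CyclotomicField m ℚ)

theorem rootChar_isPrimitive : (rootChar m).IsPrimitive :=
  AddChar.zmodChar_primitive_of_primitive_root m
    (IsCyclotomicExtension.zeta_spec m ℚ (CyclotomicField m ℚ))

theorem rootChar_apply (a : ZMod m) :
    rootChar m a = IsCyclotomicExtension.zeta m ℚ (CyclotomicField m ℚ) ^ a.val :=
  AddChar.zmodChar_apply _ _

theorem sum_rootChar_mul (b : ZMod m) :
    ∑ a, rootChar m (a * b) = if b = 0 then (m : CyclotomicField m ℚ) else 0 := by
  rw [AddChar.sum_mulShift b (rootChar_isPrimitive m), ZMod.card]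
  split_ifs <;> simp

theorem rootChar_eq_one {a : ZMod m} (h : rootChar m a = 1) : a = 0 := by
  rw [rootChar_apply, (IsCyclotomicExtension.zeta_spec m ℚ _).pow_eq_one_iff_dvd] at h
  rw [← ZMod.val_eq_zero]
  exact Nat.eq_zero_of_dvd_of_lt h (ZMod.val_lt a)

theorem rootChar_mul_neg (a : ZMod m) : rootChar m a * rootChar m (-a) = 1 := by
  rw [← AddChar.map_add_eq_mul, add_neg_cancel, AddChar.map_zero_eq_one]

theorem rootChar_one : rootChar m 1 = IsCyclotomicExtension.zeta m ℚ (CyclotomicField m ℚ) := by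
  have h := AddChar.zmodChar_apply'
    (IsCyclotomicExtension.zeta_spec m ℚ (CyclotomicField m ℚ)).pow_eq_one 1
  rw [Nat.cast_one, pow_one] at h
  exact h

theorem isPrimitiveRoot_rootChar_neg_one : IsPrimitiveRoot (rootChar m (-1)) m := by
  have h1 := rootChar_one m
  have h2 : rootChar m (-1) = (IsCyclotomicExtension.zeta m ℚ (CyclotomicField m ℚ))⁻¹ := by
    rw [← h1]
    exact eq_inv_of_mul_eq_one_right (rootChar_mul_neg m 1)
  rw [h2]
  exact (IsCyclotomicExtension.zeta_spec m ℚ _).inv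

theorem rootChar_neg_one_pow (a : ZMod m) : rootChar m (-1) ^ a.val = rootChar m (-a) := by
  rw [← AddChar.map_nsmul_eq_pow]
  congr 1
  simp

theorem aeval_rootChar_neg_one : aeval (rootChar m (-1)) (cyclotomic m ℚ) = 0 := by
  rw [cyclotomic_eq_minpoly_rat (isPrimitiveRoot_rootChar_neg_one m) (NeZero.pos m)]
  exact minpoly.aeval _ _

theorem cycConj_rootChar (a : ZMod m) : cycConj m (rootChar m a) = rootChar m (-a) := by
  have hz := IsCyclotomicExtension.zeta_spec m ℚ (CyclotomicField m ℚ)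
  have h := hz.autToPow_spec ℚ (cycConj m)
  have h' : hz.autToPow ℚ (cycConj m) = -1 :=
    (IsCyclotomicExtension.autEquivPow (CyclotomicField m ℚ)
      (cyclotomic.irreducible_rat (NeZero.pos m))).apply_symm_apply (-1)
  rw [h', ← rootChar_apply, Units.val_neg, Units.val_one] at h
  rw [rootChar_apply, map_pow, ← h, rootChar_neg_one_pow]

theorem algEquiv_eq_one_of_rootChar (φ : CyclotomicField m ℚ ≃ₐ[ℚ] CyclotomicField m ℚ)
    (h : ∀ a, φ (rootChar m a) = rootChar m a) : φ = 1 := by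
  have hz := IsCyclotomicExtension.zeta_spec m ℚ (CyclotomicField m ℚ)
  apply AlgEquiv.coe_toAlgHom_injective
  apply (hz.powerBasis ℚ).algHom_ext
  rw [IsPrimitiveRoot.powerBasis_gen, ← rootChar_one]
  exact h 1

/-- Fourier inversion for the trace form: `∑_j Tr(κ ζ_m^j) ζ_m^{-j} = m κ`. -/
theorem sum_trace_mul_rootChar (κ : CyclotomicField m ℚ) :
    ∑ j, ((Algebra.trace ℚ (CyclotomicField m ℚ) (κ * rootChar m j) : ℚ) : CyclotomicField m ℚ) *
      rootChar m (-j) = (m : CyclotomicField m ℚ) * κ := by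
  classical
  have htr : ∀ x : CyclotomicField m ℚ, ((Algebra.trace ℚ (CyclotomicField m ℚ) x : ℚ) :
      CyclotomicField m ℚ) = ∑ φ : CyclotomicField m ℚ ≃ₐ[ℚ] CyclotomicField m ℚ, φ x := fun x => by
    rw [← trace_eq_sum_automorphisms, eq_ratCast]
  simp only [htr, map_mul, Finset.sum_mul]
  rw [Finset.sum_comm]
  -- The trace is the sum over the Galois group. For each φ, the map j ↦ φ(ζ_m^j) ζ_m^(-j) is a
  -- character of ℤ/m, trivial only for φ = 1; so only φ = 1 survives the sum over j.
  have key : ∀ φ : CyclotomicField m ℚ ≃ₐ[ℚ] CyclotomicField m ℚ,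
      ∑ j, φ κ * φ (rootChar m j) * rootChar m (-j) =
        if φ = 1 then (m : CyclotomicField m ℚ) * κ else 0 := by
    intro φ
    split_ifs with h
    · subst h
      simp [mul_assoc, rootChar_mul_neg]
    · let ψ : AddChar (ZMod m) (CyclotomicField m ℚ) :=
        { toFun := fun j => φ (rootChar m j) * rootChar m (-j)
          map_zero_eq_one' := by simp
          map_add_eq_mul' := fun a b => by
            rw [neg_add, AddChar.map_add_eq_mul, AddChar.map_add_eq_mul, map_mul]; ring }
      have hψ : ψ ≠ 1 := by
        intro hψ
        refine h (algEquiv_eq_one_of_rootChar m φ fun a => ?_)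
        have h1 : φ (rootChar m a) * rootChar m (-a) = 1 := DFunLike.congr_fun hψ a
        have h2 := rootChar_mul_neg m a
        have h3 : rootChar m (-a) ≠ 0 := right_ne_zero_of_mul_eq_one h2
        exact mul_right_cancel₀ h3 (h1.trans h2.symm)
      have h4 : ∑ j, φ (rootChar m j) * rootChar m (-j) = 0 := AddChar.sum_eq_zero_of_ne_one hψ
      simp only [mul_assoc, ← Finset.mul_sum, h4, mul_zero]
  simp only [key]
  simp

/-- The coefficients `ε(j) = Tr(ζ_m^j) / m` of the idempotent of `ℚ[Q]` that belongs to `ζ_m`. -/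
noncomputable def idemCoeff (j : ZMod m) : ℚ :=
  Algebra.trace ℚ (CyclotomicField m ℚ) (rootChar m j) / m

theorem sum_idemCoeff :
    ∑ j, (idemCoeff m j : CyclotomicField m ℚ) * rootChar m (-j) = 1 := by
  have h := sum_trace_mul_rootChar m 1
  have hm : (m : CyclotomicField m ℚ) ≠ 0 := Nat.cast_ne_zero.2 (NeZero.ne m)
  simp only [one_mul, mul_one] at h
  simp only [idemCoeff, Rat.cast_div, Rat.cast_natCast, div_mul_eq_mul_div, ← Finset.sum_div, h]
  exact div_self hm

/-- An operator whose `m`-th cyclotomic polynomial kills `v` satisfies on `v` every `ℚ`-linear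
relation between the powers of `ζ_m`. -/
theorem sum_smul_pow_eq_zero_of_rootChar {k V ι : Type*} [CommRing k] [Algebra ℚ k]
    [AddCommGroup V] [Module k V] [Fintype ι] (T : Module.End k V) {v : V}
    (hT : aeval T (cyclotomic m k) v = 0) (c : ι → ℚ) (n : ι → ZMod m)
    (hc : ∑ i, (c i : CyclotomicField m ℚ) * rootChar m (-n i) = 0) :
    ∑ i, algebraMap ℚ k (c i) • (T ^ (n i).val) v = 0 := by
  let p : ℚ[X] := ∑ i, C (c i) * X ^ (n i).val
  have hp : aeval (rootChar m (-1)) p = 0 := by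
    simpa [p, rootChar_neg_one_pow] using hc
  -- Φ_m is the minimal polynomial of ζ_m⁻¹ over ℚ, so the relation is a multiple of Φ_m, already
  -- over ℚ and hence over k.
  have hdvd : cyclotomic m ℚ ∣ p := by
    rw [cyclotomic_eq_minpoly_rat (isPrimitiveRoot_rootChar_neg_one m) (NeZero.pos m)]
    exact minpoly.dvd _ _ hp
  obtain ⟨q, hq⟩ := hdvd
  have h1 : aeval T (p.map (algebraMap ℚ k)) v = 0 := by
    rw [hq, mul_comm, Polynomial.map_mul, map_cyclotomic, map_mul, Module.End.mul_apply, hT,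
      map_zero]
  have h2 : aeval T (p.map (algebraMap ℚ k)) = ∑ i, algebraMap ℚ k (c i) • T ^ (n i).val := by
    simp only [p, Polynomial.map_sum, Polynomial.map_mul, map_C, Polynomial.map_pow, map_X, map_sum,
      map_mul, aeval_C, map_pow, aeval_X, Algebra.smul_def]
  rw [h2, LinearMap.sum_apply] at h1
  simpa using h1

end RootChar

/-! ### The simple factors of the group algebras -/

section Factors

variable {G : Type} [Group G]

theorem MonoidAlgebra.sum_single_coeff {k : Type*} [Semiring k] {M : Type*} [Fintype M]
    (a : MonoidAlgebra k M) : ∑ g, MonoidAlgebra.single g (a.coeff g) = a := by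
  classical
  ext g
  simp [MonoidAlgebra.coeff_sum]

theorem MonoidAlgebra.coeff_sum_single {k : Type*} [Semiring k] {M : Type*} [Fintype M]
    (f : M → k) (h : M) : (∑ g, MonoidAlgebra.single g (f g)).coeff h = f h := by
  classical
  simp [MonoidAlgebra.coeff_sum, Finsupp.single_apply]

/-- A criterion for a homomorphism from a group algebra to be bijective on `topFactor`. -/
theorem bijOn_topFactor {S : Type} [Ring S] [Algebra ℚ S] (z : G) (m : ℕ)
    (r : MonoidAlgebra ℚ G →ₐ[ℚ] S) (sec : S → MonoidAlgebra ℚ G) (e : MonoidAlgebra ℚ G)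
    (hsec : ∀ s, r (sec s) = s) (hsec' : ∀ a, sec (r a) = e * a) (hsec0 : sec 0 = 0)
    (hΦ : r (aeval (MonoidAlgebra.of ℚ G z) (cyclotomic m ℚ)) = 0)
    (he : ∀ a ∈ topFactor ℚ z m, e * a = a) (hcomm : Commute (MonoidAlgebra.of ℚ G z) e) :
    Set.BijOn r (topFactor ℚ z m) Set.univ := by
  refine ⟨fun _ _ => Set.mem_univ _, fun a ha b hb hab => ?_, fun s _ => ⟨sec s, ?_, hsec s⟩⟩
  · rw [← he a ha, ← he b hb, ← hsec', ← hsec', hab]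
  · change aeval (MonoidAlgebra.of ℚ G z) (cyclotomic m ℚ) * sec s = 0
    have hc : Commute (aeval (MonoidAlgebra.of ℚ G z) (cyclotomic m ℚ)) e := by
      rw [aeval_eq_sum_range]
      exact Commute.sum_left _ _ _ fun i _ => (hcomm.pow_left i).smul_left _
    have h1 : sec s = e * sec s := by rw [← hsec', hsec]
    -- Φ_m(z) · sec s = (e Φ_m(z)) · sec s = sec (r (Φ_m(z))) · sec s = 0.
    rw [h1, ← mul_assoc, hc.eq, ← hsec', hΦ, hsec0, zero_mul]

/-- Left multiplication by z is an operator whose m-th cyclotomic polynomial kills a, so relations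
between powers of ζ_m transfer to it. -/
theorem mul_eq_zero_of_mem_topFactor {m : ℕ} [NeZero m] {z : G} {a : MonoidAlgebra ℚ G}
    (ha : a ∈ topFactor ℚ z m) {ι : Type} [Fintype ι] (c : ι → ℚ) (n : ι → ZMod m)
    (hc : ∑ i, (c i : CyclotomicField m ℚ) * rootChar m (-n i) = 0) :
    (∑ i, MonoidAlgebra.single (z ^ (n i).val) (c i)) * a = 0 := by
  have h := sum_smul_pow_eq_zero_of_rootChar m (k := ℚ)
    (LinearMap.mulLeft ℚ (MonoidAlgebra.of ℚ G z)) (v := a) (by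
      have h1 := aeval_algHom_apply (Algebra.lmul ℚ (MonoidAlgebra ℚ G)) (MonoidAlgebra.of ℚ G z)
        (cyclotomic m ℚ)
      have h2 := LinearMap.congr_fun h1 a
      exact h2.trans ha) c n hc
  rw [Finset.sum_mul, ← h]
  refine Finset.sum_congr rfl fun i _ => ?_
  rw [LinearMap.pow_mulLeft, LinearMap.mulLeft_apply, ← map_pow, Algebra.algebraMap_self,
    RingHom.id_apply, MonoidAlgebra.of_apply, ← smul_mul_assoc, MonoidAlgebra.smul_single,
    smul_eq_mul, mul_one]

end Factors

/-! ### The top factor of ℚ[Q]: Fourier inversion on ℤ/m. -/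

section CyclicFactor

variable (m : ℕ) [NeZero m]

theorem CycQ.zeta_pow (j : ZMod m) : CycQ.zeta m ^ j.val = Multiplicative.ofAdd j := by
  rw [CycQ.zeta, ← ofAdd_nsmul]
  simp

theorem Heis.zeta_pow (j : ZMod m) : Heis.zeta m ^ j.val = ⟨0, 0, j⟩ := by
  have h : ∀ n : ℕ, Heis.zeta m ^ n = ⟨0, 0, n⟩ := fun n => by
    induction n with
    | zero => simp; rfl
    | succ n ih => rw [pow_succ, ih]; simp [Heis.mul_def, Heis.zeta]
  rw [h]
  simp

theorem cycAlg_single (q : CycQ m) (r : ℚ) :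
    cycAlg m (MonoidAlgebra.single q r) = (r : CyclotomicField m ℚ) * rootChar m (-q.toAdd) := by
  rw [cycAlg, MonoidAlgebra.lift_single, Algebra.smul_def, eq_ratCast]
  rfl

theorem heisAlg_single (h : Heis m) (r : ℚ) (i j : ZMod m) :
    heisAlg m (MonoidAlgebra.single h r) i j =
      if i = j + h.b then (r : CyclotomicField m ℚ) * rootChar m (h.a * i - h.c) else 0 := by
  rw [heisAlg, MonoidAlgebra.lift_single, Algebra.smul_def, Matrix.algebraMap_eq_diagonal,
    Matrix.diagonal_mul]
  simp [heisMatrix]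

theorem trace_ratCast_mul (r : ℚ) (x : CyclotomicField m ℚ) :
    Algebra.trace ℚ (CyclotomicField m ℚ) ((r : CyclotomicField m ℚ) * x) =
      r * Algebra.trace ℚ (CyclotomicField m ℚ) x := by
  have h := (Algebra.trace ℚ (CyclotomicField m ℚ)).map_smul r x
  rw [Algebra.smul_def, eq_ratCast, smul_eq_mul] at h
  exact h

/-- The element `(1/m) ∑_j Tr(κ ζ_m^j) ζ^j` of `ℚ[Q]`, the preimage of `κ` in the simple factor. -/
noncomputable def cycSection : CyclotomicField m ℚ →ₗ[ℚ] MonoidAlgebra ℚ (CycQ m) :=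
  ∑ q : CycQ m, MonoidAlgebra.lsingle q ∘ₗ ((m : ℚ)⁻¹ • (Algebra.trace ℚ (CyclotomicField m ℚ)) ∘ₗ
    LinearMap.mulRight ℚ (rootChar m q.toAdd))

theorem cycSection_apply (κ : CyclotomicField m ℚ) : cycSection m κ =
    ∑ q : CycQ m, MonoidAlgebra.single q
      (Algebra.trace ℚ (CyclotomicField m ℚ) (κ * rootChar m q.toAdd) / m) := by
  simp [cycSection, LinearMap.sum_apply, div_eq_inv_mul]

/-- The index `none` carries the term -1 with exponent 0, which gives `sum_idemCoeff` the
homogeneous shape that the transfer of relations requires. -/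
theorem sum_idemCoeff_sub_one :
    ∑ i : Option (ZMod m), ((i.elim (-1) (idemCoeff m) : ℚ) : CyclotomicField m ℚ) *
      rootChar m (-(i.elim 0 id)) = 0 := by
  simp [Fintype.sum_option, sum_idemCoeff]

theorem idem_mul_of_mem_topFactor {G : Type} [Group G] {z : G}
    {a : MonoidAlgebra ℚ G} (ha : a ∈ topFactor ℚ z m) :
    (∑ j : ZMod m, MonoidAlgebra.single (z ^ j.val) (idemCoeff m j)) * a = a := by
  have h := mul_eq_zero_of_mem_topFactor ha _ _ (sum_idemCoeff_sub_one m)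
  rw [Fintype.sum_option, add_mul] at h
  simp only [Option.elim_none, Option.elim_some, ZMod.val_zero, pow_zero, id] at h
  rw [← sub_eq_zero, ← h, sub_eq_neg_add]
  congr 1
  rw [MonoidAlgebra.single_neg, ← MonoidAlgebra.one_def, neg_one_mul]

theorem cycAlg_cycSection (κ : CyclotomicField m ℚ) : cycAlg m (cycSection m κ) = κ := by
  have hm : (m : CyclotomicField m ℚ) ≠ 0 := Nat.cast_ne_zero.2 (NeZero.ne m)
  simp only [cycSection_apply, map_sum, cycAlg_single, Rat.cast_div, Rat.cast_natCast,
    div_mul_eq_mul_div, ← Finset.sum_div]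
  rw [div_eq_iff hm, mul_comm κ, ← sum_trace_mul_rootChar m κ]
  exact Fintype.sum_equiv Multiplicative.toAdd _ _ fun _ => rfl

/-- On a group element q the coefficient of q' is Tr(ζ_m^(q'-q))/m, the idempotent translated by q.
-/
theorem cycSection_cycAlg (a : MonoidAlgebra ℚ (CycQ m)) : cycSection m (cycAlg m a) =
    (∑ j : ZMod m, MonoidAlgebra.single (CycQ.zeta m ^ j.val) (idemCoeff m j)) * a := by
  rw [← MonoidAlgebra.sum_single_coeff a, map_sum, map_sum, Finset.mul_sum]
  refine Finset.sum_congr rfl fun q _ => ?_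
  rw [cycAlg_single, cycSection_apply, Finset.sum_mul]
  refine (Fintype.sum_equiv ((Equiv.addRight q.toAdd).trans Multiplicative.ofAdd) _ _
    fun j => ?_).symm
  rw [MonoidAlgebra.single_mul_single, CycQ.zeta_pow, mul_assoc, trace_ratCast_mul,
    ← AddChar.map_add_eq_mul, mul_comm (idemCoeff m j), idemCoeff, mul_div_assoc]
  simp [ofAdd_add]

/-- The top factor of `ℚ[Q]` is the cyclotomic field. -/
theorem cycAlg_bijOn : Set.BijOn (cycAlg m) (topFactor ℚ (CycQ.zeta m) m) Set.univ := by
  refine bijOn_topFactor _ m _ (cycSection m) _ (cycAlg_cycSection m) (cycSection_cycAlg m)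
    (map_zero _) ?_ (fun a ha => idem_mul_of_mem_topFactor m ha) (mul_comm _ _)
  rw [← aeval_algHom_apply, MonoidAlgebra.of_apply, cycAlg_single]
  simpa [CycQ.zeta] using aeval_rootChar_neg_one m

end CyclicFactor

/-! ### The top factor of ℚ[H]: Fourier inversion on the Heisenberg group. -/

section HeisenbergFactor

variable (m : ℕ) [NeZero m]

/-- The linear right inverse of `heisAlg` with image in the top factor. -/
noncomputable def heisSection :
    Matrix (ZMod m) (ZMod m) (CyclotomicField m ℚ) →ₗ[ℚ] MonoidAlgebra ℚ (Heis m) where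
  -- The coefficient of h is (dim/|H|) · Tr(tr(s ρ(h)⁻¹)), with Tr the field trace and dim/|H| =
  -- m/m³.
  toFun s := ∑ h : Heis m, MonoidAlgebra.single h
    (Algebra.trace ℚ (CyclotomicField m ℚ)
      (∑ i, s i (i - h.b) * rootChar m (h.c - h.a * i)) / (m : ℚ) ^ 2)
  map_add' s s' := by
    simp only [Matrix.add_apply, add_mul, Finset.sum_add_distrib, map_add, add_div,
      MonoidAlgebra.single_add]
  map_smul' r s := by
    simp only [Matrix.smul_apply, smul_mul_assoc, ← Finset.smul_sum, map_smul, smul_div_assoc,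
      ← MonoidAlgebra.smul_single, RingHom.id_apply]

theorem heisSection_apply (s : Matrix (ZMod m) (ZMod m) (CyclotomicField m ℚ)) :
    heisSection m s = ∑ h : Heis m, MonoidAlgebra.single h
      (Algebra.trace ℚ (CyclotomicField m ℚ)
        (∑ i, s i (i - h.b) * rootChar m (h.c - h.a * i)) / (m : ℚ) ^ 2) := rfl

theorem Heis.sum_eq {A : Type*} [AddCommMonoid A] (f : Heis m → A) :
    ∑ h, f h = ∑ b, ∑ a, ∑ c, f ⟨a, b, c⟩ := by
  rw [Fintype.sum_equiv (Heis.equivProd m) f (fun p => f ⟨p.1, p.2.1, p.2.2⟩) fun _ => rfl]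
  simp only [Fintype.sum_prod_type]
  rw [Finset.sum_comm]

theorem sum_rootChar_sub_mul (i j : ZMod m) :
    ∑ a, rootChar m (a * i - a * j) = if i = j then (m : CyclotomicField m ℚ) else 0 := by
  simp only [← mul_sub, sum_rootChar_mul, sub_eq_zero]

/-- In the entry (i, j) only b = i - j contributes. The sum over c is Fourier inversion for the
field trace, and the sum over a is character orthogonality, which isolates the row i; each
contributes a factor m. -/
theorem heisAlg_heisSection (s : Matrix (ZMod m) (ZMod m) (CyclotomicField m ℚ)) :
    heisAlg m (heisSection m s) = s := by
  have hm : (m : CyclotomicField m ℚ) ≠ 0 := Nat.cast_ne_zero.2 (NeZero.ne m)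
  ext i j
  rw [heisSection_apply, map_sum, Matrix.sum_apply]
  simp only [heisAlg_single]
  rw [Heis.sum_eq, Finset.sum_eq_single (i - j)]
  · simp only [add_sub_cancel, if_true]
    have key : ∀ a, ∑ c, ((Algebra.trace ℚ (CyclotomicField m ℚ)
        (∑ l, s l (l - (i - j)) * rootChar m (c - a * l)) / (m : ℚ) ^ 2 : ℚ) :
          CyclotomicField m ℚ) * rootChar m (a * i - c) =
        ∑ l, s l (l - (i - j)) * rootChar m (a * i - a * l) / m := fun a => by
      have h := sum_trace_mul_rootChar m (∑ l, s l (l - (i - j)) * rootChar m (-(a * l)))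
      have h1 : ∀ c, (∑ l, s l (l - (i - j)) * rootChar m (-(a * l))) * rootChar m c =
          ∑ l, s l (l - (i - j)) * rootChar m (c - a * l) := fun c => by
        rw [Finset.sum_mul]
        refine Finset.sum_congr rfl fun l _ => ?_
        rw [mul_assoc, ← AddChar.map_add_eq_mul, neg_add_eq_sub]
      simp only [h1] at h
      simp only [Rat.cast_div, Rat.cast_pow, Rat.cast_natCast, sub_eq_add_neg (a * i),
        AddChar.map_add_eq_mul, mul_comm (rootChar m (a * i)), ← mul_assoc]
      rw [← Finset.sum_mul]
      simp only [div_mul_eq_mul_div, ← Finset.sum_div]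
      rw [h, Finset.mul_sum, Finset.sum_mul, Finset.sum_div, Finset.sum_div]
      refine Finset.sum_congr rfl fun l _ => ?_
      field_simp
    simp only [key]
    rw [Finset.sum_comm]
    simp only [← Finset.sum_div, ← Finset.mul_sum, sum_rootChar_sub_mul]
    simp [hm]
  · intro b _ hb
    refine Finset.sum_eq_zero fun a _ => Finset.sum_eq_zero fun c _ => if_neg fun h => hb ?_
    rw [h]; ring
  · simp

/-- The matrix trace of ρ(h)ρ(h')⁻¹ vanishes unless h and h' differ by a central element: different
b give disjoint supports, different a give a nontrivial character sum. What remains is the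
idempotent of ℚ[Q] translated by h. -/
theorem heisSection_heisAlg (a : MonoidAlgebra ℚ (Heis m)) : heisSection m (heisAlg m a) =
    (∑ j : ZMod m, MonoidAlgebra.single (Heis.zeta m ^ j.val) (idemCoeff m j)) * a := by
  have hm : (m : ℚ) ≠ 0 := Nat.cast_ne_zero.2 (NeZero.ne m)
  rw [← MonoidAlgebra.sum_single_coeff a, map_sum, map_sum, Finset.mul_sum]
  refine Finset.sum_congr rfl fun h _ => ?_
  generalize a.coeff h = r
  rw [heisSection_apply, Finset.sum_mul, Heis.sum_eq, Finset.sum_eq_single h.b,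
    Finset.sum_eq_single h.a]
  · refine (Fintype.sum_equiv (Equiv.addRight h.c) _ _ fun j => ?_).symm
    have e : ∀ l : ZMod m, h.a * l - h.c + (j + h.c - h.a * l) = j := fun l => by ring
    simp only [heisAlg_single, sub_add_cancel, if_true, mul_assoc, ← AddChar.map_add_eq_mul,
      Equiv.coe_addRight, e, Finset.sum_const, Finset.card_univ, ZMod.card, map_nsmul,
      trace_ratCast_mul]
    rw [MonoidAlgebra.single_mul_single, Heis.zeta_pow, idemCoeff]
    congr 1
    · simp [Heis.mul_def]
    · rw [nsmul_eq_mul]; field_simp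
  · intro a' _ ha
    refine Finset.sum_eq_zero fun c _ => ?_
    have e : ∀ l : ZMod m, h.a * l - h.c + (c - a' * l) = (c - h.c) + l * (h.a - a') :=
      fun l => by ring
    simp only [heisAlg_single, sub_add_cancel, if_true, mul_assoc, ← AddChar.map_add_eq_mul, e]
    simp only [AddChar.map_add_eq_mul, ← Finset.mul_sum, sum_rootChar_mul,
      if_neg (sub_ne_zero.2 ha.symm)]
    simp
  · simp
  · intro b _ hb
    refine Finset.sum_eq_zero fun a' _ => Finset.sum_eq_zero fun c _ => ?_
    have e : ∀ l : ZMod m, l ≠ l - b + h.b := fun l hl => hb (by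
      have : l - (l - b + h.b) = 0 := sub_eq_zero.2 hl
      have h2 : b - h.b = 0 := by rw [← this]; ring
      exact sub_eq_zero.1 h2)
    simp [heisAlg_single, e]
  · simp

theorem heisAlg_zeta : heisAlg m (MonoidAlgebra.of ℚ _ (Heis.zeta m)) =
    algebraMap (CyclotomicField m ℚ) _ (rootChar m (-1)) := by
  ext i j
  rw [MonoidAlgebra.of_apply, heisAlg_single, Matrix.algebraMap_matrix_apply]
  simp [Heis.zeta]

/-- The top factor of `ℚ[H]` is the matrix algebra over the cyclotomic field. -/
theorem heisAlg_bijOn : Set.BijOn (heisAlg m) (topFactor ℚ (Heis.zeta m) m) Set.univ := by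
  refine bijOn_topFactor _ m _ (heisSection m) _ (heisAlg_heisSection m) (heisSection_heisAlg m)
    (map_zero _) ?_ (fun a ha => idem_mul_of_mem_topFactor m ha) ?_
  · rw [← aeval_algHom_apply, heisAlg_zeta, aeval_algebraMap_apply, aeval_rootChar_neg_one,
      map_zero]
  · refine Commute.sum_right _ _ _ fun j _ => ?_
    rw [Commute, SemiconjBy, MonoidAlgebra.of_apply, MonoidAlgebra.single_mul_single,
      MonoidAlgebra.single_mul_single, Heis.mul_zeta, one_mul, mul_one]

end HeisenbergFactor

/-! ### Representations of the Heisenberg group and their `τ`-invariants -/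

/-- The coefficient of 1 in the Reidemeister pairing is the form itself, and for an equivariant map
the other coefficients are values of the form too. -/
theorem mem_reidAut_iff {k G V : Type} [CommRing k] [Group G] [Fintype G] [AddCommGroup V]
    [Module k V] {ρ : Representation k G V} {B : LinearMap.BilinForm k V} {f : V ≃ₗ[k] V} :
    f ∈ reidAut ρ B ↔ (∀ g x, f (ρ g x) = ρ g (f x)) ∧ ∀ x y, B (f x) (f y) = B x y := by
  refine and_congr_right fun h => forall_congr' fun x => ⟨fun H y => ?_, fun H y => ?_⟩
  · have h1 := congrArg (fun a => a.coeff 1) (H y)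
    simpa only [reidemeister, MonoidAlgebra.coeff_sum_single, map_one, Module.End.one_apply]
      using h1
  · simp only [reidemeister, ← h, H]

theorem map_aeval_apply {k V N : Type} [CommRing k] [AddCommGroup V] [Module k V] [AddCommGroup N]
    [Module k N] {t : N →ₗ[k] V} {A : Module.End k N} {A' : Module.End k V}
    (h : ∀ n, t (A n) = A' (t n)) (p : k[X]) (n : N) : t (aeval A p n) = aeval A' p (t n) := by
  induction p using Polynomial.induction_on' with
  | add p q hp hq => simp only [map_add, LinearMap.add_apply, hp, hq]
  | monomial j a =>
    simp only [aeval_monomial, Module.End.mul_apply, Module.algebraMap_end_apply, map_smul]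
    congr 1
    induction j with
    | zero => simp
    | succ j ih => rw [pow_succ', pow_succ', Module.End.mul_apply, Module.End.mul_apply, h, ih]

section Descent

variable {m : ℕ} [NeZero m] {k V N : Type} [CommRing k] [Algebra ℚ k] [AddCommGroup V] [Module k V]
  [AddCommGroup N] [Module k N]

variable (m k) in
theorem isUnit_natCast_of_ratAlgebra : IsUnit (m : k) := by
  have h : IsUnit (m : ℚ) := (Nat.cast_ne_zero.2 (NeZero.ne m)).isUnit
  simpa using h.map (algebraMap ℚ k)

/-- `t` identifies the representation `ρ'` of `⟨ζ⟩` with the `τ`-invariants of the representation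
`ρ` of the Heisenberg group, in which `ζ` acts with order `m`. -/
structure IsTauDescent (ρ : Representation k (Heis m) V) (ρ' : Representation k (CycQ m) N)
    (t : N →ₗ[k] V) : Prop where
  cyclotomic_zeta : aeval (ρ (Heis.zeta m)) (cyclotomic m k) = 0
  injective : Function.Injective t
  tau_apply : ∀ n, ρ (Heis.tau m) (t n) = t n
  exists_of_tau : ∀ v, ρ (Heis.tau m) v = v → ∃ n, t n = v
  zeta_apply : ∀ n, t (ρ' (CycQ.zeta m) n) = ρ (Heis.zeta m) (t n)

theorem Heis.tau_pow (j : ZMod m) : Heis.tau m ^ j.val = ⟨j, 0, 0⟩ := by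
  have h : ∀ n : ℕ, Heis.tau m ^ n = ⟨n, 0, 0⟩ := fun n => by
    induction n with
    | zero => simp; rfl
    | succ n ih => rw [pow_succ, ih]; simp [Heis.mul_def, Heis.tau]
  rw [h]
  simp

/-- Since ∑_a ζ_m^(al) = 0 for every l ≠ 0, unit or not, the same holds for the operator ζ. For the
splitting of V, this is where it matters that ζ has exact order m. -/
theorem sum_rho_zeta_mul {ρ : Representation k (Heis m) V}
    (hρ : aeval (ρ (Heis.zeta m)) (cyclotomic m k) = 0) (l : ZMod m) (v : V) :
    ∑ a, ρ ⟨0, 0, a * l⟩ v = if l = 0 then (m : k) • v else 0 := by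
  split_ifs with h
  · subst h
    have : ∀ a : ZMod m, ρ ⟨0, 0, a * 0⟩ v = v := fun a => by
      rw [mul_zero]
      exact LinearMap.congr_fun ρ.map_one v
    simp only [this, Finset.sum_const, Finset.card_univ, ZMod.card, Nat.cast_smul_eq_nsmul]
  · have h1 := sum_smul_pow_eq_zero_of_rootChar m (ρ (Heis.zeta m)) (v := v) (by rw [hρ]; rfl)
      (fun _ => 1) (fun a => a * l) (by
        simp only [← mul_neg, Rat.cast_one, one_mul, sum_rootChar_mul, neg_eq_zero, if_neg h])
    simpa [← map_pow, Heis.zeta_pow] using h1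

namespace IsTauDescent

variable {ρ : Representation k (Heis m) V} {ρ' : Representation k (CycQ m) N} {t : N →ₗ[k] V}

theorem zeta_pow_apply (H : IsTauDescent ρ ρ' t) (c : ZMod m) (n : N) :
    ρ ⟨0, 0, c⟩ (t n) = t (ρ' (Multiplicative.ofAdd c) n) := by
  have h : ∀ (j : ℕ) (n : N), t ((ρ' (CycQ.zeta m) ^ j) n) = (ρ (Heis.zeta m) ^ j) (t n) := by
    intro j
    induction j with
    | zero => simp
    | succ j ih => intro n; simp only [pow_succ, Module.End.mul_apply, ih, H.zeta_apply]
  have h2 := h c.val n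
  rw [← map_pow, ← map_pow, Heis.zeta_pow, CycQ.zeta_pow] at h2
  exact h2.symm

theorem tau_pow_apply (H : IsTauDescent ρ ρ' t) (a : ZMod m) (n : N) : ρ ⟨a, 0, 0⟩ (t n) = t n := by
  rw [← Heis.tau_pow, map_pow]
  induction a.val with
  | zero => simp
  | succ j ih => rw [pow_succ', Module.End.mul_apply, ih, H.tau_apply]

theorem cyclotomic_zeta' (H : IsTauDescent ρ ρ' t) :
    aeval (ρ' (CycQ.zeta m)) (cyclotomic m k) = 0 := by
  ext n
  apply H.injective
  rw [map_aeval_apply H.zeta_apply, H.cyclotomic_zeta]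
  simp

/-- The action of the Heisenberg group on the translates `σ^j t(N)`. -/
theorem rho_sigma_apply (H : IsTauDescent ρ ρ' t) (h : Heis m) (j : ZMod m) (n : N) :
    ρ h (ρ ⟨0, j, 0⟩ (t n)) =
      ρ ⟨0, j + h.b, 0⟩ (t (ρ' (Multiplicative.ofAdd (h.c - h.a * (j + h.b))) n)) := by
  rw [← H.zeta_pow_apply]
  -- Inserting τ^a, which fixes t n, reduces the claim to the group identity h σ^j = σ^(j+b)
  -- ζ^(c-a(j+b)) τ^a.
  conv_rhs => rw [← H.tau_pow_apply h.a n]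
  simp only [← Module.End.mul_apply, ← map_mul]
  congr 2
  ext <;> simp only [Heis.mul_def] <;> ring

theorem sum_rho'_mul (H : IsTauDescent ρ ρ' t) (l : ZMod m) (n : N) :
    ∑ a, ρ' (Multiplicative.ofAdd (a * l)) n = if l = 0 then (m : k) • n else 0 := by
  apply H.injective
  rw [map_sum]
  simp only [← H.zeta_pow_apply, sum_rho_zeta_mul H.cyclotomic_zeta]
  split_ifs <;> simp

variable (ρ t) in
/-- The map `(n_j) ↦ ∑_j σ^j t(n_j)`. -/
noncomputable def sumMap : (ZMod m → N) →ₗ[k] V :=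
  ∑ j, ρ ⟨0, j, 0⟩ ∘ₗ t ∘ₗ LinearMap.proj j

theorem sumMap_apply (f : ZMod m → N) : sumMap ρ t f = ∑ j, ρ ⟨0, j, 0⟩ (t (f j)) := by
  simp [sumMap, LinearMap.sum_apply]

/-- The operator (∑_a τ^a) σ^(-i) extracts the i-th component: on σ^j t(N) it involves ∑_a
ζ^(-a(j-i)), which is m for j = i and 0 otherwise. -/
theorem sumMap_injective (H : IsTauDescent ρ ρ' t) : Function.Injective (sumMap ρ t) := by
  rw [injective_iff_map_eq_zero]
  intro f hf
  rw [sumMap_apply] at hf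
  ext i
  have h1 : ∑ a, ρ ⟨a, 0, 0⟩ (ρ ⟨0, -i, 0⟩ (∑ j, ρ ⟨0, j, 0⟩ (t (f j)))) = (m : k) • t (f i) := by
    simp only [map_sum, H.rho_sigma_apply]
    rw [Finset.sum_comm]
    have h2 : ∀ j, ∑ a, ρ ⟨0, j + -i + 0, 0⟩ (t (ρ' (Multiplicative.ofAdd
        (0 - a * (j + -i + 0))) (ρ' (Multiplicative.ofAdd (0 - 0 * (j + -i))) (f j)))) =
        ρ ⟨0, j + -i + 0, 0⟩ (t (if j = i then (m : k) • f j else 0)) := fun j => by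
      rw [← map_sum, ← map_sum]
      have h3 := H.sum_rho'_mul (-(j + -i + 0)) (f j)
      simp only [neg_eq_zero, add_zero, ← sub_eq_add_neg, sub_eq_zero] at h3
      rw [← h3]
      congr 2
      refine Finset.sum_congr rfl fun a _ => ?_
      rw [← Module.End.mul_apply, ← map_mul, ← ofAdd_add]
      congr 3
      ring
    simp only [h2]
    rw [Finset.sum_eq_single i]
    · rw [if_pos rfl, map_smul, map_smul]
      congr 1
      rw [add_neg_cancel, add_zero]
      exact LinearMap.congr_fun ρ.map_one _
    · intro j _ hj
      simp [hj]
    · simp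
  rw [hf] at h1
  simp only [map_zero, Finset.sum_const_zero] at h1
  have h4 := (isUnit_natCast_of_ratAlgebra m k).smul_eq_zero.1 h1.symm
  exact H.injective (by simpa using h4)

/-- Since σ^j τ^a σ^(-j) = ζ^(ja) τ^a, the sum ∑_j σ^j (∑_a τ^a) σ^(-j) collapses to its a = 0 part,
which is m. Each (∑_a τ^a) σ^(-j) v is τ-invariant, hence in t(N). -/
theorem sumMap_surjective (H : IsTauDescent ρ ρ' t) : Function.Surjective (sumMap ρ t) := by
  intro v
  have hu := isUnit_natCast_of_ratAlgebra m k
  have hinv : ∀ w, ∃ n, t n = ∑ a, ρ ⟨a, 0, 0⟩ w := fun w => by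
    refine H.exists_of_tau _ ?_
    rw [map_sum]
    refine Fintype.sum_equiv (Equiv.addLeft 1) _ _ fun a => ?_
    rw [← Module.End.mul_apply, ← map_mul]
    simp [Heis.mul_def, Heis.tau]
  choose f hf using fun j : ZMod m => hinv (ρ ⟨0, -j, 0⟩ v)
  have h1 : sumMap ρ t f = (m : k) • v := by
    rw [sumMap_apply]
    have h2 : ∀ j, ρ ⟨0, j, 0⟩ (t (f j)) = ∑ a, ρ ⟨a, 0, 0⟩ (ρ ⟨0, 0, j * a⟩ v) := fun j => by
      rw [hf, map_sum]
      refine Finset.sum_congr rfl fun a _ => ?_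
      simp only [← Module.End.mul_apply, ← map_mul]
      congr 2
      ext <;> simp [Heis.mul_def]
    simp only [h2]
    rw [Finset.sum_comm]
    simp only [← map_sum, sum_rho_zeta_mul H.cyclotomic_zeta]
    rw [Finset.sum_eq_single 0]
    · rw [if_pos rfl]
      exact LinearMap.congr_fun ρ.map_one _
    · intro a _ ha
      simp [ha]
    · simp
  obtain ⟨r, hr⟩ := hu.exists_left_inv
  exact ⟨r • f, by rw [map_smul, h1, smul_smul, hr, one_smul]⟩

/-- The decomposition of `V` as the direct sum of the `σ^j t(N)`. -/
noncomputable def decomp (H : IsTauDescent ρ ρ' t) : (ZMod m → N) ≃ₗ[k] V :=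
  LinearEquiv.ofBijective (sumMap ρ t) ⟨H.sumMap_injective, H.sumMap_surjective⟩

theorem decomp_apply (H : IsTauDescent ρ ρ' t) (f : ZMod m → N) :
    H.decomp f = ∑ j, ρ ⟨0, j, 0⟩ (t (f j)) :=
  sumMap_apply f

theorem sigma_zero_apply (v : V) : ρ ⟨0, 0, 0⟩ v = v := LinearMap.congr_fun ρ.map_one v

theorem decomp_single (H : IsTauDescent ρ ρ' t) (j : ZMod m) (n : N) :
    H.decomp (Pi.single j n) = ρ ⟨0, j, 0⟩ (t n) := by
  rw [decomp_apply, Finset.sum_eq_single j]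
  · simp
  · intro i _ hi; simp [hi]
  · simp

theorem exists_eq_sum (H : IsTauDescent ρ ρ' t) (v : V) :
    ∃ f : ZMod m → N, v = ∑ j, ρ ⟨0, j, 0⟩ (t (f j)) :=
  ⟨H.decomp.symm v, by rw [← H.decomp_apply, LinearEquiv.apply_symm_apply]⟩

/-- Equivariant maps that agree on the `τ`-invariants are equal. -/
theorem eq_of_eq_on_invariants (H : IsTauDescent ρ ρ' t) {f f' : V →ₗ[k] V}
    (hf : ∀ h x, f (ρ h x) = ρ h (f x))
    (hf' : ∀ h x, f' (ρ h x) = ρ h (f' x)) (h : ∀ n, f (t n) = f' (t n)) : f = f' := by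
  ext v
  obtain ⟨c, rfl⟩ := H.exists_eq_sum v
  simp only [map_sum, hf, hf', h]

/-! ### Orthogonality of the summands and the isomorphism of automorphism groups. -/

section Form

variable {B : LinearMap.BilinForm k V} {B' : LinearMap.BilinForm k N}

/-- The summands `σ^j t(N)` are orthogonal. -/
theorem form_sigma (H : IsTauDescent ρ ρ' t)
    (hB : ∀ h x y, B (ρ h x) (ρ h y) = B x y) (hBt : ∀ x y, B (t x) (t y) = (m : k) * B' x y)
    (i j : ZMod m) (n n' : N) :
    B (ρ ⟨0, i, 0⟩ (t n)) (ρ ⟨0, j, 0⟩ (t n')) = if i = j then (m : k) * B' n n' else 0 := by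
  split_ifs with h
  · subst h
    rw [hB, hBt]
  · have h1 : (m : k) * B (ρ ⟨0, i, 0⟩ (t n)) (ρ ⟨0, j, 0⟩ (t n')) = 0 := by
      -- The isometry τ^a ζ^(ai) is the identity on σ^i t(N) and acts as ζ^(a(i-j)) on σ^j t(N).
      -- Summing over a kills the pairing.
      have h2 : ∀ a : ZMod m, B (ρ ⟨0, i, 0⟩ (t n)) (ρ ⟨0, j, 0⟩ (t n')) =
          B (ρ ⟨0, i, 0⟩ (t n)) (ρ ⟨0, j, 0⟩ (t (ρ' (Multiplicative.ofAdd (a * (i - j))) n'))) := by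
        intro a
        rw [← hB ⟨a, 0, a * i⟩, H.rho_sigma_apply, H.rho_sigma_apply]
        simp only [add_zero, sub_self, ofAdd_zero, map_one, Module.End.one_apply, mul_sub]
      have h3 : (m : k) * B (ρ ⟨0, i, 0⟩ (t n)) (ρ ⟨0, j, 0⟩ (t n')) =
          ∑ a : ZMod m, B (ρ ⟨0, i, 0⟩ (t n)) (ρ ⟨0, j, 0⟩ (t n')) := by
        simp
      rw [h3, Finset.sum_congr rfl fun a _ => h2 a]
      simp only [← map_sum, H.sum_rho'_mul, if_neg (sub_ne_zero.2 h), map_zero]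
    exact (isUnit_natCast_of_ratAlgebra m k).mul_right_eq_zero.1 h1

theorem form_zeta (H : IsTauDescent ρ ρ' t)
    (hB : ∀ h x y, B (ρ h x) (ρ h y) = B x y) (hBt : ∀ x y, B (t x) (t y) = (m : k) * B' x y)
    (q : CycQ m) (x y : N) : B' (ρ' q x) (ρ' q y) = B' x y := by
  have h := hB ⟨0, 0, q.toAdd⟩ (t x) (t y)
  rw [H.zeta_pow_apply, H.zeta_pow_apply, hBt, hBt] at h
  exact (isUnit_natCast_of_ratAlgebra m k).mul_left_cancel h

/-- An equivariant f commutes with τ, so f and its inverse preserve t(N). The form on N is recovered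
from that on V because m is a unit. -/
theorem exists_restrict (H : IsTauDescent ρ ρ' t)
    (hBt : ∀ x y, B (t x) (t y) = (m : k) * B' x y)
    {f : V ≃ₗ[k] V} (hf : f ∈ reidAut ρ B) :
    ∃ f' ∈ reidAut ρ' B', ∀ n, t (f' n) = f (t n) := by
  obtain ⟨hf1, hf2⟩ := mem_reidAut_iff.1 hf
  -- The component at 0 of the decomposition is a linear left inverse of t.
  let L : N →ₗ[k] N := LinearMap.proj 0 ∘ₗ H.decomp.symm.toLinearMap ∘ₗ f.toLinearMap ∘ₗ t
  have hL : ∀ n, t (L n) = f (t n) := fun n => by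
    obtain ⟨n', hn'⟩ := H.exists_of_tau (f (t n)) (by rw [← hf1, H.tau_apply])
    have h1 : L n = (H.decomp.symm (f (t n))) 0 := rfl
    have h2 : f (t n) = H.decomp (Pi.single 0 n') := by
      rw [H.decomp_single, sigma_zero_apply, hn']
    rw [h1, h2, LinearEquiv.symm_apply_apply, Pi.single_eq_same, ← h2, hn']
  have hbij : Function.Bijective L := by
    refine ⟨fun x y hxy => H.injective (f.injective (by rw [← hL, ← hL, hxy])), fun n => ?_⟩
    obtain ⟨n', hn'⟩ := H.exists_of_tau (f.symm (t n)) (by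
      apply f.injective
      rw [hf1, LinearEquiv.apply_symm_apply, H.tau_apply])
    exact ⟨n', H.injective (by rw [hL, hn', LinearEquiv.apply_symm_apply])⟩
  refine ⟨LinearEquiv.ofBijective L hbij, mem_reidAut_iff.2 ⟨fun q x => ?_, fun x y => ?_⟩, hL⟩
  · apply H.injective
    have h := H.zeta_pow_apply q.toAdd
    simp only [ofAdd_toAdd] at h
    simp only [LinearEquiv.ofBijective_apply]
    rw [hL, ← h, hf1, ← hL, h]
  · apply (isUnit_natCast_of_ratAlgebra m k).mul_left_cancel
    simp only [LinearEquiv.ofBijective_apply]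
    rw [← hBt, hL, hL, hf2, hBt]

/-- Equivariance forces σ^j t(n) ↦ σ^j t(f' n). This commutes with H because group elements permute
the summands up to powers of ζ, with which f' commutes; it is an isometry because the summands are
orthogonal. -/
theorem exists_extend (H : IsTauDescent ρ ρ' t)
    (hB : ∀ h x y, B (ρ h x) (ρ h y) = B x y) (hBt : ∀ x y, B (t x) (t y) = (m : k) * B' x y)
    {f' : N ≃ₗ[k] N} (hf' : f' ∈ reidAut ρ' B') :
    ∃ f ∈ reidAut ρ B, ∀ n, t (f' n) = f (t n) := by
  obtain ⟨hf1, hf2⟩ := mem_reidAut_iff.1 hf'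
  let F : V ≃ₗ[k] V := H.decomp.symm.trans ((LinearEquiv.piCongrRight fun _ => f').trans H.decomp)
  have hF : ∀ j n, F (ρ ⟨0, j, 0⟩ (t n)) = ρ ⟨0, j, 0⟩ (t (f' n)) := fun j n => by
    rw [← H.decomp_single, ← H.decomp_single]
    simp only [F, LinearEquiv.trans_apply, LinearEquiv.symm_apply_apply]
    congr 1
    ext i
    by_cases h : i = j
    · subst h; simp
    · simp [h]
  refine ⟨F, mem_reidAut_iff.2 ⟨fun h x => ?_, fun x y => ?_⟩, fun n => ?_⟩
  · obtain ⟨c, rfl⟩ := H.exists_eq_sum x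
    simp only [map_sum, H.rho_sigma_apply, hF, hf1]
  · obtain ⟨c, rfl⟩ := H.exists_eq_sum x
    obtain ⟨c', rfl⟩ := H.exists_eq_sum y
    simp only [map_sum, LinearMap.sum_apply, hF, H.form_sigma hB hBt, hf2]
  · have h := hF 0 n
    rw [sigma_zero_apply, sigma_zero_apply] at h
    exact h.symm

/-- Restriction to the `τ`-invariants is an isomorphism of the automorphism groups. -/
theorem exists_mulEquiv (H : IsTauDescent ρ ρ' t)
    (hB : ∀ h x y, B (ρ h x) (ρ h y) = B x y) (hBt : ∀ x y, B (t x) (t y) = (m : k) * B' x y) :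
    ∃ α : reidAut ρ B ≃* reidAut ρ' B',
      ∀ (f : reidAut ρ B) (n : N), t ((α f).1 n) = f.1 (t n) := by
  choose r hr hrt using fun f : reidAut ρ B => H.exists_restrict hBt f.2
  choose s hs hst using fun f : reidAut ρ' B' => H.exists_extend hB hBt f.2
  refine ⟨{ toFun := fun f => ⟨r f, hr f⟩
            invFun := fun f => ⟨s f, hs f⟩
            left_inv := fun f => ?_
            right_inv := fun f => ?_
            map_mul' := fun f f' => ?_ }, hrt⟩
  · apply Subtype.ext
    apply LinearEquiv.toLinearMap_injective
    refine H.eq_of_eq_on_invariants (mem_reidAut_iff.1 (hs ⟨r f, hr f⟩)).1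
      (mem_reidAut_iff.1 f.2).1 fun n => ?_
    exact (hst ⟨r f, hr f⟩ n).symm.trans (hrt f n)
  · apply Subtype.ext
    ext n
    apply H.injective
    exact (hrt ⟨s f, hs f⟩ n).trans (hst f n).symm
  · apply Subtype.ext
    ext n
    apply H.injective
    refine (hrt (f * f') n).trans ?_
    change f.1 (f'.1 (t n)) = t (r f (r f' n))
    rw [hrt, hrt]

end Form

end IsTauDescent

end Descent

/-! ### Sesquilinearity of the Reidemeister pairing -/

section Sesquilinear

variable {k G V : Type} [CommRing k] [Group G] [Fintype G] [AddCommGroup V] [Module k V]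
  (ρ : Representation k G V) (B : LinearMap.BilinForm k V)

/-- The Reidemeister pairing as a bilinear map. -/
noncomputable def reidBilin : V →ₗ[k] V →ₗ[k] MonoidAlgebra k G :=
  LinearMap.mk₂ k (reidemeister ρ B)
    (fun x x' y => by simp [reidemeister, MonoidAlgebra.single_add, Finset.sum_add_distrib])
    (fun r x y => by simp [reidemeister, Finset.smul_sum])
    (fun x y y' => by simp [reidemeister, MonoidAlgebra.single_add, Finset.sum_add_distrib])
    (fun r x y => by simp [reidemeister, Finset.smul_sum])

theorem reidBilin_apply (x y : V) : reidBilin ρ B x y = reidemeister ρ B x y := rfl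

variable {ρ B}

/-- Invariance gives (g x, h y) = (x, g⁻¹h y), so the coefficient moves out after reindexing h by
left multiplication with g⁻¹. -/
theorem reidemeister_smul_left (hB : ∀ g x y, B (ρ g x) (ρ g y) = B x y)
    (a : MonoidAlgebra k G) (x y : V) :
    reidemeister ρ B (ρ.asAlgebraHom a x) y = a * reidemeister ρ B x y := by
  rw [← MonoidAlgebra.sum_single_coeff a, map_sum, LinearMap.sum_apply, ← reidBilin_apply, map_sum,
    LinearMap.sum_apply, Finset.sum_mul]
  refine Finset.sum_congr rfl fun g _ => ?_
  rw [Representation.asAlgebraHom_single, LinearMap.smul_apply, map_smul, LinearMap.smul_apply,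
    reidBilin_apply, reidemeister, reidemeister, Finset.smul_sum, Finset.mul_sum]
  refine Fintype.sum_equiv (Equiv.mulLeft g⁻¹) _ _ fun h => ?_
  rw [MonoidAlgebra.smul_single, MonoidAlgebra.single_mul_single, smul_eq_mul, Equiv.coe_mulLeft,
    mul_inv_cancel_left, ← hB g x, ← Module.End.mul_apply (ρ g), ← map_mul, mul_inv_cancel_left]

theorem reidemeister_smul_right (a : MonoidAlgebra k G) (x y : V) :
    reidemeister ρ B x (ρ.asAlgebraHom a y) =
      reidemeister ρ B x y * ∑ g, MonoidAlgebra.single g⁻¹ (a.coeff g) := by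
  conv_lhs => rw [← MonoidAlgebra.sum_single_coeff a]
  rw [map_sum, LinearMap.sum_apply, ← reidBilin_apply, map_sum, Finset.mul_sum]
  refine Finset.sum_congr rfl fun g _ => ?_
  rw [Representation.asAlgebraHom_single, LinearMap.smul_apply, map_smul,
    reidBilin_apply, reidemeister, reidemeister, Finset.smul_sum, Finset.sum_mul]
  refine Fintype.sum_equiv (Equiv.mulRight g) _ _ fun h => ?_
  rw [MonoidAlgebra.smul_single, MonoidAlgebra.single_mul_single, smul_eq_mul, Equiv.coe_mulRight,
    mul_inv_cancel_right, map_mul, Module.End.mul_apply, mul_comm]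

/-- By left linearity, Φ_m(z)⟨x, y⟩ = ⟨Φ_m(z)x, y⟩ = 0. For ζ in Q or H over ℚ, the pairing is thus
determined by its image under `cycAlg` or `heisAlg`. -/
theorem reidemeister_mem_topFactor (hB : ∀ g x y, B (ρ g x) (ρ g y) = B x y) {z : G} {m : ℕ}
    (hz : aeval (ρ z) (cyclotomic m k) = 0) (x y : V) :
    reidemeister ρ B x y ∈ topFactor k z m := by
  change aeval (MonoidAlgebra.of k G z) (cyclotomic m k) * reidemeister ρ B x y = 0
  rw [← reidemeister_smul_left hB, ← aeval_algHom_apply, MonoidAlgebra.of_apply,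
    Representation.asAlgebraHom_single_one, hz, ← reidBilin_apply]
  simp

theorem map_asAlgebraHom_of_equivariant {f : V →ₗ[k] V} (hf : ∀ g x, f (ρ g x) = ρ g (f x))
    (a : MonoidAlgebra k G) (x : V) : f (ρ.asAlgebraHom a x) = ρ.asAlgebraHom a (f x) := by
  rw [← MonoidAlgebra.sum_single_coeff a]
  simp only [map_sum, LinearMap.sum_apply, Representation.asAlgebraHom_single,
    LinearMap.smul_apply, map_smul, hf]

end Sesquilinear

/-! ### The involution g ↦ g⁻¹ and conjugation in the simple factors. -/

section StarCompat

variable (m : ℕ) [NeZero m]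

theorem cycAlg_inv (a : MonoidAlgebra ℚ (CycQ m)) :
    cycAlg m (∑ g, MonoidAlgebra.single g⁻¹ (a.coeff g)) = cycConj m (cycAlg m a) := by
  conv_rhs => rw [← MonoidAlgebra.sum_single_coeff a]
  simp only [map_sum, cycAlg_single, map_mul, map_ratCast, cycConj_rootChar, toAdd_inv]

/-- Each ρ(h) is a monomial matrix whose nonzero entries are roots of unity, so its inverse is its
conjugate transpose. -/
theorem heisAlg_inv (a : MonoidAlgebra ℚ (Heis m)) :
    heisAlg m (∑ g, MonoidAlgebra.single g⁻¹ (a.coeff g)) =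
      (heisAlg m a).transpose.map (cycConj m) := by
  ext i j
  conv_rhs => rw [← MonoidAlgebra.sum_single_coeff a]
  simp only [map_sum, Matrix.sum_apply, Matrix.map_apply, Matrix.transpose_apply, heisAlg_single]
  refine Finset.sum_congr rfl fun h _ => ?_
  have hinv : h⁻¹ = ⟨-h.a, -h.b, -h.c + h.b * h.a⟩ := rfl
  rw [hinv]
  by_cases hij : j = i + h.b
  · subst hij
    rw [if_pos rfl, if_pos (by ring), map_mul, map_ratCast, cycConj_rootChar]
    congr 2
    ring
  · rw [if_neg hij, if_neg (fun h1 => hij (by rw [h1]; ring)), map_zero]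

end StarCompat

/-! ### Modules over the simple factors -/

section Lift

/-- The factorization of `F` through the surjective homomorphism `r` with linear section `sec`. -/
def AlgHom.liftOfSection {k A S E : Type*} [CommRing k] [Ring A] [Ring S] [Ring E] [Algebra k A]
    [Algebra k S] [Algebra k E] (r : A →ₐ[k] S) (sec : S →ₗ[k] A) (hsec : ∀ s, r (sec s) = s)
    (F : A →ₐ[k] E) (hF : ∀ a, r a = 0 → F a = 0) : S →ₐ[k] E :=
  AlgHom.ofLinearMap (F.toLinearMap ∘ₗ sec)
    (by
      have h := hF (sec 1 - 1) (by rw [map_sub, hsec, map_one, sub_self])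
      rw [map_sub, map_one F, sub_eq_zero] at h
      exact h)
    (fun s s' => by
      have h := hF (sec (s * s') - sec s * sec s') (by
        rw [map_sub, map_mul r, hsec, hsec, hsec, sub_self])
      rw [map_sub, map_mul F, sub_eq_zero] at h
      exact h)

theorem AlgHom.liftOfSection_apply {k A S E : Type*} [CommRing k] [Ring A] [Ring S] [Ring E]
    [Algebra k A] [Algebra k S] [Algebra k E] (r : A →ₐ[k] S) (sec : S →ₗ[k] A)
    (hsec : ∀ s, r (sec s) = s) (F : A →ₐ[k] E) (hF : ∀ a, r a = 0 → F a = 0) (a : A) :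
    AlgHom.liftOfSection r sec hsec F hF (r a) = F a := by
  have h := hF (sec (r a) - a) (by rw [map_sub, hsec, sub_self])
  rw [map_sub, sub_eq_zero] at h
  exact h

/-- The coefficients may be moved along the bijection r. This replaces bases over an ideal of the
group algebra by bases over ℚ(ζ_m) or over its matrix algebra. -/
theorem isFactorBasis_iff {G V S ι : Type} [Group G] [AddCommGroup V] [Module ℚ V]
    [Fintype ι] [Ring S] [Algebra ℚ S] {ρ : Representation ℚ G V} {z : G} {m : ℕ}
    {r : MonoidAlgebra ℚ G →ₐ[ℚ] S} (hr : Set.BijOn r (topFactor ℚ z m) Set.univ)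
    {act : S →ₐ[ℚ] Module.End ℚ V} (hact : ∀ a, act (r a) = ρ.asAlgebraHom a) (x : ι → V) :
    IsFactorBasis ρ z m x ↔ Function.Bijective fun s : ι → S => ∑ i, act (s i) (x i) := by
  have hb : Function.Bijective fun a : topFactor ℚ z m => r a.1 := by
    refine ⟨fun a b hab => Subtype.ext (hr.injOn a.2 b.2 hab), fun s => ?_⟩
    obtain ⟨a, ha, has⟩ := hr.surjOn (Set.mem_univ s)
    exact ⟨⟨a, ha⟩, has⟩
  let e : (ι → topFactor ℚ z m) ≃ (ι → S) := Equiv.piCongrRight fun _ => Equiv.ofBijective _ hb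
  rw [← Function.Bijective.of_comp_iff _ e.bijective]
  have h : (fun s : ι → S => ∑ i, act (s i) (x i)) ∘ e =
      fun a : ι → topFactor ℚ z m => ∑ i, ρ.asAlgebraHom (a i).1 (x i) := by
    ext a
    exact Finset.sum_congr rfl fun i _ => by rw [← hact]; rfl
  rw [h]
  rfl

end Lift

/-! ### Automorphism groups of free modules as matrix groups. -/

section MatrixGroup

/-- The automorphisms of a free module as matrices. -/
theorem exists_mulEquiv_generalLinear {K N ι : Type} [CommRing K] [AddCommGroup N] [Module K N]
    [Fintype ι] [DecidableEq ι] {y : ι → N}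
    (hy : Function.Bijective fun κ : ι → K => ∑ p, κ p • y p) :
    ∃ Ω : (N ≃ₗ[K] N) ≃* GL ι K, ∀ φ q, φ (y q) = ∑ p, (Ω φ).1 p q • y p := by
  let L : (ι → K) ≃ₗ[K] N := LinearEquiv.ofBijective (Fintype.linearCombination K y) hy
  let b : Module.Basis ι K N := Module.Basis.ofEquivFun L.symm
  have hb : ∀ p, b p = y p := fun p => by
    have h1 : b p = L (Pi.single p 1) := by simp [b]
    rw [h1]
    change Fintype.linearCombination K y (Pi.single p 1) = y p
    simp
  refine ⟨(LinearMap.GeneralLinearGroup.generalLinearEquiv K N).symm.trans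
    (Units.mapEquiv (LinearMap.toMatrixAlgEquiv b).toMulEquiv), fun φ q => ?_⟩
  have h2 := b.sum_repr (φ (b q))
  have h3 : ∀ p, LinearMap.toMatrixAlgEquiv b φ.toLinearMap p q = b.repr (φ (b q)) p := fun p => by
    rw [LinearMap.toMatrixAlgEquiv_apply]
    rfl
  simp only [hb] at h2 h3
  refine h2.symm.trans (Finset.sum_congr rfl fun p _ => ?_)
  rw [← h3]
  rfl

/-- A group `R` of `K`-linear automorphisms of a free `K`-module is isomorphic to the group `P` of
their matrices. -/
theorem exists_mulEquiv_of_mem_iff {K N ι : Type} [CommRing K] [AddCommGroup N] [Module K N]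
    [Module ℚ N] [Fintype ι] [DecidableEq ι] {y : ι → N}
    (hy : Function.Bijective fun κ : ι → K => ∑ p, κ p • y p)
    (R : Subgroup (N ≃ₗ[ℚ] N)) (P : Subgroup (GL ι K))
    (hR : ∀ f ∈ R, ∀ (κ : K) (n : N), f (κ • n) = κ • f n)
    (h : ∀ (f : N ≃ₗ[ℚ] N) (A : GL ι K), (∀ (κ : K) (n : N), f (κ • n) = κ • f n) →
      (∀ q, f (y q) = ∑ p, A.1 p q • y p) → (f ∈ R ↔ A ∈ P)) :
    ∃ ν : R ≃* P, ∀ (f : R) (q : ι), f.1 (y q) = ∑ p, (ν f).1.1 p q • y p := by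
  obtain ⟨Ω, hΩ⟩ := exists_mulEquiv_generalLinear hy
  let lin : R → (N ≃ₗ[K] N) := fun f => { f.1.toAddEquiv with map_smul' := hR f.1 f.2 }
  have hmem : ∀ f : R, Ω (lin f) ∈ P := fun f => (h f.1 _ (hR f.1 f.2) (hΩ (lin f))).1 f.2
  let F : R →* P :=
    { toFun := fun f => ⟨Ω (lin f), hmem f⟩
      map_one' := Subtype.ext ((congrArg Ω (by ext; rfl)).trans Ω.map_one)
      map_mul' := fun f f' =>
        Subtype.ext ((congrArg Ω (by ext; rfl)).trans (Ω.map_mul (lin f) (lin f'))) }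
  refine ⟨MulEquiv.ofBijective F ⟨fun f f' hff => ?_, fun A => ?_⟩, fun f q => hΩ (lin f) q⟩
  · have h1 : lin f = lin f' := Ω.injective (congrArg Subtype.val hff)
    apply Subtype.ext
    ext n
    exact LinearEquiv.congr_fun h1 n
  · have hφ : Ω (Ω.symm A.1) = A.1 := Ω.apply_symm_apply _
    -- No compatibility of the two scalar actions is needed: every additive map is ℚ-linear.
    let f : N ≃ₗ[ℚ] N :=
      { (Ω.symm A.1).toAddEquiv with
        map_smul' := fun c n => map_rat_smul (Ω.symm A.1).toAddEquiv c n }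
    have hf : f ∈ R := (h f A.1 (Ω.symm A.1).map_smul fun q => by
      have h1 := hΩ (Ω.symm A.1) q
      rw [hφ] at h1
      exact h1).2 A.2
    refine ⟨⟨f, hf⟩, Subtype.ext (Eq.trans (congrArg Ω ?_) hφ)⟩
    ext n
    rfl

end MatrixGroup

/-! ### N as a hermitian space over ℚ(ζ_m). -/

section CycModule

variable {m : ℕ} [NeZero m] {N : Type} [AddCommGroup N] [Module ℚ N]
  {ρ' : Representation ℚ (CycQ m) N}

/-- An element of the kernel of `cycAlg` is a rational relation between powers of ζ_m⁻¹, which ζ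
also satisfies on N. Hence the action of ℚ[Q] factors through ℚ(ζ_m). -/
theorem asAlgebraHom_eq_zero_of_cycAlg (hρ : aeval (ρ' (CycQ.zeta m)) (cyclotomic m ℚ) = 0)
    (a : MonoidAlgebra ℚ (CycQ m)) (ha : cycAlg m a = 0) : ρ'.asAlgebraHom a = 0 := by
  ext n
  have h := sum_smul_pow_eq_zero_of_rootChar m (ρ' (CycQ.zeta m)) (v := n) (by rw [hρ]; rfl)
    (fun q : CycQ m => a.coeff q) (fun q => q.toAdd) (by
      rw [← MonoidAlgebra.sum_single_coeff a, map_sum] at ha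
      simpa only [cycAlg_single] using ha)
  simp only [← map_pow, CycQ.zeta_pow, ofAdd_toAdd] at h
  rw [← MonoidAlgebra.sum_single_coeff a, map_sum, LinearMap.sum_apply, LinearMap.zero_apply, ← h]
  refine Finset.sum_congr rfl fun q _ => ?_
  rw [Representation.asAlgebraHom_single, LinearMap.smul_apply, Algebra.algebraMap_self,
    RingHom.id_apply]

/-- The action of `ℚ(ζ_m)` on a representation of `⟨ζ⟩` in which `ζ` has order `m`. -/
noncomputable def cycAction (hρ : aeval (ρ' (CycQ.zeta m)) (cyclotomic m ℚ) = 0) :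
    CyclotomicField m ℚ →ₐ[ℚ] Module.End ℚ N :=
  AlgHom.liftOfSection (cycAlg m) (cycSection m) (cycAlg_cycSection m) ρ'.asAlgebraHom
    (asAlgebraHom_eq_zero_of_cycAlg hρ)

variable (hρ : aeval (ρ' (CycQ.zeta m)) (cyclotomic m ℚ) = 0)

theorem cycAction_cycAlg (a : MonoidAlgebra ℚ (CycQ m)) :
    cycAction hρ (cycAlg m a) = ρ'.asAlgebraHom a :=
  AlgHom.liftOfSection_apply _ _ _ _ _ a

theorem cycAction_rootChar (j : ZMod m) :
    cycAction hρ (rootChar m j) = ρ' (Multiplicative.ofAdd (-j)) := by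
  have h := cycAction_cycAlg hρ (MonoidAlgebra.single (Multiplicative.ofAdd (-j)) 1)
  rw [cycAlg_single, Representation.asAlgebraHom_single_one] at h
  simpa using h

theorem map_cycAction {f : N →ₗ[ℚ] N} (hf : ∀ g x, f (ρ' g x) = ρ' g (f x))
    (κ : CyclotomicField m ℚ) (n : N) : f (cycAction hρ κ n) = cycAction hρ κ (f n) := by
  rw [← cycAlg_cycSection m κ, cycAction_cycAlg, map_asAlgebraHom_of_equivariant hf]

variable {B' : LinearMap.BilinForm ℚ N}

theorem cycAlg_reidemeister_left (hB : ∀ g x y, B' (ρ' g x) (ρ' g y) = B' x y)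
    (κ : CyclotomicField m ℚ) (x y : N) :
    cycAlg m (reidemeister ρ' B' (cycAction hρ κ x) y) =
      κ * cycAlg m (reidemeister ρ' B' x y) := by
  rw [← cycAlg_cycSection m κ, cycAction_cycAlg, reidemeister_smul_left hB, map_mul]

theorem cycAlg_reidemeister_right (κ : CyclotomicField m ℚ) (x y : N) :
    cycAlg m (reidemeister ρ' B' x (cycAction hρ κ y)) =
      cycAlg m (reidemeister ρ' B' x y) * cycConj m κ := by
  rw [← cycAlg_cycSection m κ, cycAction_cycAlg, reidemeister_smul_right, map_mul, cycAlg_inv]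

theorem cycAlg_reidemeister_sum {ι : Type} [Fintype ι]
    (hB : ∀ g x y, B' (ρ' g x) (ρ' g y) = B' x y) (y : ι → N) (c d : ι → CyclotomicField m ℚ) :
    cycAlg m (reidemeister ρ' B' (∑ p, cycAction hρ (c p) (y p))
      (∑ p, cycAction hρ (d p) (y p))) =
    ∑ p, ∑ q, c p * cycAlg m (reidemeister ρ' B' (y p) (y q)) * cycConj m (d q) := by
  simp only [← reidBilin_apply, map_sum, LinearMap.sum_apply]
  rw [Finset.sum_comm]
  refine Finset.sum_congr rfl fun p _ => Finset.sum_congr rfl fun q _ => ?_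
  rw [reidBilin_apply, reidBilin_apply, cycAlg_reidemeister_left hρ hB, cycAlg_reidemeister_right,
    mul_assoc]

/-- The matrices, in a basis over `ℚ(ζ_m)`, of the automorphisms that preserve the Reidemeister
pairing form the unitary group of the Gram matrix. -/
theorem exists_mulEquiv_matrixUnitary {ι : Type} [Fintype ι] [DecidableEq ι]
    (hB : ∀ g x y, B' (ρ' g x) (ρ' g y) = B' x y) {y : ι → N}
    (hy : Function.Bijective fun κ : ι → CyclotomicField m ℚ => ∑ p, cycAction hρ (κ p) (y p)) :
    ∃ ν : reidAut ρ' B' ≃* matrixUnitary m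
        (Matrix.of fun p q => cycAlg m (reidemeister ρ' B' (y p) (y q))),
      ∀ (f : reidAut ρ' B') (q : ι), f.1 (y q) = ∑ p, cycAction hρ ((ν f).1.1 p q) (y p) := by
  let _ : Module (CyclotomicField m ℚ) N := Module.compHom N (cycAction hρ).toRingHom
  refine exists_mulEquiv_of_mem_iff (K := CyclotomicField m ℚ) (y := y) hy _ _
    (fun f hf κ n => map_cycAction hρ (f := f.toLinearMap) hf.1 κ n) fun f A hf hA => ?_
  change ∀ κ n, f (cycAction hρ κ n) = cycAction hρ κ (f n) at hf
  change ∀ q, f (y q) = ∑ p, cycAction hρ (A.1 p q) (y p) at hA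
  -- By sesquilinearity the Gram matrix of the image vectors is Aᵗ B Ā, where B is the Gram matrix
  -- of y.
  have hgram : ∀ q q', cycAlg m (reidemeister ρ' B' (f (y q)) (f (y q'))) =
      (A.1.transpose * (Matrix.of fun p q => cycAlg m (reidemeister ρ' B' (y p) (y q))) *
        A.1.map (cycConj m)) q q' := fun q q' => by
    rw [hA, hA, cycAlg_reidemeister_sum hρ hB, Finset.sum_comm]
    simp only [Matrix.mul_apply, Matrix.transpose_apply, Matrix.of_apply, Matrix.map_apply,
      Finset.sum_mul]
  constructor
  · intro h
    change _ * _ * _ = _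
    ext q q'
    rw [← hgram, h.2, Matrix.of_apply]
  · intro h
    change _ * _ * _ = _ at h
    rw [h] at hgram
    refine ⟨fun q n => ?_, fun x x' => ?_⟩
    -- Linearity over ℚ(ζ_m) contains equivariance, since ζ_m^(-q) acts as q.
    · have h1 := hf (rootChar m (-q.toAdd)) n
      rw [cycAction_rootChar, neg_neg, ofAdd_toAdd] at h1
      exact h1
    -- Both pairings lie in the simple factor, where `cycAlg` is injective, so they can be compared
    -- in ℚ(ζ_m) and expanded in the basis.
    · have hz := reidemeister_mem_topFactor (m := m) hB hρ
      apply (cycAlg_bijOn m).injOn (hz _ _) (hz _ _)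
      obtain ⟨c, rfl⟩ := hy.2 x
      obtain ⟨d, rfl⟩ := hy.2 x'
      simp only [map_sum, hf]
      rw [cycAlg_reidemeister_sum hρ hB, cycAlg_reidemeister_sum hρ hB]
      simp only [hgram, Matrix.of_apply]

end CycModule

/-! ### Passage between modules over the matrix algebra and vector spaces over ℚ(ζ_m). -/

namespace IsTauDescent

variable {m : ℕ} [NeZero m] {V N : Type} [AddCommGroup V] [Module ℚ V]
  [AddCommGroup N] [Module ℚ N] {ρ : Representation ℚ (Heis m) V}
  {ρ' : Representation ℚ (CycQ m) N} {t : N →ₗ[ℚ] V}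

/-- For a group element this is `rho_sigma_apply`: ρ(h) sends e_j to ζ_m^(a(j+b)-c) e_(j+b), and
ζ_m^x acts on N as ζ^(-x). Hence V ≅ N^m as a module over the matrix algebra, with matrices acting
on columns. -/
theorem asAlgebraHom_sigma_apply (H : IsTauDescent ρ ρ' t) (a : MonoidAlgebra ℚ (Heis m))
    (j : ZMod m) (n : N) :
    ρ.asAlgebraHom a (ρ ⟨0, j, 0⟩ (t n)) =
      ∑ i, ρ ⟨0, i, 0⟩ (t (cycAction H.cyclotomic_zeta' (heisAlg m a i j) n)) := by
  rw [← MonoidAlgebra.sum_single_coeff a]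
  simp only [map_sum, LinearMap.sum_apply, Matrix.sum_apply]
  rw [Finset.sum_comm]
  refine Finset.sum_congr rfl fun h _ => ?_
  rw [Representation.asAlgebraHom_single, LinearMap.smul_apply, H.rho_sigma_apply,
    Finset.sum_eq_single (j + h.b)]
  · have h1 : cycAction H.cyclotomic_zeta' (a.coeff h : CyclotomicField m ℚ) =
        algebraMap ℚ _ (a.coeff h) := by
      rw [← eq_ratCast (algebraMap ℚ (CyclotomicField m ℚ)), AlgHom.commutes]
    rw [heisAlg_single, if_pos rfl, map_mul, cycAction_rootChar, neg_sub, Module.End.mul_apply, h1,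
      Module.algebraMap_end_apply, map_smul, map_smul]
  · intro i _ hi
    rw [heisAlg_single, if_neg hi]
    simp
  · simp

theorem asAlgebraHom_eq_zero_of_heisAlg (H : IsTauDescent ρ ρ' t) (a : MonoidAlgebra ℚ (Heis m))
    (ha : heisAlg m a = 0) : ρ.asAlgebraHom a = 0 := by
  ext v
  obtain ⟨f, rfl⟩ := H.exists_eq_sum v
  simp [map_sum, H.asAlgebraHom_sigma_apply, ha]

/-- The action of the matrix algebra over `ℚ(ζ_m)`. -/
noncomputable def matAction (H : IsTauDescent ρ ρ' t) :
    Matrix (ZMod m) (ZMod m) (CyclotomicField m ℚ) →ₐ[ℚ] Module.End ℚ V :=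
  AlgHom.liftOfSection (heisAlg m) (heisSection m) (heisAlg_heisSection m) ρ.asAlgebraHom
    H.asAlgebraHom_eq_zero_of_heisAlg

theorem matAction_heisAlg (H : IsTauDescent ρ ρ' t) (a : MonoidAlgebra ℚ (Heis m)) :
    H.matAction (heisAlg m a) = ρ.asAlgebraHom a :=
  AlgHom.liftOfSection_apply _ _ _ _ _ a

theorem matAction_sigma_apply (H : IsTauDescent ρ ρ' t)
    (s : Matrix (ZMod m) (ZMod m) (CyclotomicField m ℚ)) (j : ZMod m) (n : N) :
    H.matAction s (ρ ⟨0, j, 0⟩ (t n)) =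
      ∑ i, ρ ⟨0, i, 0⟩ (t (cycAction H.cyclotomic_zeta' (s i j) n)) := by
  rw [← heisAlg_heisSection m s, matAction_heisAlg, H.asAlgebraHom_sigma_apply]

theorem matAction_single_apply (H : IsTauDescent ρ ρ' t) (κ : CyclotomicField m ℚ) (n : N) :
    H.matAction (Matrix.single 0 0 κ) (t n) = t (cycAction H.cyclotomic_zeta' κ n) := by
  have h := H.matAction_sigma_apply (Matrix.single 0 0 κ) 0 n
  rw [sigma_zero_apply, Finset.sum_eq_single 0] at h
  · simpa [sigma_zero_apply] using h
  · intro i _ hi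
    simp [Matrix.single_apply_of_row_ne hi.symm]
  · simp

/-- The image of the matrix unit `E_{0i}` lies in the `τ`-invariants. -/
theorem exists_matAction_single (H : IsTauDescent ρ ρ' t) (i : ZMod m) (v : V) :
    ∃ n, t n = H.matAction (Matrix.single 0 i 1) v := by
  obtain ⟨f, rfl⟩ := H.exists_eq_sum v
  refine ⟨f i, ?_⟩
  rw [map_sum, Finset.sum_eq_single i]
  · rw [matAction_sigma_apply, Finset.sum_eq_single 0]
    · simp [sigma_zero_apply]
    · intro j _ hj
      simp [Matrix.single_apply_of_row_ne hj.symm]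
    · simp
  · intro j _ hj
    rw [matAction_sigma_apply]
    simp [Matrix.single_apply_of_col_ne _ _ hj.symm]
  · simp

section Basis

variable {ι : Type}

theorem transfer_cycAction (H : IsTauDescent ρ ρ' t) {x : ι → V} {y : ι × ZMod m → N}
    (hxy : ∀ a i, t (y (a, i)) = H.matAction (Matrix.single 0 i 1) (x a))
    (κ : CyclotomicField m ℚ) (a : ι) (i : ZMod m) :
    t (cycAction H.cyclotomic_zeta' κ (y (a, i))) = H.matAction (Matrix.single 0 i κ) (x a) := by
  rw [← matAction_single_apply, hxy, ← Module.End.mul_apply, ← map_mul,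
    Matrix.single_mul_single_same, mul_one]

variable [Fintype ι]

theorem transfer_sum_cycAction (H : IsTauDescent ρ ρ' t) {x : ι → V} {y : ι × ZMod m → N}
    (hxy : ∀ a i, t (y (a, i)) = H.matAction (Matrix.single 0 i 1) (x a))
    (κ : ι × ZMod m → CyclotomicField m ℚ) :
    t (∑ p, cycAction H.cyclotomic_zeta' (κ p) (y p)) =
      ∑ a, H.matAction (∑ i, Matrix.single 0 i (κ (a, i))) (x a) := by
  rw [map_sum, Fintype.sum_prod_type]
  simp only [map_sum, LinearMap.sum_apply, H.transfer_cycAction hxy]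

theorem single_zero_mul (s : Matrix (ZMod m) (ZMod m) (CyclotomicField m ℚ)) (j : ZMod m) :
    Matrix.single 0 j 1 * s = ∑ i, Matrix.single 0 i (s j i) := by
  ext a b
  rw [Matrix.sum_apply]
  by_cases h : a = 0
  · subst h
    rw [Matrix.single_mul_apply_same, one_mul, Finset.sum_eq_single b]
    · simp
    · intro c _ hc
      simp [Matrix.single_apply_of_col_ne _ _ hc]
    · simp
  · rw [Matrix.single_mul_apply_of_ne _ _ _ _ _ h]
    exact (Finset.sum_eq_zero fun c _ => Matrix.single_apply_of_row_ne (Ne.symm h) _ _ _).symm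

/-- A basis of `V` over the matrix algebra gives a basis of `N` over `ℚ(ζ_m)`. -/
theorem bijective_sum_cycAction (H : IsTauDescent ρ ρ' t) {x : ι → V} {y : ι × ZMod m → N}
    (hxy : ∀ a i, t (y (a, i)) = H.matAction (Matrix.single 0 i 1) (x a))
    (hx : Function.Bijective fun s : ι → Matrix (ZMod m) (ZMod m) (CyclotomicField m ℚ) =>
      ∑ a, H.matAction (s a) (x a)) :
    Function.Bijective fun κ : ι × ZMod m → CyclotomicField m ℚ =>
      ∑ p, cycAction H.cyclotomic_zeta' (κ p) (y p) := by
  constructor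
  · intro κ κ' h
    have h1 := congrArg t h
    simp only [H.transfer_sum_cycAction hxy] at h1
    have h2 := hx.1 h1
    ext ⟨a, i⟩
    have h3 := congrFun (congrFun (congrFun h2 a) 0) i
    simp only [Matrix.sum_apply] at h3
    rw [Finset.sum_eq_single i, Finset.sum_eq_single i] at h3
    · simpa using h3
    all_goals first
      | (intro c _ hc; exact Matrix.single_apply_of_col_ne _ _ hc _)
      | simp
  · intro n
    obtain ⟨s, hs⟩ := hx.2 (t n)
    -- E_{00} fixes t n, so applying it to t n = ∑ s_a x_a keeps only the rows 0 of the s_a.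
    refine ⟨fun p => s p.1 0 p.2, H.injective ?_⟩
    simp only [H.transfer_sum_cycAction hxy]
    simp only [← single_zero_mul, map_mul, Module.End.mul_apply]
    rw [← map_sum]
    have hs' : ∑ a, H.matAction (s a) (x a) = t n := hs
    rw [hs', matAction_single_apply, map_one, Module.End.one_apply]

/-- A basis of `N` over `ℚ(ζ_m)` gives a basis of `V` over the matrix algebra. -/
theorem bijective_sum_matAction (H : IsTauDescent ρ ρ' t) {y : ι × ZMod m → N}
    (hy : Function.Bijective fun κ : ι × ZMod m → CyclotomicField m ℚ =>
      ∑ p, cycAction H.cyclotomic_zeta' (κ p) (y p)) :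
    Function.Bijective fun s : ι → Matrix (ZMod m) (ZMod m) (CyclotomicField m ℚ) =>
      ∑ a, H.matAction (s a) (∑ i, ρ ⟨0, i, 0⟩ (t (y (a, i)))) := by
  -- For x_a = ∑_i σ^i t(y_(a,i)), the rows j of all s_a together are the coordinates, in the basis
  -- y, of the component of ∑ s_a x_a in σ^j t(N).
  let e : (ι → Matrix (ZMod m) (ZMod m) (CyclotomicField m ℚ)) ≃
      (ZMod m → ι × ZMod m → CyclotomicField m ℚ) :=
    { toFun := fun s j p => s p.1 j p.2
      invFun := fun f a => Matrix.of fun j i => f j (a, i)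
      left_inv := fun _ => rfl
      right_inv := fun _ => rfl }
  have h : (fun s : ι → Matrix (ZMod m) (ZMod m) (CyclotomicField m ℚ) =>
      ∑ a, H.matAction (s a) (∑ i, ρ ⟨0, i, 0⟩ (t (y (a, i))))) =
      H.decomp ∘ (fun f j => ∑ p, cycAction H.cyclotomic_zeta' (f j p) (y p)) ∘ e := by
    ext s
    simp only [Function.comp_apply, H.decomp_apply, map_sum, H.matAction_sigma_apply,
      Fintype.sum_prod_type]
    rw [Finset.sum_congr rfl fun a _ => Finset.sum_comm, Finset.sum_comm]
    rfl
  rw [h]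
  exact H.decomp.bijective.comp ((Function.Bijective.piMap fun _ => hy).comp e.bijective)

/-- The matrix of an automorphism of `V` and of its restriction to the `τ`-invariants. -/
theorem matrix_restrict (H : IsTauDescent ρ ρ' t) {x : ι → V} {y : ι × ZMod m → N}
    (hxy : ∀ a i, t (y (a, i)) = H.matAction (Matrix.single 0 i 1) (x a))
    (hy : Function.Bijective fun κ : ι × ZMod m → CyclotomicField m ℚ =>
      ∑ p, cycAction H.cyclotomic_zeta' (κ p) (y p))
    {f : V →ₗ[ℚ] V} (hf : ∀ h v, f (ρ h v) = ρ h (f v)) {f' : N → N}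
    (hff : ∀ n, t (f' n) = f (t n))
    {A : Matrix (ι × ZMod m) (ι × ZMod m) (CyclotomicField m ℚ)}
    (hA : ∀ q, f' (y q) = ∑ p, cycAction H.cyclotomic_zeta' (A p q) (y p))
    {γ : ι → ι → Matrix (ZMod m) (ZMod m) (CyclotomicField m ℚ)}
    (hγ : ∀ b, f (x b) = ∑ a, H.matAction (γ a b) (x a)) (p q : ι × ZMod m) :
    A p q = γ p.1 q.1 q.2 p.2 := by
  have hfm : ∀ s v, f (H.matAction s v) = H.matAction s (f v) := fun s v => by
    rw [← heisAlg_heisSection m s, matAction_heisAlg, map_asAlgebraHom_of_equivariant hf]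
  -- With q = (b, j): f(E_{0j}x_b) = ∑_a E_{0j}γ_{ab}x_a = ∑_{a,i} (γ_{ab})_{ji} E_{0i}x_a. This is
  -- the origin of the transposed inner indices.
  have h1 : (fun p => A p q) = fun p : ι × ZMod m => γ p.1 q.1 q.2 p.2 := by
    refine hy.1 (H.injective ?_)
    change t (∑ p, cycAction H.cyclotomic_zeta' (A p q) (y p)) =
      t (∑ p : ι × ZMod m, cycAction H.cyclotomic_zeta' (γ p.1 q.1 q.2 p.2) (y p))
    rw [← hA, H.transfer_sum_cycAction hxy, hff, hxy, hfm, hγ, map_sum]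
    simp only [← single_zero_mul, map_mul, Module.End.mul_apply]
  exact congrFun h1 p

end Basis

/-! ### Comparison of the Gram matrices. -/

section Gram

variable {B : LinearMap.BilinForm ℚ V} {B' : LinearMap.BilinForm ℚ N}

/-- Only h = τ^aζ^c contributes to the entry (0, 0), and its contribution does not depend on a: this
gives one factor m. The other one comes from `hBt`. -/
theorem heisAlg_reidemeister (H : IsTauDescent ρ ρ' t)
    (hB : ∀ h x y, B (ρ h x) (ρ h y) = B x y) (hBt : ∀ x y, B (t x) (t y) = (m : ℚ) * B' x y)
    (n n' : N) : heisAlg m (reidemeister ρ B (t n) (t n')) 0 0 =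
      (m : CyclotomicField m ℚ) ^ 2 * cycAlg m (reidemeister ρ' B' n n') := by
  simp only [reidemeister, map_sum, Matrix.sum_apply, heisAlg_single, cycAlg_single]
  rw [Heis.sum_eq, Finset.sum_eq_single 0]
  · have h1 : ∀ a c, B (t n) (ρ ⟨a, 0, c⟩ (t n')) =
        (m : ℚ) * B' n (ρ' (Multiplicative.ofAdd c) n') := fun a c => by
      have h2 := hB ⟨a, 0, 0⟩ (t n) (ρ ⟨0, 0, c⟩ (t n'))
      rw [H.tau_pow_apply, ← Module.End.mul_apply (ρ ⟨a, 0, 0⟩), ← map_mul, H.zeta_pow_apply,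
        hBt] at h2
      rw [← h2]
      simp [Heis.mul_def]
    simp only [h1, add_zero, if_true, mul_zero, zero_sub, Finset.sum_const, Finset.card_univ,
      ZMod.card, nsmul_eq_mul, Rat.cast_mul, Rat.cast_natCast, mul_assoc, ← Finset.mul_sum]
    rw [pow_two, mul_assoc]
    congr 2
    exact Fintype.sum_equiv Multiplicative.ofAdd _ _ fun _ => rfl
  · intro b _ hb
    simp [hb.symm]
  · simp

/-- The (0, 0) entry of E_{0i} S E_{0j}* = E_{0i} S E_{j0} is S_{ij}. Sesquilinearity therefore
moves the entry (i, j) for the x_a to the entry (0, 0) for the vectors E_{0i}x_a, which lie in t(N).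
-/
theorem gram_eq (H : IsTauDescent ρ ρ' t)
    (hB : ∀ h x y, B (ρ h x) (ρ h y) = B x y) (hBt : ∀ x y, B (t x) (t y) = (m : ℚ) * B' x y)
    {ι : Type} {x : ι → V} {y : ι × ZMod m → N}
    (hxy : ∀ a i, t (y (a, i)) = H.matAction (Matrix.single 0 i 1) (x a)) (p q : ι × ZMod m) :
    heisAlg m (reidemeister ρ B (x p.1) (x q.1)) p.2 q.2 =
      (m : CyclotomicField m ℚ) ^ 2 * cycAlg m (reidemeister ρ' B' (y p) (y q)) := by
  rw [← H.heisAlg_reidemeister hB hBt, hxy p.1 p.2, hxy q.1 q.2]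
  obtain ⟨a, ha⟩ : ∃ a, heisAlg m a = Matrix.single 0 p.2 1 := ⟨_, heisAlg_heisSection m _⟩
  obtain ⟨b, hb⟩ : ∃ b, heisAlg m b = Matrix.single 0 q.2 1 := ⟨_, heisAlg_heisSection m _⟩
  rw [← ha, ← hb, matAction_heisAlg, matAction_heisAlg, reidemeister_smul_left hB,
    reidemeister_smul_right, map_mul, map_mul, heisAlg_inv, ha, hb, Matrix.transpose_single,
    Matrix.map_single, map_one]
  simp

end Gram

end IsTauDescent

/-! ### Coverings, transfer and the intersection form -/

namespace PolySurface

section Fibre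

variable {S : Type} [Fintype S] {M : PolySurface} {v : M.Dart → Equiv.Perm S}
  {hv : ∀ d, v (M.rev d) = (v d)⁻¹}

/-- `face` and `rev` shift the sheet by the same v d, so the shift cancels in `rot`: the covering is
unbranched at the vertices. -/
theorem branchedCover_rot_pow (j : ℕ) (d : M.Dart) (s : S) :
    ((M.branchedCover v hv).rot ^ j) (d, s) = ((M.rot ^ j) d, s) := by
  have h : ∀ (d : M.Dart) (s : S), (M.branchedCover v hv).rot (d, s) = (M.rot d, s) :=
    fun _ _ => Prod.ext rfl (Equiv.apply_symm_apply _ _)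
  induction j with
  | zero => rfl
  | succ j ih =>
    rw [pow_succ', pow_succ']
    exact (congrArg (M.branchedCover v hv).rot ih).trans (h _ _)

theorem branchedCover_deg (d : M.Dart) (s : S) : (M.branchedCover v hv).deg (d, s) = M.deg d := by
  refine Function.minimalPeriod_eq_minimalPeriod_iff.2 fun n => ?_
  unfold Function.IsPeriodicPt Function.IsFixedPt
  rw [← Equiv.Perm.coe_pow, ← Equiv.Perm.coe_pow, branchedCover_rot_pow]
  exact ⟨fun h => congrArg Prod.fst h, fun h => Prod.ext h rfl⟩

variable {k : Type} [CommRing k]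

theorem mem_cycles_branchedCover {c : M.Dart × S → k} :
    c ∈ (M.branchedCover v hv).cycles k ↔ (∀ d s, c (M.rev d, v d s) = - c (d, s)) ∧
      ∀ d s, ∑ j ∈ Finset.range (M.deg d), c ((M.rot ^ j) d, s) = 0 := by
  constructor
  · rintro ⟨h1, h2⟩
    refine ⟨fun d s => h1 (d, s), fun d s => ?_⟩
    have h := h2 (d, s)
    rw [branchedCover_deg] at h
    simpa only [branchedCover_rot_pow] using h
  · rintro ⟨h1, h2⟩
    refine ⟨fun p => h1 p.1 p.2, fun p => ?_⟩
    obtain ⟨d, s⟩ := p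
    rw [branchedCover_deg]
    simpa only [branchedCover_rot_pow] using h2 d s

theorem mem_boundaries_branchedCover {c : M.Dart × S → k} :
    c ∈ (M.branchedCover v hv).boundaries k ↔ ∃ u : M.Dart × S → k,
      (∀ d s, u (M.face d, v d s) = u (d, s)) ∧
      ∀ d s, c (d, s) = u (d, s) - u (M.rev d, v d s) :=
  ⟨fun ⟨u, h1, h2⟩ => ⟨u, fun d s => h1 (d, s), fun d s => h2 (d, s)⟩,
    fun ⟨u, h1, h2⟩ => ⟨u, fun p => h1 p.1 p.2, fun p => h2 p.1 p.2⟩⟩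

end Fibre

section Covering

variable {S S' : Type} [Fintype S] {M : PolySurface}
  {v : M.Dart → Equiv.Perm S} {v' : M.Dart → Equiv.Perm S'}
  {hv : ∀ d, v (M.rev d) = (v d)⁻¹} {hv' : ∀ d, v' (M.rev d) = (v' d)⁻¹}
  {T : S → S'} {k : Type} [CommRing k]

/-- The transfer multiplies the intersection form by the degree `n` of the covering. -/
theorem intersection_transfer [Fintype S'] (hT : ∀ d s, T (v d s) = v' d (T s)) [Algebra ℚ k]
    {n : k}
    (hn : ∀ F : S' → k, ∑ s, F (T s) = n * ∑ s, F s) (x y : (M.branchedCover v' hv').H1 k) :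
    (M.branchedCover v hv).intersection k
      ((coverOfFibre (hv := hv) (hv' := hv') T hT).transfer k x)
      ((coverOfFibre (hv := hv) (hv' := hv') T hT).transfer k y) =
    n * (M.branchedCover v' hv').intersection k x y := by
  refine Submodule.Quotient.induction_on _ x fun a =>
    Submodule.Quotient.induction_on _ y fun b => ?_
  change (M.branchedCover v hv).crossing k (fun p : M.Dart × S => a.1 (p.1, T p.2))
    (fun p : M.Dart × S => b.1 (p.1, T p.2)) = n * (M.branchedCover v' hv').crossing k a.1 b.1
  refine (crossing_eq k _ _ _).trans (Eq.trans ?_ (congrArg (n * ·) (crossing_eq k _ _ _).symm))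
  have h : ∀ (d : M.Dart) (s : S),
      (M.branchedCover v hv).crossFun k (fun p : M.Dart × S => b.1 (p.1, T p.2)) (d, s) =
        (M.branchedCover v' hv').crossFun k b.1 (d, T s) := fun d s => by
    simp only [crossFun, branchedCover_deg, branchedCover_rot_pow]
  have e1 : ∑ d : M.Dart × S, a.1 (d.1, T d.2) * (M.branchedCover v hv).crossFun k
      (fun p : M.Dart × S => b.1 (p.1, T p.2)) d =
      n * ∑ d : M.Dart × S', a.1 d * (M.branchedCover v' hv').crossFun k b.1 d := by
    rw [Fintype.sum_prod_type, Fintype.sum_prod_type, Finset.mul_sum]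
    refine Finset.sum_congr rfl fun d _ => ?_
    simp only [h]
    exact hn fun s => a.1 (d, s) * (M.branchedCover v' hv').crossFun k b.1 (d, s)
  exact e1

variable [DecidableEq S']

/-- The push-forward of chains along a covering: the sum over the fibres. -/
def pushChain (M : PolySurface) (T : S → S') (c : M.Dart × S → k) (p : M.Dart × S') : k :=
  ∑ s, if T s = p.2 then c (p.1, s) else 0

/-- Reindexing the fibre by v d; the map φ stands for `rev` and `face`, so that one lemma serves
both cycles and boundaries. -/
theorem pushChain_shear (hT : ∀ d s, T (v d s) = v' d (T s)) (φ : M.Dart → M.Dart)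
    (c : M.Dart × S → k) (d : M.Dart) (s : S') :
    pushChain M T c (φ d, v' d s) = pushChain M T (fun p => c (φ p.1, v p.1 p.2)) (d, s) := by
  refine (Fintype.sum_equiv (v d) _ _ fun s' => ?_).symm
  simp only [hT, EmbeddingLike.apply_eq_iff_eq]

theorem pushChain_mem_cycles [Fintype S'] (hT : ∀ d s, T (v d s) = v' d (T s)) {c : M.Dart × S → k}
    (hc : c ∈ (M.branchedCover v hv).cycles k) :
    pushChain M T c ∈ (M.branchedCover v' hv').cycles k := by
  rw [mem_cycles_branchedCover] at hc ⊢
  refine ⟨fun d s => ?_, fun d s => ?_⟩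
  · rw [pushChain_shear hT M.rev]
    simp only [pushChain, hc.1, ← Finset.sum_neg_distrib]
    exact Finset.sum_congr rfl fun s' _ => by split_ifs <;> simp
  · simp only [pushChain]
    rw [Finset.sum_comm]
    refine Finset.sum_eq_zero fun s' _ => ?_
    split_ifs
    · exact hc.2 d s'
    · simp

theorem pushChain_mem_boundaries [Fintype S'] (hT : ∀ d s, T (v d s) = v' d (T s))
    {c : M.Dart × S → k}
    (hc : c ∈ (M.branchedCover v hv).boundaries k) :
    pushChain M T c ∈ (M.branchedCover v' hv').boundaries k := by
  rw [mem_boundaries_branchedCover] at hc ⊢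
  obtain ⟨u, hu, hc⟩ := hc
  refine ⟨pushChain M T u, fun d s => ?_, fun d s => ?_⟩
  · rw [pushChain_shear hT M.face]
    simp only [pushChain, hu]
  · rw [pushChain_shear hT M.rev]
    simp only [pushChain, hc, ← Finset.sum_sub_distrib]
    exact Finset.sum_congr rfl fun s' _ => by split_ifs <;> simp

theorem pushChain_comp [Fintype S'] {n : k} (hn : ∀ F : S' → k, ∑ s, F (T s) = n * ∑ s, F s)
    (c : M.Dart × S' → k) : pushChain M T (fun p => c (p.1, T p.2)) = n • c := by
  ext ⟨d, s⟩
  simp only [pushChain, Pi.smul_apply, smul_eq_mul]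
  rw [hn fun s' => if s' = s then c (d, s') else 0]
  simp

/-- Push-forward after transfer is multiplication by n: if the transfer of a cycle bounds, so does n
times the cycle. -/
theorem transfer_injective [Fintype S'] (hT : ∀ d s, T (v d s) = v' d (T s)) {n : k} (hu : IsUnit n)
    (hn : ∀ F : S' → k, ∑ s, F (T s) = n * ∑ s, F s) :
    Function.Injective ((coverOfFibre (hv := hv) (hv' := hv') T hT).transfer k) := by
  rw [injective_iff_map_eq_zero]
  intro x
  refine Submodule.Quotient.induction_on _ x fun c hc => ?_
  have h1 : (fun p : M.Dart × S => c.1 (p.1, T p.2)) ∈ (M.branchedCover v hv).boundaries k :=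
    (Submodule.Quotient.mk_eq_zero
      (((M.branchedCover v hv).boundaries k).submoduleOf ((M.branchedCover v hv).cycles k))).1 hc
  have h2 : n • c.1 ∈ (M.branchedCover v' hv').boundaries k :=
    pushChain_comp (M := M) hn c.1 ▸ pushChain_mem_boundaries (hv := hv) (hv' := hv') hT h1
  obtain ⟨r, hr⟩ := hu.exists_left_inv
  have h3 := Submodule.smul_mem _ r h2
  rw [smul_smul, hr, one_smul] at h3
  exact (Submodule.Quotient.mk_eq_zero _).2 h3

/-- Classes that are invariant under a group of deck transformations that is transitive on the
fibres lie in the image of the transfer. -/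
theorem exists_transfer_eq [Fintype S'] (hT : ∀ d s, T (v d s) = v' d (T s)) {A : Type} [Fintype A]
    {n : k} (hu : IsUnit n)
    (act : A → Equiv.Perm S) (hact : ∀ a d s, act a (v d s) = v d (act a s))
    (hfib : ∀ (F : S → k) (s : S), ∑ a, F (act a s) = ∑ s', if T s' = T s then F s' else 0)
    (hA : (Fintype.card A : k) = n) (x : (M.branchedCover v hv).H1 k)
    (hx : ∀ a, (coverOfFibre (hv := hv) (hv' := hv) (act a) (hact a)).transfer k x = x) :
    ∃ y, (coverOfFibre (hv := hv) (hv' := hv') T hT).transfer k y = x := by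
  obtain ⟨r, hr⟩ := hu.exists_left_inv
  obtain ⟨c, rfl⟩ := Submodule.mkQ_surjective _ x
  let y : (M.branchedCover v' hv').H1 k :=
    Submodule.mkQ _ ⟨pushChain M T c.1, pushChain_mem_cycles (hv := hv) (hv' := hv') hT c.2⟩
  refine ⟨r • y, ?_⟩
  -- Transfer after push-forward is the sum over the deck transformations (by `hfib`), which is n on
  -- an invariant class; r is the inverse of n.
  have h1 : (coverOfFibre (hv := hv) (hv' := hv') T hT).transfer k y =
      ∑ a, (coverOfFibre (hv := hv) (hv' := hv) (act a) (hact a)).transfer k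
        (Submodule.mkQ _ c) := by
    let w : A → (M.branchedCover v hv).cycles k := fun a =>
      ⟨fun p : M.Dart × S => c.1 (p.1, act a p.2),
        (coverOfFibre (hv := hv) (hv' := hv) (act a) (hact a)).comp_mem_cycles k c.2⟩
    have h2 : ∀ a, (coverOfFibre (hv := hv) (hv' := hv) (act a) (hact a)).transfer k
        (Submodule.mkQ _ c) = Submodule.mkQ _ (w a) := fun _ => rfl
    simp only [h2]
    rw [← map_sum]
    refine congrArg (Submodule.mkQ _) (Subtype.ext (funext fun p => ?_))
    obtain ⟨d, s⟩ := p
    exact (hfib (fun s => c.1 (d, s)) s).symm.trans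
      (map_sum ((LinearMap.proj (R := k) (φ := fun _ => k) (d, s)).comp
        ((M.branchedCover v hv).cycles k).subtype) w Finset.univ).symm
  rw [map_smul, h1]
  simp only [hx, Finset.sum_const, Finset.card_univ]
  rw [← Nat.cast_smul_eq_nsmul k, hA, smul_smul, hr, one_smul]

end Covering

theorem mapCoeff_transfer {M' M : PolySurface} (p : Cover M' M) {k k' : Type} [CommRing k]
    [CommRing k'] (φ : k →+* k') (x : M.H1 k) :
    M'.mapCoeff φ (p.transfer k x) = p.transfer k' (M.mapCoeff φ x) :=
  Submodule.Quotient.induction_on _ x fun _ => rfl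

end PolySurface

theorem aeval_orderRep {k G V : Type} [CommRing k] [Group G] [AddCommGroup V] [Module k V]
    (ρ : Representation k G V) (z : G) (m : ℕ) (hz : ∀ g, g * z = z * g) :
    aeval (orderRep ρ z m hz z) (cyclotomic m k) = 0 := by
  ext x
  have h := map_aeval_apply (t := (orderPart ρ z m).subtype) (A := orderRep ρ z m hz z)
    (A' := ρ z) (fun _ => rfl) (cyclotomic m k) x
  exact h.trans x.2

/-! ### The descent from W to Z. -/

section Surfaces

open PolySurface

variable (g m : ℕ) [NeZero m]

theorem sum_fibre_WZ {k : Type} [CommRing k] (F : ZMod m × ZMod m → k) :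
    ∑ h : Heis m, F (h.b, h.c) = (m : k) * ∑ s, F s := by
  rw [Heis.sum_eq, Fintype.sum_prod_type, Finset.mul_sum]
  simp

variable (k : Type) [CommRing k]

theorem transfer_repZ_zeta (x : (surfaceZ g m).H1 k) :
    (coverWZ g m).transfer k (repZ g m k (CycQ.zeta m) x) =
      repW g m k (Heis.zeta m) ((coverWZ g m).transfer k x) := by
  refine Submodule.Quotient.induction_on _ x fun c => ?_
  refine congrArg (Submodule.Quotient.mk) (Subtype.ext (funext fun p => ?_))
  obtain ⟨d, s⟩ := p
  refine congrArg (fun s => c.1 (d, s)) ?_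
  have h : (Heis.zeta m)⁻¹ = ⟨0, 0, -1⟩ := by
    change Heis.mk (-0) (-0) (-1 + 0 * 0) = _
    simp
  change (s.b, (CycQ.zeta m)⁻¹.toAdd + s.c) = (((Heis.zeta m)⁻¹ * s).b, ((Heis.zeta m)⁻¹ * s).c)
  rw [h]
  simp [Heis.mul_def, CycQ.zeta]

theorem repW_tau_transfer (x : (surfaceZ g m).H1 k) :
    repW g m k (Heis.tau m) ((coverWZ g m).transfer k x) = (coverWZ g m).transfer k x := by
  refine Submodule.Quotient.induction_on _ x fun c => ?_
  refine congrArg (Submodule.Quotient.mk) (Subtype.ext (funext fun p => ?_))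
  obtain ⟨d, s⟩ := p
  refine congrArg (fun s => c.1 (d, s)) ?_
  have h : (Heis.tau m)⁻¹ = ⟨-1, 0, 0⟩ := by
    change Heis.mk (-1) (-0) (-0 + 0 * 1) = _
    simp
  change (((Heis.tau m)⁻¹ * s).b, ((Heis.tau m)⁻¹ * s).c) = (s.b, s.c)
  rw [h]
  simp [Heis.mul_def]

variable [Algebra ℚ k]

theorem transferWZ_injective : Function.Injective ((coverWZ g m).transfer k) :=
  transfer_injective _ (isUnit_natCast_of_ratAlgebra m k) (sum_fibre_WZ m)

theorem exists_transferWZ_eq (x : (surfaceW g m).H1 k) (hx : repW g m k (Heis.tau m) x = x) :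
    ∃ y, (coverWZ g m).transfer k y = x := by
  have hx' : ∀ a : ZMod m, repW g m k ⟨a, 0, 0⟩ x = x := fun a => by
    rw [← Heis.tau_pow, map_pow]
    induction a.val with
    | zero => simp
    | succ j ih => rw [pow_succ', Module.End.mul_apply, ih, hx]
  refine exists_transfer_eq _ (isUnit_natCast_of_ratAlgebra m k)
    (fun a : ZMod m => MulAction.toPermHom (Heis m) (Heis m) (⟨a, 0, 0⟩⁻¹))
    (fun a => handle_comm (fun s => by simp [mul_assoc]) (fun s => by simp [mul_assoc]))
    (fun F s => ?_) (by rw [ZMod.card]) x hx'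
  refine Eq.symm ((Heis.sum_eq m fun s' => if (s'.b, s'.c) = (s.b, s.c) then F s' else 0).trans
    ((Finset.sum_eq_single s.b (fun b _ hb => by simp [hb]) (by simp)).trans (Eq.symm ?_)))
  refine Fintype.sum_equiv ((Equiv.neg _).trans (Equiv.addRight s.a)) _ _ fun a => ?_
  have h2 : (⟨a, 0, 0⟩ : Heis m)⁻¹ = ⟨-a, 0, 0⟩ := by
    change Heis.mk (-a) (-0) (-0 + 0 * a) = _
    simp
  rw [h2]
  simp [Heis.mul_def]

/-- The transfer commutes with ζ, hence with Φ_m(ζ); being injective with image the τ-invariants, it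
matches the kernels of Φ_m(ζ). -/
theorem transferWZ_bijOn : Set.BijOn ((coverWZ g m).transfer k) (topN g m k)
    {x | x ∈ topM g m k ∧ repW g m k (Heis.tau m) x = x} := by
  have h := map_aeval_apply (transfer_repZ_zeta g m k) (cyclotomic m k)
  refine ⟨fun x hx => ⟨?_, repW_tau_transfer g m k x⟩, (transferWZ_injective g m k).injOn,
    fun x hx => ?_⟩
  · change aeval (repW g m k (Heis.zeta m)) (cyclotomic m k) _ = 0
    rw [← h, LinearMap.mem_ker.1 hx, map_zero]
  · obtain ⟨y, rfl⟩ := exists_transferWZ_eq g m k x hx.2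
    refine ⟨y, ?_, rfl⟩
    apply transferWZ_injective g m k
    rw [h, map_zero]
    exact hx.1

/-- The transfer `N_m → M_m`. -/
noncomputable def topTransfer : topN g m k →ₗ[k] topM g m k :=
  ((coverWZ g m).transfer k).restrict fun _ hx => ((transferWZ_bijOn g m k).mapsTo hx).1

theorem coe_topTransfer (n : topN g m k) :
    (topTransfer g m k n : (surfaceW g m).H1 k) = (coverWZ g m).transfer k n := rfl

theorem isTauDescent_topTransfer :
    IsTauDescent (topMRep g m k) (topNRep g m k) (topTransfer g m k) where
  cyclotomic_zeta := aeval_orderRep _ _ _ _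
  injective x y hxy := Subtype.ext (transferWZ_injective g m k (congrArg Subtype.val hxy))
  tau_apply n := Subtype.ext (repW_tau_transfer g m k n)
  exists_of_tau v hv := by
    obtain ⟨n, hn, hnv⟩ := (transferWZ_bijOn g m k).surjOn ⟨v.2, congrArg Subtype.val hv⟩
    exact ⟨⟨n, hn⟩, Subtype.ext hnv⟩
  zeta_apply n := Subtype.ext (transfer_repZ_zeta g m k n)

/-- A deck transformation is a covering of degree 1, so this is a case of `intersection_transfer`.
-/
theorem topMForm_invariant (h : Heis m) (x y : topM g m k) :
    topMForm g m k (topMRep g m k h x) (topMRep g m k h y) = topMForm g m k x y := by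
  have h1 := intersection_transfer (M := standard g)
    (hv := handle_rev g (Equiv.mulRight (Heis.sigma m)) (Equiv.mulRight (Heis.tau m)))
    (hv' := handle_rev g (Equiv.mulRight (Heis.sigma m)) (Equiv.mulRight (Heis.tau m)))
    (T := MulAction.toPermHom (Heis m) (Heis m) h⁻¹)
    (handle_comm (fun s => by simp [mul_assoc]) (fun s => by simp [mul_assoc]))
    (n := (1 : k)) (fun F => by rw [one_mul]; exact Equiv.sum_comp _ F) x.1 y.1
  rw [one_mul] at h1
  exact h1

theorem topMForm_topTransfer (x y : topN g m k) :
    topMForm g m k (topTransfer g m k x) (topTransfer g m k y) = (m : k) * topNForm g m k x y :=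
  intersection_transfer _ (sum_fibre_WZ m) x.1 y.1

end Surfaces

/-! ### The dimension of `N_m` -/

/-- Applied to `rot` of the standard surface, which has one vertex: the cycle condition at any dart
becomes a sum over all darts. -/
theorem sum_range_minimalPeriod {α A : Type*} [Fintype α] [AddCommMonoid A] (f : Equiv.Perm α)
    (hf : ∀ x y, f.SameCycle x y) (F : α → A) (x : α) :
    ∑ j ∈ Finset.range (Function.minimalPeriod f x), F ((f ^ j) x) = ∑ y, F y := by
  classical
  have hpos : 0 < Function.minimalPeriod f x :=
    Function.minimalPeriod_pos_of_mem_periodicPts (f.injective.mem_periodicPts x)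
  refine Finset.sum_bij (fun j _ => (f ^ j) x) (fun _ _ => Finset.mem_univ _) ?_ ?_ fun _ _ => rfl
  · intro a ha b hb hab
    simp only [Finset.mem_range] at ha hb
    rw [Equiv.Perm.coe_pow, Equiv.Perm.coe_pow] at hab
    exact Function.iterate_injOn_Iio_minimalPeriod ha hb hab
  · intro y _
    obtain ⟨n, -, hn⟩ := (hf x y).exists_pow_eq'
    refine ⟨n % Function.minimalPeriod f x, Finset.mem_range.2 (Nat.mod_lt _ hpos), ?_⟩
    rw [Equiv.Perm.coe_pow, Function.iterate_mod_minimalPeriod_eq, ← Equiv.Perm.coe_pow, hn]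

namespace PolySurface

theorem finRotate_induction {g : ℕ} (P : Fin g → Prop) (h0 : ∀ i : Fin g, i.val = 0 → P i)
    (h : ∀ i, P i → P (finRotate g i)) (i : Fin g) : P i := by
  obtain ⟨n, hn⟩ := i
  induction n with
  | zero => exact h0 _ rfl
  | succ n ih =>
    have h1 := h _ (ih (by omega))
    obtain ⟨g', rfl⟩ : ∃ g', g = g' + 1 := ⟨g - 1, by omega⟩
    rwa [finRotate_of_lt (by omega)] at h1

/-- Inside a handle `rot` runs through the sides 1, 2, 3, 0; from side 0 it passes to side 1 of the
preceding handle. -/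
theorem standard_rot_sameCycle (g : ℕ) (d d' : (standard g).Dart) :
    (standard g).rot.SameCycle d d' := by
  have step : ∀ x y : (standard g).Dart, (standard g).rot x = y → (standard g).rot.SameCycle x y :=
    fun x y h => ⟨1, by rw [zpow_one, h]⟩
  have h12 : ∀ i : Fin g, (standard g).rot.SameCycle (i, (1 : Fin 4)) (i, (2 : Fin 4)) :=
    fun i => step _ _ rfl
  have h23 : ∀ i : Fin g, (standard g).rot.SameCycle (i, (2 : Fin 4)) (i, (3 : Fin 4)) :=
    fun i => step _ _ rfl
  have h30 : ∀ i : Fin g, (standard g).rot.SameCycle (i, (3 : Fin 4)) (i, (0 : Fin 4)) :=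
    fun i => step _ _ rfl
  have h01 : ∀ i : Fin g, (standard g).rot.SameCycle (finRotate g i, (0 : Fin 4))
      (i, (1 : Fin 4)) := fun i => by
    refine step _ _ ?_
    change ((finRotate g).symm (finRotate g i), (1 : Fin 4)) = (i, 1)
    rw [Equiv.symm_apply_apply]
  have hr : ∀ (i : Fin g) (r : Fin 4),
      (standard g).rot.SameCycle (i, r) (i, (1 : Fin 4)) := fun i r => by
    fin_cases r
    · exact ((h12 i).trans ((h23 i).trans (h30 i))).symm
    · exact Equiv.Perm.SameCycle.refl _ _
    · exact (h12 i).symm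
    · exact ((h12 i).trans (h23 i)).symm
  have hbase : ∀ i i0 : Fin g, i0.val = 0 →
      (standard g).rot.SameCycle (i, (1 : Fin 4)) (i0, (1 : Fin 4)) := fun i i0 hi0 => by
    refine finRotate_induction (fun i => (standard g).rot.SameCycle (i, (1 : Fin 4))
      (i0, (1 : Fin 4))) (fun j hj => ?_) (fun j hj => ?_) i
    · rw [Fin.ext (hj.trans hi0.symm)]
      exact Equiv.Perm.SameCycle.refl _ _
    · exact ((hr _ 0).symm.trans (h01 j)).trans hj
  obtain ⟨i, r⟩ := d
  obtain ⟨i', r'⟩ := d'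
  let i0 : Fin g := ⟨0, i.pos⟩
  exact ((hr i r).trans (hbase i i0 rfl)).trans ((hr i' r').trans (hbase i' i0 rfl)).symm

end PolySurface

/-! ### Explicit cycles and boundaries of Z. -/

section CyclesZ

open PolySurface

variable {g m : ℕ}

theorem handle_zero {S : Type} {a b : Equiv.Perm S} {i : Fin g} (hi : i.val = 0) (r : Fin 4) :
    handle g a b (i, r) = ![a, b, a⁻¹, b⁻¹] r := if_pos hi

theorem handle_ne_zero {S : Type} {a b : Equiv.Perm S} {i : Fin g} (hi : i.val ≠ 0) (r : Fin 4) :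
    handle g a b (i, r) = 1 := if_neg hi

theorem monodromyE_inv_apply (l j : ZMod m) : (monodromyE m)⁻¹ (l, j) = (l - 1, j) := by
  rw [Equiv.Perm.inv_eq_iff_eq]
  simp [monodromyE]

theorem monodromyF_inv_apply (l j : ZMod m) : (monodromyF m)⁻¹ (l, j) = (l, j - l) := by
  rw [Equiv.Perm.inv_eq_iff_eq]
  simp [monodromyF, Equiv.prodShear]

variable [NeZero m]

/-- The cycles of `Z` in terms of the coefficients of the lifts of the edges `e_i` and `f_i`. -/
theorem mem_cycles_surfaceZ {i0 : Fin g} (hi0 : i0.val = 0)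
    {c : (Fin g × Fin 4) × (ZMod m × ZMod m) → ℚ} :
    c ∈ (surfaceZ g m).cycles ℚ ↔
      (∀ (i : Fin g) s,
        c ((i, 2), s) = - c ((i, 0), (handle g (monodromyE m) (monodromyF m) (i, 0))⁻¹ s)) ∧
      (∀ (i : Fin g) s,
        c ((i, 3), s) = - c ((i, 1), (handle g (monodromyE m) (monodromyF m) (i, 1))⁻¹ s)) ∧
      ∀ l j, c ((i0, 0), (l, j)) - c ((i0, 0), (l - 1, j)) + c ((i0, 1), (l, j)) -
        c ((i0, 1), (l, j - l)) = 0 := by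
  set v := handle g (monodromyE m) (monodromyF m) with hv
  have hsum : ∀ (h0 : ∀ i s, c ((i, 2), s) = - c ((i, 0), (v (i, 0))⁻¹ s))
      (h1 : ∀ i s, c ((i, 3), s) = - c ((i, 1), (v (i, 1))⁻¹ s)) (l j : ZMod m),
      ∑ d : Fin g × Fin 4, c (d, (l, j)) = c ((i0, 0), (l, j)) - c ((i0, 0), (l - 1, j)) +
        c ((i0, 1), (l, j)) - c ((i0, 1), (l, j - l)) := fun h0 h1 l j => by
    rw [Fintype.sum_prod_type, Finset.sum_eq_single i0]
    · rw [Fin.sum_univ_four, h0, h1, hv, handle_zero hi0, handle_zero hi0]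
      change c ((i0, 0), (l, j)) + c ((i0, 1), (l, j)) +
        -c ((i0, 0), (monodromyE m)⁻¹ (l, j)) + -c ((i0, 1), (monodromyF m)⁻¹ (l, j)) = _
      rw [monodromyE_inv_apply, monodromyF_inv_apply]
      ring
    -- In a handle with trivial monodromy the terms of e and e⁻¹ cancel at the same vertex, and so
    -- do those of f and f⁻¹.
    · intro i _ hi
      have hi' : i.val ≠ 0 := fun h => hi (Fin.ext (h.trans hi0.symm))
      rw [Fin.sum_univ_four, h0, h1, hv, handle_ne_zero hi', handle_ne_zero hi']
      simp
    · simp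
  have hrev : (∀ (d : Fin g × Fin 4) s, c ((standard g).rev d, v d s) = - c (d, s)) ↔
      (∀ i s, c ((i, 2), s) = - c ((i, 0), (v (i, 0))⁻¹ s)) ∧
      (∀ i s, c ((i, 3), s) = - c ((i, 1), (v (i, 1))⁻¹ s)) := by
    have hvrev := handle_rev g (monodromyE m) (monodromyF m)
    constructor
    · intro h
      refine ⟨fun i s => ?_, fun i s => ?_⟩
      · exact (congrArg (fun s => c ((i, 2), s)) ((v (i, 0)).apply_symm_apply s).symm).trans
          (h (i, 0) ((v (i, 0))⁻¹ s))
      · exact (congrArg (fun s => c ((i, 3), s)) ((v (i, 1)).apply_symm_apply s).symm).trans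
          (h (i, 1) ((v (i, 1))⁻¹ s))
    · rintro ⟨h0, h1⟩ ⟨i, r⟩ s
      fin_cases r
      · exact (h0 i (v (i, 0) s)).trans
          (congrArg (fun s => -c ((i, 0), s)) ((v (i, 0)).symm_apply_apply s))
      · exact (h1 i (v (i, 1) s)).trans
          (congrArg (fun s => -c ((i, 1), s)) ((v (i, 1)).symm_apply_apply s))
      · have e : v (i, 2) = (v (i, 0))⁻¹ := hvrev (i, (0 : Fin 4))
        change c ((i, 0), v (i, 2) s) = - c ((i, 2), s)
        rw [e, h0, neg_neg]
      · have e : v (i, 3) = (v (i, 1))⁻¹ := hvrev (i, (1 : Fin 4))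
        change c ((i, 1), v (i, 3) s) = - c ((i, 3), s)
        rw [e, h1, neg_neg]
  have hdeg : ∀ (d : Fin g × Fin 4) (s : ZMod m × ZMod m),
      ∑ j ∈ Finset.range ((standard g).deg d), c (((standard g).rot ^ j) d, s) =
        ∑ d : Fin g × Fin 4, c (d, s) := fun d s =>
    sum_range_minimalPeriod _ (standard_rot_sameCycle g) (fun d => c (d, s)) d
  refine (mem_cycles_branchedCover (M := standard g)).trans ?_
  rw [← and_assoc]
  refine (and_congr_left' hrev).trans (and_congr_right fun h => ?_)
  constructor
  · intro h2 l j
    rw [← hsum h.1 h.2]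
    exact (hdeg (i0, 0) (l, j)).symm.trans (h2 (i0, (0 : Fin 4)) (l, j))
  · rintro h2 d ⟨l, j⟩
    exact (hdeg d (l, j)).trans ((hsum h.1 h.2 l j).trans (h2 l j))

/-- Boundaries of `Z` are invariant under `ζ`. -/
theorem boundaries_surfaceZ_invariant (hg : 2 ≤ g) {c : (Fin g × Fin 4) × (ZMod m × ZMod m) → ℚ}
    (hc : c ∈ (surfaceZ g m).boundaries ℚ) (d : Fin g × Fin 4) (l j : ZMod m) :
    c (d, (l, j + 1)) = c (d, (l, j)) := by
  let v : Fin g × Fin 4 → Equiv.Perm (ZMod m × ZMod m) := handle g (monodromyE m) (monodromyF m)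
  obtain ⟨u, hu, hc⟩ : ∃ u : (Fin g × Fin 4) × (ZMod m × ZMod m) → ℚ,
      (∀ (d : Fin g × Fin 4) s, u ((standard g).face d, v d s) = u (d, s)) ∧
      ∀ (d : Fin g × Fin 4) s, c (d, s) = u (d, s) - u ((standard g).rev d, v d s) :=
    (mem_boundaries_branchedCover (M := standard g)).1 hc
  let ζ : Equiv.Perm (ZMod m × ZMod m) := Equiv.prodCongr (Equiv.refl _) (Equiv.addRight 1)
  have hv : ∀ d s, ζ (v d s) = v d (ζ s) := fun d s =>
    handle_comm (a := monodromyE m) (b := monodromyF m) (a' := monodromyE m) (b' := monodromyF m)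
      (T := ζ) (fun s => rfl)
      (fun s => by simp [ζ, monodromyF, Equiv.prodShear, add_right_comm]) d s
  have s0 : ∀ (i : Fin g) s, u ((i, (1 : Fin 4)), v (i, 0) s) = u ((i, (0 : Fin 4)), s) :=
    fun i s => hu (i, (0 : Fin 4)) s
  have s1 : ∀ (i : Fin g) s, u ((i, (2 : Fin 4)), v (i, 1) s) = u ((i, (1 : Fin 4)), s) :=
    fun i s => hu (i, (1 : Fin 4)) s
  have s2 : ∀ (i : Fin g) s, u ((i, (3 : Fin 4)), v (i, 2) s) = u ((i, (2 : Fin 4)), s) :=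
    fun i s => hu (i, (2 : Fin 4)) s
  have s3 : ∀ (i : Fin g) s,
      u ((finRotate g i, (0 : Fin 4)), v (i, 3) s) = u ((i, (3 : Fin 4)), s) :=
    fun i s => hu (i, (3 : Fin 4)) s
  have hne : ∀ i : Fin g, i.val ≠ 0 → ∀ s,
      u ((finRotate g i, (0 : Fin 4)), s) = u ((i, (0 : Fin 4)), s) := fun i hi s => by
    have e : ∀ r, v (i, r) = 1 := fun r => handle_ne_zero hi r
    have h3 := s3 i s
    have h2 := s2 i s
    have h1 := s1 i s
    have h0 := s0 i s
    rw [e] at h0 h1 h2 h3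
    exact h3.trans (h2.trans (h1.trans h0))
  obtain ⟨g', rfl⟩ : ∃ g', g = g' + 2 := ⟨g - 2, by omega⟩
  -- Along the four sides of the first handle the sheet changes by the commutator of the
  -- monodromies, which is ζ. The other handles lead back to side 0 without a change of sheet, so
  -- the polygon through s also passes through ζ s.
  have hz : ∀ s, u ((1, (0 : Fin 4)), ζ s) = u ((0, (0 : Fin 4)), s) := fun s => by
    have e : ∀ r, v (0, r) = ![monodromyE m, monodromyF m, (monodromyE m)⁻¹, (monodromyF m)⁻¹] r :=
      fun r => handle_zero rfl r
    rw [← s0 0, ← s1 0, ← s2 0, ← s3 0]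
    have e1 : finRotate (g' + 2) 0 = 1 := by
      rw [finRotate_apply, zero_add]
    rw [e1, e, e, e, e]
    refine congrArg (fun s => u ((1, 0), s)) ?_
    obtain ⟨l, j⟩ := s
    change _ = (monodromyF m)⁻¹ ((monodromyE m)⁻¹ (l + 1, j + (l + 1)))
    rw [monodromyE_inv_apply, monodromyF_inv_apply]
    change (l, j + 1) = _
    refine Prod.ext ?_ ?_ <;> ring
  have hn : ∀ (n : ℕ) (hn : n + 1 < g' + 2) s,
      u ((⟨n + 1, hn⟩, (0 : Fin 4)), s) = u ((1, (0 : Fin 4)), s) := fun n => by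
    induction n with
    | zero => exact fun _ _ => rfl
    | succ n ih =>
      intro hn s
      rw [← ih (by omega), ← hne ⟨n + 1, by omega⟩ (by simp), finRotate_of_lt (by omega)]
  have hlast : ∀ s, u ((0, (0 : Fin 4)), s) = u ((1, (0 : Fin 4)), s) := fun s => by
    rw [← hn g' (by omega), ← hne ⟨g' + 1, by omega⟩ (by simp)]
    congr 3
    exact finRotate_last.symm
  have hall : ∀ (i : Fin (g' + 2)) s, u ((i, (0 : Fin 4)), s) = u ((1, (0 : Fin 4)), s) := by
    rintro ⟨n, hn'⟩ s
    cases n with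
    | zero => exact hlast s
    | succ n => exact hn n hn' s
  have p0 : ∀ (i : Fin (g' + 2)) s, u ((i, (0 : Fin 4)), ζ s) = u ((i, (0 : Fin 4)), s) :=
    fun i s => by rw [hall, hz, hall 0, hall i]
  have step : ∀ (d d' : Fin (g' + 2) × Fin 4), (∀ s, u (d', v d s) = u (d, s)) →
      (∀ s, u (d, ζ s) = u (d, s)) → ∀ s, u (d', ζ s) = u (d', s) := fun d d' h1 h2 s => by
    obtain ⟨s, rfl⟩ := (v d).surjective s
    rw [hv, h1, h1, h2]
  have p1 : ∀ (i : Fin (g' + 2)) s, u ((i, (1 : Fin 4)), ζ s) = u ((i, (1 : Fin 4)), s) :=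
    fun i => step _ _ (s0 i) (p0 i)
  have p2 : ∀ (i : Fin (g' + 2)) s, u ((i, (2 : Fin 4)), ζ s) = u ((i, (2 : Fin 4)), s) :=
    fun i => step _ _ (s1 i) (p1 i)
  have p3 : ∀ (i : Fin (g' + 2)) s, u ((i, (3 : Fin 4)), ζ s) = u ((i, (3 : Fin 4)), s) :=
    fun i => step _ _ (s2 i) (p2 i)
  have hp : ∀ (d : Fin (g' + 2) × Fin 4) s, u (d, ζ s) = u (d, s) := by
    rintro ⟨i, r⟩ s
    fin_cases r
    · exact p0 i s
    · exact p1 i s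
    · exact p2 i s
    · exact p3 i s
  rw [hc, hc]
  congr 1
  · exact hp d (l, j)
  · exact (congrArg (fun s => u (_, s)) (hv d (l, j))).symm.trans (hp _ _)

end CyclesZ

/-! ### Fourier coefficients of rational functions on ℤ/m. -/

section Fourier

variable (m : ℕ) [NeZero m]

/-- The `ζ_m⁻¹`-component of the Fourier transform of a rational function on `ℤ/m`. -/
noncomputable def charCoeff : (ZMod m → ℚ) →ₗ[ℚ] CyclotomicField m ℚ where
  toFun f := ∑ j, (f j : CyclotomicField m ℚ) * rootChar m (-j)
  map_add' f f' := by simp [add_mul, Finset.sum_add_distrib]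
  map_smul' r f := by
    refine Eq.trans ?_ (Algebra.smul_def _ _).symm
    rw [eq_ratCast, Finset.mul_sum]
    simp [mul_assoc]

theorem charCoeff_apply (f : ZMod m → ℚ) :
    charCoeff m f = ∑ j, (f j : CyclotomicField m ℚ) * rootChar m (-j) := rfl

theorem charCoeff_shift (f : ZMod m → ℚ) (a : ZMod m) :
    charCoeff m (fun j => f (j - a)) = rootChar m (-a) * charCoeff m f := by
  rw [charCoeff_apply, charCoeff_apply, Finset.mul_sum]
  refine Fintype.sum_equiv (Equiv.subRight a) _ _ fun j => ?_
  rw [Equiv.subRight_apply, mul_left_comm, ← AddChar.map_add_eq_mul]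
  congr 2
  ring

theorem charCoeff_const (hm : 2 ≤ m) (r : ℚ) : charCoeff m (fun _ => r) = 0 := by
  have : Fact (1 < m) := ⟨hm⟩
  have h := sum_rootChar_mul m (-1)
  rw [if_neg (neg_ne_zero.2 one_ne_zero)] at h
  rw [charCoeff_apply, ← Finset.mul_sum]
  simp only [mul_neg, mul_one] at h
  rw [h, mul_zero]

theorem charCoeff_trace (κ : CyclotomicField m ℚ) :
    charCoeff m (fun j => Algebra.trace ℚ (CyclotomicField m ℚ) (κ * rootChar m j) / m) = κ := by
  have hm : (m : CyclotomicField m ℚ) ≠ 0 := Nat.cast_ne_zero.2 (NeZero.ne m)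
  simp only [charCoeff_apply, Rat.cast_div, Rat.cast_natCast, div_mul_eq_mul_div,
    ← Finset.sum_div]
  rw [div_eq_iff hm, mul_comm κ, ← sum_trace_mul_rootChar m κ]

/-- Convolution with the idempotent retains only the order-m part of f, so the result is determined
by the one coefficient `charCoeff m f`. -/
theorem sum_idemCoeff_mul (f : ZMod m → ℚ) (j : ZMod m) :
    ∑ q, idemCoeff m q * f (j - q) =
      Algebra.trace ℚ (CyclotomicField m ℚ) (charCoeff m f * rootChar m j) / m := by
  rw [charCoeff_apply, Finset.sum_mul, map_sum, Finset.sum_div]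
  refine Fintype.sum_equiv (Equiv.subLeft j) _ _ fun q => ?_
  rw [Equiv.subLeft_apply, mul_assoc, ← AddChar.map_add_eq_mul, trace_ratCast_mul, idemCoeff]
  have h : -(j - q) + j = q := by ring
  rw [h]
  ring

end Fourier

/-! ### The Fourier transform of H₁(Z; ℚ) and the vertex conditions. -/

section DimensionN

open PolySurface

variable (g m : ℕ) [NeZero m]

/-- The Fourier coefficients of a chain of `Z` on the lifts of the edges `e_i` and `f_i`. -/
noncomputable def chainFourier : ((Fin g × Fin 4) × (ZMod m × ZMod m) → ℚ) →ₗ[ℚ]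
    ((Fin g × Fin 2) × ZMod m → CyclotomicField m ℚ) :=
  LinearMap.pi fun p => charCoeff m ∘ₗ
    LinearMap.funLeft ℚ ℚ fun j => ((p.1.1, Fin.castLE (by decide) p.1.2), (p.2, j))

theorem chainFourier_apply (c : (Fin g × Fin 4) × (ZMod m × ZMod m) → ℚ)
    (p : (Fin g × Fin 2) × ZMod m) : chainFourier g m c p =
      charCoeff m fun j => c ((p.1.1, Fin.castLE (by decide) p.1.2), (p.2, j)) := rfl

variable {g} in
-- A boundary is constant along each ζ-orbit, and a nontrivial character sums to zero against
-- constants.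
theorem chainFourier_boundary (hg : 2 ≤ g) (hm : 2 ≤ m)
    {c : (Fin g × Fin 4) × (ZMod m × ZMod m) → ℚ} (hc : c ∈ (surfaceZ g m).boundaries ℚ) :
    chainFourier g m c = 0 := by
  ext p
  rw [chainFourier_apply]
  have h : ∀ d l j, c (d, (l, j)) = c (d, (l, 0)) := fun d l j => by
    have h' : ∀ n : ℕ, c (d, (l, (n : ZMod m))) = c (d, (l, 0)) := fun n => by
      induction n with
      | zero => simp
      | succ n ih => rw [Nat.cast_succ, boundaries_surfaceZ_invariant hg hc, ih]
    rw [← h' j.val, ZMod.natCast_zmod_val]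
  simp only [h _ _ _]
  exact charCoeff_const m hm _

variable {g m} in
/-- The Fourier coefficients of a class in `H₁(Z; ℚ)`. -/
noncomputable def homologyFourier (hg : 2 ≤ g) (hm : 2 ≤ m) : (surfaceZ g m).H1 ℚ →ₗ[ℚ]
    ((Fin g × Fin 2) × ZMod m → CyclotomicField m ℚ) :=
  Submodule.liftQ _ ((chainFourier g m) ∘ₗ ((surfaceZ g m).cycles ℚ).subtype) fun _ hc =>
    chainFourier_boundary m hg hm hc

variable {g m}

theorem homologyFourier_mk (hg : 2 ≤ g) (hm : 2 ≤ m) (c : (surfaceZ g m).cycles ℚ) :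
    homologyFourier hg hm (Submodule.Quotient.mk c) = chainFourier g m c.1 := rfl

theorem repZ_mk (q : CycQ m) (c : (surfaceZ g m).cycles ℚ) :
    ∃ c' : (surfaceZ g m).cycles ℚ,
      repZ g m ℚ q (Submodule.Quotient.mk c) = Submodule.Quotient.mk c' ∧
      ∀ (d : Fin g × Fin 4) (l j : ZMod m), c'.1 (d, (l, j)) = c.1 (d, (l, j - q.toAdd)) := by
  refine ⟨_, rfl, fun d l j => ?_⟩
  change c.1 (d, (l, -q.toAdd + j)) = _
  rw [neg_add_eq_sub]

theorem homologyFourier_repZ (hg : 2 ≤ g) (hm : 2 ≤ m) (q : CycQ m) (x : (surfaceZ g m).H1 ℚ) :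
    homologyFourier hg hm (repZ g m ℚ q x) =
      rootChar m (-q.toAdd) • homologyFourier hg hm x := by
  refine Submodule.Quotient.induction_on _ x fun c => ?_
  obtain ⟨c', h, hc'⟩ := repZ_mk q c
  rw [h, homologyFourier_mk, homologyFourier_mk]
  ext p
  rw [Pi.smul_apply, smul_eq_mul]
  refine (congrArg (charCoeff m) (funext fun j => hc' _ _ j)).trans ?_
  exact charCoeff_shift m
    (fun j => c.1 ((p.1.1, Fin.castLE (by decide) p.1.2), (p.2, j))) q.toAdd

theorem homologyFourier_asAlgebraHom (hg : 2 ≤ g) (hm : 2 ≤ m) (a : MonoidAlgebra ℚ (CycQ m))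
    (x : (surfaceZ g m).H1 ℚ) : homologyFourier hg hm ((repZ g m ℚ).asAlgebraHom a x) =
      cycAlg m a • homologyFourier hg hm x := by
  rw [← MonoidAlgebra.sum_single_coeff a]
  simp only [map_sum, LinearMap.sum_apply, Finset.sum_smul]
  refine Finset.sum_congr rfl fun q _ => ?_
  rw [Representation.asAlgebraHom_single, LinearMap.smul_apply, map_smul, homologyFourier_repZ,
    cycAlg_single]
  ext p
  rw [Pi.smul_apply, Pi.smul_apply, Pi.smul_apply, smul_eq_mul, smul_eq_mul, mul_assoc]
  exact (Algebra.smul_def _ _).trans (congrArg (· * _) (eq_ratCast _ _))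

/-- A class of `N_m` is determined by its Fourier coefficients. -/
theorem homologyFourier_injOn (hg : 2 ≤ g) (hm : 2 ≤ m) :
    Set.InjOn (homologyFourier hg hm) (topN g m ℚ) := by
  intro x hx x' hx' hxx
  rw [← sub_eq_zero]
  have hy : x - x' ∈ topN g m ℚ := Submodule.sub_mem _ hx hx'
  have h0 : homologyFourier hg hm (x - x') = 0 := by rw [map_sub, hxx, sub_self]
  generalize x - x' = y at hy h0
  -- On N_m the idempotent acts as 1, so y is also represented by the idempotent average of any
  -- representing cycle. The coefficients of this average depend only on the Fourier coefficients of
  -- the original cycle, so it is the zero cycle.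
  have hy' := sum_smul_pow_eq_zero_of_rootChar m (k := ℚ) (repZ g m ℚ (CycQ.zeta m))
    (LinearMap.mem_ker.1 hy) _ _ (sum_idemCoeff_sub_one m)
  rw [Fintype.sum_option] at hy'
  simp only [Option.elim_none, Option.elim_some, id, ZMod.val_zero, pow_zero, ← map_pow,
    CycQ.zeta_pow, Algebra.algebraMap_self, RingHom.id_apply, Module.End.one_apply,
    neg_one_smul, neg_add_eq_zero] at hy'
  obtain ⟨c, rfl⟩ := Submodule.mkQ_surjective _ y
  choose c' hc' hcc using fun q : ZMod m => repZ_mk (Multiplicative.ofAdd q) c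
  rw [hy']
  have h1 : ∑ q, idemCoeff m q • repZ g m ℚ (Multiplicative.ofAdd q) (Submodule.mkQ _ c) =
      Submodule.mkQ _ (∑ q, idemCoeff m q • c' q) := by
    rw [map_sum]
    exact Finset.sum_congr rfl fun q _ => congrArg (idemCoeff m q • ·) (hc' q)
  rw [h1]
  have hs : ∀ (d : Fin g × Fin 4) (l j : ZMod m), (∑ q, idemCoeff m q • c' q).1 (d, (l, j)) =
      Algebra.trace ℚ (CyclotomicField m ℚ)
        (charCoeff m (fun j => c.1 (d, (l, j))) * rootChar m j) / m := fun d l j => by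
    rw [← sum_idemCoeff_mul]
    refine (map_sum ((LinearMap.proj (R := ℚ) (φ := fun _ => ℚ) (d, (l, j))).comp
        ((surfaceZ g m).cycles ℚ).subtype) (fun q => idemCoeff m q • c' q) Finset.univ).trans ?_
    exact Finset.sum_congr rfl fun q _ => congrArg (idemCoeff m q * ·) (hcc q d l j)
  have h2 : ∀ (i : Fin g) (r : Fin 2) (s : ZMod m × ZMod m),
      (∑ q, idemCoeff m q • c' q).1 ((i, Fin.castLE (by decide) r), s) = 0 := fun i r s => by
    refine (hs _ s.1 s.2).trans ?_
    have h3 : charCoeff m (fun j => c.1 ((i, Fin.castLE (by decide) r), (s.1, j))) = 0 :=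
      congrFun h0 ((i, r), s.1)
    rw [h3, zero_mul, map_zero, zero_div]
  have h3 := (mem_cycles_surfaceZ (i0 := ⟨0, by omega⟩) rfl).1 (∑ q, idemCoeff m q • c' q).2
  have h4 : ∑ q, idemCoeff m q • c' q = 0 := by
    refine Subtype.ext (funext ?_)
    rintro ⟨⟨i, r⟩, s⟩
    fin_cases r
    · exact h2 i 0 s
    · exact h2 i 1 s
    · exact (h3.1 i s).trans (neg_eq_zero.2 (h2 i 0 _))
    · exact (h3.2.1 i s).trans (neg_eq_zero.2 (h2 i 1 _))
  rw [h4, map_zero]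

/-- The condition for Fourier coefficients to be those of a cycle. -/
noncomputable def vertexMap (i0 : Fin g) :
    ((Fin g × Fin 2) × ZMod m → CyclotomicField m ℚ) →ₗ[CyclotomicField m ℚ]
      (ZMod m → CyclotomicField m ℚ) where
  toFun X l := X ((i0, 0), l) - X ((i0, 0), l - 1) + (1 - rootChar m (-l)) * X ((i0, 1), l)
  map_add' X X' := by
    ext l
    simp only [Pi.add_apply]
    ring
  map_smul' r X := by
    ext l
    simp only [Pi.smul_apply, smul_eq_mul, RingHom.id_apply]
    ring

theorem vertexMap_apply (i0 : Fin g) (X : (Fin g × Fin 2) × ZMod m → CyclotomicField m ℚ)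
    (l : ZMod m) : vertexMap i0 X l =
      X ((i0, 0), l) - X ((i0, 0), l - 1) + (1 - rootChar m (-l)) * X ((i0, 1), l) := rfl

/-- For l ≠ 0 the factor 1 - ζ_m^(-l) is invertible and the f₁-coordinate solves the equation. At l
= 0 this factor vanishes, and an e₁-coordinate supported at 0 supplies w 0; here -1 ≠ 0 in ℤ/m is
used. -/
theorem vertexMap_surjective (hm : 2 ≤ m) (i0 : Fin g) :
    Function.Surjective (vertexMap (m := m) i0) := by
  classical
  have : Fact (1 < m) := ⟨hm⟩
  intro w
  let u : ZMod m → CyclotomicField m ℚ := fun l => if l = 0 then w 0 else 0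
  -- At l = 0 the division is by 0; its default value is immaterial because it is multiplied by 1 -
  -- 1 = 0.
  let X : (Fin g × Fin 2) × ZMod m → CyclotomicField m ℚ := fun p =>
    if p.1.2 = 0 then u p.2
    else (w p.2 - u p.2 + u (p.2 - 1)) / (1 - rootChar m (-p.2))
  refine ⟨X, funext fun l => ?_⟩
  have h0 : ∀ l, X ((i0, 0), l) = u l := fun l => if_pos rfl
  have h1 : ∀ l, X ((i0, 1), l) = (w l - u l + u (l - 1)) / (1 - rootChar m (-l)) :=
    fun l => if_neg (by decide : ¬ (1 : Fin 2) = 0)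
  rw [vertexMap_apply, h0, h0, h1]
  by_cases hl : l = 0
  · subst hl
    simp [u]
  · have hne : 1 - rootChar m (-l) ≠ 0 := fun h =>
      hl (neg_eq_zero.1 (rootChar_eq_one m (sub_eq_zero.1 h).symm))
    rw [mul_div_cancel₀ _ hne]
    ring

theorem finrank_ker_vertexMap (hm : 2 ≤ m) (i0 : Fin g) :
    Module.finrank (CyclotomicField m ℚ) (LinearMap.ker (vertexMap (m := m) i0)) =
      (2 * g - 1) * m := by
  have h := LinearMap.finrank_range_add_finrank_ker (vertexMap (m := m) i0)
  rw [LinearMap.range_eq_top.2 (vertexMap_surjective hm i0), finrank_top,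
    Module.finrank_fintype_fun_eq_card, Module.finrank_fintype_fun_eq_card, ZMod.card,
    Fintype.card_prod, Fintype.card_prod, Fintype.card_fin, Fintype.card_fin, ZMod.card] at h
  rw [Nat.sub_mul, one_mul, mul_comm 2 g]
  omega

/-- This is the Fourier transform in j of the vertex condition at (l, j): the shift j ↦ j - l along
f₁ becomes the factor ζ_m^(-l). -/
theorem vertexMap_homologyFourier (hg : 2 ≤ g) (hm : 2 ≤ m) {i0 : Fin g} (hi0 : i0.val = 0)
    (x : (surfaceZ g m).H1 ℚ) : vertexMap i0 (homologyFourier hg hm x) = 0 := by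
  refine Submodule.Quotient.induction_on _ x fun c => ?_
  have h := ((mem_cycles_surfaceZ hi0).1 c.2).2.2
  rw [homologyFourier_mk]
  ext l
  have e0 : ∀ l, chainFourier g m c.1 ((i0, 0), l) =
    charCoeff m fun j => c.1 ((i0, 0), (l, j)) := fun _ => rfl
  have e1 : ∀ l, chainFourier g m c.1 ((i0, 1), l) =
    charCoeff m fun j => c.1 ((i0, 1), (l, j)) := fun _ => rfl
  rw [vertexMap_apply, e0, e0, e1, sub_mul, one_mul,
    ← charCoeff_shift m (fun j => c.1 ((i0, 1), (l, j))), ← add_sub_assoc, ← map_sub, ← map_add,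
    ← map_sub]
  exact (congrArg (charCoeff m) (funext fun j => h l j)).trans (map_zero _)

theorem exists_homologyFourier_eq (hg : 2 ≤ g) (hm : 2 ≤ m) {i0 : Fin g} (hi0 : i0.val = 0)
    {X : (Fin g × Fin 2) × ZMod m → CyclotomicField m ℚ} (hX : vertexMap i0 X = 0) :
    ∃ x, homologyFourier hg hm x = X := by
  let T : CyclotomicField m ℚ → ZMod m → ℚ := fun κ j =>
    Algebra.trace ℚ (CyclotomicField m ℚ) (κ * rootChar m j) / m
  let v : Fin g × Fin 4 → Equiv.Perm (ZMod m × ZMod m) := handle g (monodromyE m) (monodromyF m)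
  let e : Fin g → Fin 2 → ZMod m × ZMod m → ℚ := fun i r s => T (X ((i, r), s.1)) s.2
  -- The inverse transform gives the values on the lifts of e and f; those on e⁻¹ and f⁻¹ are then
  -- forced by antisymmetry under `rev`.
  let c : (Fin g × Fin 4) × (ZMod m × ZMod m) → ℚ := fun p =>
    ![e p.1.1 0 p.2, e p.1.1 1 p.2, -e p.1.1 0 ((v (p.1.1, 0))⁻¹ p.2),
      -e p.1.1 1 ((v (p.1.1, 1))⁻¹ p.2)] p.1.2
  have hc : c ∈ (surfaceZ g m).cycles ℚ := by
    refine (mem_cycles_surfaceZ hi0).2 ⟨fun _ _ => rfl, fun _ _ => rfl, fun l j => ?_⟩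
    change T (X ((i0, 0), l)) j - T (X ((i0, 0), l - 1)) j + T (X ((i0, 1), l)) j -
      T (X ((i0, 1), l)) (j - l) = 0
    simp only [T]
    rw [← sub_div, ← add_div, ← sub_div, ← map_sub, ← map_add, ← map_sub]
    have h := congrFun hX l
    rw [vertexMap_apply, Pi.zero_apply] at h
    have h2 : rootChar m (j - l) = rootChar m j * rootChar m (-l) := by
      rw [← AddChar.map_add_eq_mul, sub_eq_add_neg]
    have h3 : X ((i0, 0), l) * rootChar m j - X ((i0, 0), l - 1) * rootChar m j +
        X ((i0, 1), l) * rootChar m j - X ((i0, 1), l) * rootChar m (j - l) = 0 := by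
      rw [h2]
      linear_combination rootChar m j * h
    rw [h3, map_zero, zero_div]
  refine ⟨Submodule.Quotient.mk ⟨c, hc⟩, funext ?_⟩
  rintro ⟨⟨i, r⟩, l⟩
  fin_cases r
  · exact charCoeff_trace m (X ((i, 0), l))
  · exact charCoeff_trace m (X ((i, 1), l))

theorem coe_asAlgebraHom_topNRep (a : MonoidAlgebra ℚ (CycQ m)) (n : topN g m ℚ) :
    ((topNRep g m ℚ).asAlgebraHom a n : (surfaceZ g m).H1 ℚ) =
      (repZ g m ℚ).asAlgebraHom a n := by
  rw [← MonoidAlgebra.sum_single_coeff a]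
  simp only [map_sum, LinearMap.sum_apply, Representation.asAlgebraHom_single,
    LinearMap.smul_apply, Submodule.coe_sum, Submodule.coe_smul]
  rfl

theorem asAlgebraHom_mem_topN {a : MonoidAlgebra ℚ (CycQ m)}
    (ha : a ∈ topFactor ℚ (CycQ.zeta m) m) (x : (surfaceZ g m).H1 ℚ) :
    (repZ g m ℚ).asAlgebraHom a x ∈ topN g m ℚ := by
  change aeval (repZ g m ℚ (CycQ.zeta m)) (cyclotomic m ℚ) _ = 0
  have h : aeval (MonoidAlgebra.of ℚ _ (CycQ.zeta m)) (cyclotomic m ℚ) * a = 0 := ha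
  have h2 := congrArg (fun b => (repZ g m ℚ).asAlgebraHom b x) h
  simp only [map_mul, map_zero, Module.End.mul_apply, LinearMap.zero_apply,
    ← aeval_algHom_apply, Representation.asAlgebraHom_of] at h2
  exact h2

/-- `N_m` has a basis with `(2 g - 1) m` elements over `ℚ(ζ_m)`. -/
theorem exists_cyc_basis_topN (hg : 2 ≤ g) (hm : 2 ≤ m)
    (hρ : aeval (topNRep g m ℚ (CycQ.zeta m)) (cyclotomic m ℚ) = 0) :
    ∃ y : Fin (2 * g - 1) × ZMod m → topN g m ℚ,
      Function.Bijective fun κ : Fin (2 * g - 1) × ZMod m → CyclotomicField m ℚ =>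
        ∑ p, cycAction hρ (κ p) (y p) := by
  classical
  let i0 : Fin g := ⟨0, by omega⟩
  have hΘ : ∀ κ (n : topN g m ℚ), homologyFourier hg hm (cycAction hρ κ n) =
      κ • homologyFourier hg hm n := fun κ n => by
    obtain ⟨a, -, rfl⟩ := (cycAlg_bijOn m).surjOn (Set.mem_univ κ)
    rw [cycAction_cycAlg, coe_asAlgebraHom_topNRep, homologyFourier_asAlgebraHom]
  -- A class with Fourier coefficients X is moved into N_m by the element of the simple factor over
  -- 1 ∈ ℚ(ζ_m), which leaves X unchanged.
  have hex : ∀ X : LinearMap.ker (vertexMap (m := m) i0),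
      ∃ n : topN g m ℚ, homologyFourier hg hm n = X.1 := fun X => by
    obtain ⟨x, hx⟩ := exists_homologyFourier_eq hg hm (i0 := i0) rfl (LinearMap.mem_ker.1 X.2)
    obtain ⟨a, ha, ha1⟩ := (cycAlg_bijOn m).surjOn (Set.mem_univ 1)
    refine ⟨⟨_, asAlgebraHom_mem_topN ha x⟩, ?_⟩
    rw [homologyFourier_asAlgebraHom, ha1, one_smul, hx]
  let e : (Fin (2 * g - 1) × ZMod m → CyclotomicField m ℚ) ≃ₗ[CyclotomicField m ℚ]
      LinearMap.ker (vertexMap (m := m) i0) := LinearEquiv.ofFinrankEq _ _ (by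
    rw [finrank_ker_vertexMap hm, Module.finrank_fintype_fun_eq_card, Fintype.card_prod,
      Fintype.card_fin, ZMod.card])
  choose y hy using fun p => hex (e (Pi.single p 1))
  have key : ∀ κ : Fin (2 * g - 1) × ZMod m → CyclotomicField m ℚ,
      homologyFourier hg hm (∑ p, cycAction hρ (κ p) (y p) : topN g m ℚ) = (e κ).1 := fun κ => by
    rw [Submodule.coe_sum, map_sum]
    simp only [hΘ, hy]
    conv_rhs => rw [pi_eq_sum_univ' κ, map_sum, Submodule.coe_sum]
    refine Finset.sum_congr rfl fun p _ => ?_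
    rw [← Submodule.coe_smul, ← map_smul]
  refine ⟨y, fun κ κ' h => ?_, fun n => ?_⟩
  · refine e.injective (Subtype.ext ?_)
    rw [← key, ← key]
    exact congrArg (fun n : topN g m ℚ => homologyFourier hg hm n) h
  · obtain ⟨κ, hκ⟩ := e.surjective
      ⟨homologyFourier hg hm n, LinearMap.mem_ker.2 (vertexMap_homologyFourier hg hm rfl _)⟩
    refine ⟨κ, Subtype.ext (homologyFourier_injOn hg hm (Subtype.mem _) n.2 ?_)⟩
    rw [key, hκ]

end DimensionN

/-! ### The main theorem -/

theorem matrixUnitary_smul {m : ℕ} [NeZero m] {ι : Type} [Fintype ι] [DecidableEq ι]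
    {κ : CyclotomicField m ℚ} (hκ : κ ≠ 0) (S : Matrix ι ι (CyclotomicField m ℚ)) :
    matrixUnitary m (κ • S) = matrixUnitary m S := by
  ext A
  change A.1.transpose * (κ • S) * A.1.map (cycConj m) = κ • S ↔
    A.1.transpose * S * A.1.map (cycConj m) = S
  rw [Matrix.mul_smul, Matrix.smul_mul]
  exact (smul_right_injective _ hκ).eq_iff

theorem mainTheorem7 (g m : ℕ) [NeZero m] (hg : 2 ≤ g) (hm : 2 ≤ m) :
    (∀ (k : Type) [CommRing k] [Algebra ℚ k],
      Set.BijOn ((coverWZ g m).transfer k) (topN g m k)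
        {x | x ∈ topM g m k ∧ repW g m k (Heis.tau m) x = x}) ∧
    ∃ α : ∀ (k : Type) [CommRing k] [Algebra ℚ k], GroupG g m k ≃* GroupGnn g m k,
      -- `α` is the restriction to the `τ`-invariants
      (∀ (k : Type) [CommRing k] [Algebra ℚ k] (f : GroupG g m k) (n : topN g m k)
        (x : topM g m k), (x : (surfaceW g m).H1 k) = (coverWZ g m).transfer k n →
          (coverWZ g m).transfer k ((α k f).1 n) = f.1 x) ∧
      -- `α` is natural in the `ℚ`-algebra `k`
      (∀ (k k' : Type) [CommRing k] [Algebra ℚ k] [CommRing k'] [Algebra ℚ k'] (φ : k →ₐ[ℚ] k')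
        (f : GroupG g m k) (f' : GroupG g m k'),
        (∀ (x : topM g m k) (x' : topM g m k'),
          (x' : (surfaceW g m).H1 k') = (surfaceW g m).mapCoeff φ.toRingHom x →
          (f'.1 x' : (surfaceW g m).H1 k') = (surfaceW g m).mapCoeff φ.toRingHom (f.1 x)) →
        ∀ (n : topN g m k) (n' : topN g m k'),
          (n' : (surfaceZ g m).H1 k') = (surfaceZ g m).mapCoeff φ.toRingHom n →
          ((α k' f').1 n' : (surfaceZ g m).H1 k') =
            (surfaceZ g m).mapCoeff φ.toRingHom ((α k f).1 n)) ∧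
      -- the simple factors of the group algebras
      Set.BijOn (heisAlg m) (topFactor ℚ (Heis.zeta m) m) Set.univ ∧
      Set.BijOn (cycAlg m) (topFactor ℚ (CycQ.zeta m) m) Set.univ ∧
      -- `M_m` is free of rank `2 g - 1`, and the two Gram matrices define the same unitary group
      (∃ x : Fin (2 * g - 1) → topM g m ℚ, IsFactorBasis (topMRep g m ℚ) (Heis.zeta m) m x) ∧
      ∀ x : Fin (2 * g - 1) → topM g m ℚ, IsFactorBasis (topMRep g m ℚ) (Heis.zeta m) m x →
        ∃ y : Fin (2 * g - 1) × ZMod m → topN g m ℚ,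
          (∀ a i, ∀ e ∈ topFactor ℚ (Heis.zeta m) m, heisAlg m e = Matrix.single 0 i 1 →
            (coverWZ g m).transfer ℚ (y (a, i)) = (topMRep g m ℚ).asAlgebraHom e (x a)) ∧
          IsFactorBasis (topNRep g m ℚ) (CycQ.zeta m) m y ∧
          (∃ c : ℚ, c ≠ 0 ∧ gramH m g x = c • gramQ m g y) ∧
          matrixUnitary m (gramH m g x) = matrixUnitary m (gramQ m g y) ∧
          ∃ (μ : GroupG g m ℚ ≃* matrixUnitary m (gramH m g x))
            (ν : GroupGnn g m ℚ ≃* matrixUnitary m (gramQ m g y)),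
            (∀ f : GroupG g m ℚ,
              ∃ γ : Fin (2 * g - 1) → Fin (2 * g - 1) → topFactor ℚ (Heis.zeta m) m,
                (∀ b, f.1 (x b) = ∑ a, (topMRep g m ℚ).asAlgebraHom (γ a b).1 (x a)) ∧
                ∀ p q, (μ f).1.1 p q = heisAlg m (γ p.1 q.1).1 q.2 p.2) ∧
            (∀ f : GroupGnn g m ℚ,
              ∃ η : Fin (2 * g - 1) × ZMod m → Fin (2 * g - 1) × ZMod m →
                  topFactor ℚ (CycQ.zeta m) m,
                (∀ q, f.1 (y q) = ∑ p, (topNRep g m ℚ).asAlgebraHom (η p q).1 (y p)) ∧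
                ∀ p q, (ν f).1.1 p q = cycAlg m (η p q).1) ∧
            ∀ f : GroupG g m ℚ, (ν (α ℚ f)).1 = (μ f).1 := by

  have hm0 : (m : ℚ) ≠ 0 := Nat.cast_ne_zero.2 (NeZero.ne m)
  choose α hα using fun (k : Type) (_ : CommRing k) (_ : Algebra ℚ k) =>
    (isTauDescent_topTransfer g m k).exists_mulEquiv (topMForm_invariant g m k)
      (topMForm_topTransfer g m k)
  have hα' : ∀ (k : Type) [CommRing k] [Algebra ℚ k] (f : GroupG g m k) (n : topN g m k)
      (x : topM g m k), (x : (surfaceW g m).H1 k) = (coverWZ g m).transfer k n →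
        (coverWZ g m).transfer k ((α k _ _ f).1 n) = f.1 x := by
    intro k _ _ f n x hx
    have h : x = topTransfer g m k n := Subtype.ext hx
    rw [h]
    exact congrArg Subtype.val (hα k _ _ f n)
  refine ⟨fun k _ _ => transferWZ_bijOn g m k, fun k _ _ => α k _ _, hα', ?_, heisAlg_bijOn m,
    cycAlg_bijOn m, ?_, fun x hx => ?_⟩
  · intro k k' _ _ _ _ φ f f' hff n n' hn
    -- The transfer is injective and commutes with base change, so naturality of α follows from the
    -- compatibility of f' with f on M_m.
    apply transferWZ_injective g m k'
    rw [hα' k' f' n' (topTransfer g m k' n') rfl, ← PolySurface.mapCoeff_transfer,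
      hα' k f n (topTransfer g m k n) rfl]
    refine hff _ _ ?_
    rw [coe_topTransfer, coe_topTransfer, hn, PolySurface.mapCoeff_transfer]
  · obtain ⟨y, hy⟩ := exists_cyc_basis_topN hg hm (isTauDescent_topTransfer g m ℚ).cyclotomic_zeta'
    exact ⟨_, (isFactorBasis_iff (heisAlg_bijOn m)
      (isTauDescent_topTransfer g m ℚ).matAction_heisAlg _).2
        ((isTauDescent_topTransfer g m ℚ).bijective_sum_matAction hy)⟩
  · have H := isTauDescent_topTransfer g m ℚ
    have hxb := (isFactorBasis_iff (heisAlg_bijOn m) H.matAction_heisAlg x).1 hx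
    choose y hxy using fun p : Fin (2 * g - 1) × ZMod m => H.exists_matAction_single p.2 (x p.1)
    have hxy' : ∀ a i, topTransfer g m ℚ (y (a, i)) =
      H.matAction (Matrix.single 0 i 1) (x a) := fun a i => hxy (a, i)
    have hyb := H.bijective_sum_cycAction hxy' hxb
    have hgram : gramH m g x = ((m : CyclotomicField m ℚ) ^ 2) • gramQ m g y := by
      ext p q
      exact H.gram_eq (topMForm_invariant g m ℚ) (topMForm_topTransfer g m ℚ) hxy' p q
    have hU : matrixUnitary m (gramH m g x) = matrixUnitary m (gramQ m g y) := by
      rw [hgram]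
      exact matrixUnitary_smul (pow_ne_zero 2 (Nat.cast_ne_zero.2 (NeZero.ne m))) _
    obtain ⟨ν, hν⟩ := exists_mulEquiv_matrixUnitary H.cyclotomic_zeta'
      (H.form_zeta (topMForm_invariant g m ℚ) (topMForm_topTransfer g m ℚ)) hyb
    -- μ is defined as ν ∘ α, so the equality of the matrices of f and α(f) holds by construction.
    -- What has to be proved is that μ(f) is the matrix of f in the basis x; this is
    -- `matrix_restrict`.
    refine ⟨y, fun a i e he hei => ?_,
      (isFactorBasis_iff (cycAlg_bijOn m) (cycAction_cycAlg H.cyclotomic_zeta') y).2 hyb,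
      ⟨(m : ℚ) ^ 2, pow_ne_zero 2 hm0, ?_⟩, hU,
      ((α ℚ _ _).trans ν).trans (MulEquiv.subgroupCongr hU.symm), ν, fun f => ?_, fun f => ?_,
      fun f => rfl⟩
    · rw [← H.matAction_heisAlg, hei, ← hxy' a i, coe_topTransfer]
    · rw [hgram]
      ext p q
      refine Eq.trans ?_ (Algebra.smul_def ((m : ℚ) ^ 2) (gramQ m g y p q)).symm
      simp
    · choose c hc using fun b => hx.2 (f.1 (x b))
      refine ⟨fun a b => c b a, fun b => (hc b).symm, fun p q => ?_⟩
      refine H.matrix_restrict hxy' hyb (f := f.1.toLinearMap) f.2.1 (hα ℚ _ _ f)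
        (A := (ν (α ℚ _ _ f)).1.1) (hν _) (γ := fun a b => heisAlg m (c b a).1) (fun b => ?_) p q
      simp only [H.matAction_heisAlg]
      exact (hc b).symm
    · choose η hη hηc using fun p q =>
        (cycAlg_bijOn m).surjOn (Set.mem_univ ((ν f).1.1 p q))
      refine ⟨fun p q => ⟨η p q, hη p q⟩, fun q => ?_, fun p q => (hηc p q).symm⟩
      rw [hν]
      simp only [← cycAction_cycAlg H.cyclotomic_zeta', hηc]
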